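/- Let $X$ and $D$ be Banach spaces (over $\mathbb R$ or $\mathbb C$) with $D$ continuously and densely embedded into $X$, let $\tau>0$, and let $A(\cdot),P(\cdot):[0,\tau]\to\mathcal L(D,X)$ be bounded and strongly measurable (i.e. $t\mapsto A(t)x$ and $t\mapsto P(t)x$ are measurable for every $x\in D$). For $p\in(1,\infty)$ and $a<b$ put $\mathrm{MR}_p(a,b)=W^{1,p}(a,b;X)\cap L^p(a,b;D)$. A single operator $B\in\mathcal L(D,X)$ belongs to $\mathscr{MR}_p$ if for every bounded interval $(a,b)$ and every $f\in L^p(a,b;X)$ there is a unique $u\in \mathrm{MR}_p(a,b)$ with $\dot u(t)+Bu(t)=f(t)$ for a.e. $t\in[a,b]$ and $u(a)=0$; we write $B\in\mathscr{MR}$ if $B\in\mathscr{MR}_p$ for some (equivalently, all) $p\in(1,\infty)$. A family $B(\cdot):[0,\tau]\to\mathcal L(D,X)$ has maximal $L^q$-regularity on $[0,\tau]$, written $B(\cdot)\in\mathscr{MR}_q(0,\tau)$, if for every subinterval $[a,b]\subseteq[0,\tau]$, $a<b$, and every $f\in L^q(a,b;X)$ there is a unique $u\in\mathrm{MR}_q(a,b)$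 with $\dot u(t)+B(t)u(t)=f(t)$ for a.e. $t\in[a,b]$ and $u(a)=0$. Assume: **(H1)** $A(t)\in\mathscr{MR}$ for every $t\in[0,\tau]$, and for some $\nu\in(1,\infty)$ the family $A(\cdot)$ satisfies the relative $\nu$-Dini condition: there are $\eta\ge 0$ and a continuous $\omega:[0,\tau]\to[0,\infty)$ with $\omega(0)=0$ and $\int_0^\tau(\omega(t)/t)^\nu\,dt<\infty$ such that $\|A(t)x-A(s)x\|\le\omega(|t-s|)\|x\|_D+\eta\|x\|$ for all $x\in D$, $s,t\in[0,\tau]$. Let $U=(U(t,s))_{0\le s\le t\le\tau}$ be the evolution family associated with $A(\cdot)$; that is, for $x\in D$ and $s\in[0,\tau)$, $u=U(\cdot,s)x$ is the unique solution in $\mathrm{MR}_p(s,\tau)$ (for any $p\in(1,\infty)$) of $\dot u(t)+A(t)u(t)=0$ for a.e. $t\in[s,\tau]$, $u(s)=x$. **(H2)** There are $\mu\in(1,\infty)$ and $c>0$ such that for all $0\le s<\tau'<\tau$ and all $x\in D$, $$\Bigl(\int_s^{\tau'}\|P(t)U(t,s)x\|^\mu\,dt\Bigr)^{1/\mu}\le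 c\,\|x\|.$$ Then the perturbed family $A^P(\cdot)=A(\cdot)+P(\cdot)$ has maximal $L^q$-regularity on $[0,\tau]$, i.e. $A^P(\cdot)\in\mathscr{MR}_q(0,\tau)$, for every $q\in(1,\mu]$. -/

import Mathlib

open MeasureTheory Set
open scoped ContDiff

namespace MaxReg

variable {𝕜 : Type*} [RCLike 𝕜]
variable {X : Type*} [NormedAddCommGroup X] [NormedSpace 𝕜 X] [NormedSpace ℝ X]
variable {D : Type*} [NormedAddCommGroup D] [NormedSpace 𝕜 D]

/-- Lebesgue measure on the interval `(a, b)`. -/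
noncomputable abbrev vol (a b : ℝ) : Measure ℝ := volume.restrict (Ioo a b)

/-- `g` is the weak (distributional) derivative of `u` on `(a, b)`. -/
def HasWeakDeriv (a b : ℝ) (u g : ℝ → X) : Prop :=
  ∀ φ : ℝ → ℝ, ContDiff ℝ ∞ φ → HasCompactSupport φ → tsupport φ ⊆ Ioo a b →
    ∫ t, deriv φ t • u t ∂(vol a b) = - ∫ t, φ t • g t ∂(vol a b)

/-- `u ∈ MR_p(a,b) = W^{1,p}(a,b;X) ∩ L^p(a,b;D)`, where `D` is embedded in `X` through `J`.
The element is given by its continuous representative `u : [a,b] → X` (every element of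
`W^{1,p}(a,b;X)` has exactly one), by `v`, the same function seen as a function with values
in `D`, and by its weak derivative `g`. -/
structure MemMR (J : D →L[𝕜] X) (p a b : ℝ) (u : ℝ → X) (v : ℝ → D) (g : ℝ → X) : Prop where
  continuousOn : ContinuousOn u (Icc a b)
  memLp : MemLp u (ENNReal.ofReal p) (vol a b)
  memLp_deriv : MemLp g (ENNReal.ofReal p) (vol a b)
  hasWeakDeriv : HasWeakDeriv a b u g
  memLp_dom : MemLp v (ENNReal.ofReal p) (vol a b)
  embed_ae : ∀ᵐ t ∂(vol a b), J (v t) = u t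

/-- `u ∈ MR_p(a,b)` (with `v` the same function seen in `D`) solves
`u'(t) + A(t) u(t) = f(t)` for a.e. `t ∈ [a,b]`, `u(a) = x`. -/
def IsSolution (J : D →L[𝕜] X) (A : ℝ → D →L[𝕜] X) (p a b : ℝ) (f : ℝ → X) (x : X)
    (u : ℝ → X) (v : ℝ → D) : Prop :=
  ∃ g : ℝ → X, MemMR J p a b u v g ∧ (∀ᵐ t ∂(vol a b), g t + A t (v t) = f t) ∧ u a = x

/-- For every `f ∈ L^p(a,b;X)` there is a unique `u ∈ MR_p(a,b)` with
`u' + A(·) u = f` a.e. on `[a,b]` and `u(a) = 0`. -/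
def UniquelySolvable (J : D →L[𝕜] X) (A : ℝ → D →L[𝕜] X) (p a b : ℝ) : Prop :=
  ∀ f : ℝ → X, MemLp f (ENNReal.ofReal p) (vol a b) →
    ∃ u v, IsSolution J A p a b f 0 u v ∧
      ∀ u' v', IsSolution J A p a b f 0 u' v' → EqOn u' u (Icc a b)

/-- A single operator `A ∈ L(D,X)` has maximal `L^p`-regularity. -/
def SingleMRp (J : D →L[𝕜] X) (p : ℝ) (A : D →L[𝕜] X) : Prop :=
  ∀ a b : ℝ, a < b → UniquelySolvable J (fun _ => A) p a b

/-- A single operator has maximal regularity: maximal `L^p`-regularity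
for some `p ∈ (1,∞)`. -/
def SingleMR (J : D →L[𝕜] X) (A : D →L[𝕜] X) : Prop :=
  ∃ p : ℝ, 1 < p ∧ SingleMRp J p A

/-- The family `A(·)` has maximal `L^p`-regularity on `[0,τ]`: unique solvability on
every subinterval `[a,b]`. -/
def FamilyMR (J : D →L[𝕜] X) (p τ : ℝ) (A : ℝ → D →L[𝕜] X) : Prop :=
  ∀ a b : ℝ, 0 ≤ a → a < b → b ≤ τ → UniquelySolvable J A p a b

/-- `A(·) : [0,τ] → L(D,X)` is strongly measurable (each orbit `A(·)x` is measurable)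
and bounded. -/
def StronglyMeasurableBounded (τ : ℝ) (A : ℝ → D →L[𝕜] X) : Prop :=
  (∀ x : D, AEStronglyMeasurable (fun t => A t x) (volume.restrict (Icc 0 τ))) ∧
    ∃ M : ℝ, ∀ t ∈ Icc 0 τ, ‖A t‖ ≤ M

/-- The relative `ν`-Dini condition on `[0,τ]`. -/
def RelativeDini (J : D →L[𝕜] X) (ν τ : ℝ) (A : ℝ → D →L[𝕜] X) : Prop :=
  ∃ η : ℝ, 0 ≤ η ∧ ∃ w : ℝ → ℝ,
    ContinuousOn w (Icc 0 τ) ∧ (∀ t ∈ Icc 0 τ, 0 ≤ w t) ∧ w 0 = 0 ∧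
    Integrable (fun t => (w t / t) ^ ν) (vol 0 τ) ∧
    ∀ x : D, ∀ s ∈ Icc 0 τ, ∀ t ∈ Icc 0 τ,
      ‖A t x - A s x‖ ≤ w |t - s| * ‖x‖ + η * ‖J x‖

/-- Condition (H1). -/
def H1 (J : D →L[𝕜] X) (τ : ℝ) (A : ℝ → D →L[𝕜] X) : Prop :=
  (∀ t ∈ Icc 0 τ, SingleMR J (A t)) ∧ ∃ ν : ℝ, 1 < ν ∧ RelativeDini J ν τ A

open Classical in
/-- The evolution family `U(t,s)` of `A(·)` on `D`: for `x ∈ D`, the function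
`t ↦ U(t,s)x` on `[s,τ]` is the solution, in some `MR_p(s,τ)` with `1 < p < ∞`, of
`u' + A(·)u = 0` a.e., `u(s) = x`. It is recorded with values in `D` (so it is determined
for a.e. `t`). The value `0` is a default for the case that there is no such solution; this does
not happen for families satisfying (H1), for which moreover the solution does not
depend on `p`. -/
noncomputable def evolutionFamily (J : D →L[𝕜] X) (A : ℝ → D →L[𝕜] X) (τ : ℝ)
    (t s : ℝ) (x : D) : D :=
  if h : ∃ v : ℝ → D, ∃ (p : ℝ) (u : ℝ → X), 1 < p ∧
      IsSolution J A p s τ (fun _ => 0) (J x) u v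
  then h.choose t else 0

/-- Condition (H2) with exponent `μ`: the map `P(·)U(·,s)` is `L^μ`-bounded on `[s,τ']`, with
respect to the norm of `X`, by a constant independent of `s`, `τ'` and `x`. -/
def H2 (J : D →L[𝕜] X) (τ : ℝ) (A P : ℝ → D →L[𝕜] X) (μ : ℝ) : Prop :=
  1 < μ ∧ ∃ c : ℝ, 0 < c ∧ ∀ s τ' : ℝ, 0 ≤ s → s < τ' → τ' < τ → ∀ x : D,
    eLpNorm (fun t => P t (evolutionFamily J A τ t s x)) (ENNReal.ofReal μ) (vol s τ')
      ≤ ENNReal.ofReal (c * ‖J x‖)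

end MaxReg

open MeasureTheory Set Filter Topology
open scoped ContDiff ENNReal

namespace MaxReg

/-! ### Measurable operator families, `L^p` norms on intervals, and primitives -/

section Basic

variable {X : Type*} [NormedAddCommGroup X] [NormedSpace ℝ X]
variable {D : Type*} [NormedAddCommGroup D] [NormedSpace ℝ D]

/-! The theorem rests on one smallness estimate. If u' + A(·)u = f and u(a) = 0, Duhamel's formula
u(t) = ∫_a^t U(t,s) f(s) ds and Minkowski's inequality bound the L^q(a,b) norm of P(·)u by ∫_a^b
‖P(·)U(·,s)f(s)‖_{L^q(s,b)} ds. By (H2) and Hölder's inequality from μ down to q this is at most c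
(b-a)^{1/q-1/μ} ‖f‖_{L^1}, hence at most c (b-a)^{1-1/μ} ‖f‖_{L^q}. Since μ > 1, the factor is at
most 1/2 on short intervals, where a Neumann series therefore solves the perturbed problem
(`US.perturb`); overlapping short intervals are glued (`US.glue`, `US.of_local`). This is
`US.of_evolution_bound`.

Duhamel's formula enters only through Riemann sums. For f = Jφ with φ continuous into D, the sum Σ h
U(t,t_i)φ(t_i) over the nodes t_i < t differs from u by an error which maximal regularity of A(·)
makes small in L^q(a,b;D) (`lpn_perturbation_le_of_continuous`). Such f are dense, which gives
`lpn_perturbation_le`.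

All this needs maximal regularity of A(·) for every exponent, whereas (H1) provides each A(t) with
some exponent of its own. Near a time t₀ the difference A(t) - A(t₀) is a small perturbation
(`US.near`, `US.of_relatively_continuous`), so the question is whether maximal regularity of a
single operator is independent of the exponent: `US.change_exponent`, the longest part.

That part uses no semigroup. The map f ↦ u' is causal and invariant under time shifts, so for step
functions on a uniform mesh of size h the cell averages of u' are given by a lower triangular
Toeplitz matrix κ(k-m) of operators on X. For j ≥ 0, κ(j+1) is 1/h times a second difference of the
response to a constant right-hand side. Multiplying homogeneous solutions by time yields smoothing
estimates, which bound third differences and give ‖κ(j+1) - κ(j)‖ ≤ C/j² with C independent of the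
mesh. This implies Hörmander's condition for the matrix and its transpose, so a Calderón–Zygmund
decomposition and duality (`kernel_extrapolate`) carry the ℓ^p bound to ℓ^q uniformly in the mesh.
Refining the mesh proves the a priori estimate for continuous f (`lpn_deriv_le_of_continuous`), and
density yields solutions for all f in L^q. -/

theorem aestronglyMeasurable_apply {α : Type*} [MeasurableSpace α] {μ : Measure α}
    {A : α → D →L[ℝ] X} (hA : ∀ x, AEStronglyMeasurable (fun t => A t x) μ) {v : α → D}
    (hv : AEStronglyMeasurable v μ) : AEStronglyMeasurable (fun t => A t (v t)) μ := by
  obtain ⟨w, hw, hvw⟩ := hv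
  have h1 : ∀ s : SimpleFunc α D, AEStronglyMeasurable (fun t => A t (s t)) μ := by
    intro s
    induction s using SimpleFunc.induction with
    | const c hs =>
      rename_i s
      have : (fun t => A t ((SimpleFunc.piecewise s hs (SimpleFunc.const α c)
          (SimpleFunc.const α 0)) t)) = s.indicator (fun t => A t c) := by
        ext t
        by_cases ht : t ∈ s <;> simp [ht]
      rw [this]
      exact (hA c).indicator hs
    | add hd hf hg =>
      refine (hf.add hg).congr (Eventually.of_forall fun t => ?_)
      simp
  have h2 : AEStronglyMeasurable (fun t => A t (w t)) μ := by
    refine aestronglyMeasurable_of_tendsto_ae atTop (fun n => h1 (hw.approx n)) ?_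
    filter_upwards with t
    exact ((A t).continuous.tendsto _).comp (hw.tendsto_approx t)
  refine h2.congr ?_
  filter_upwards [hvw] with t ht
  rw [ht]

/-- A strongly measurable family of operators on `(a, b)`, bounded by `M`. -/
structure FamBdd (A : ℝ → D →L[ℝ] X) (a b M : ℝ) : Prop where
  meas : ∀ x, AEStronglyMeasurable (fun t => A t x) (vol a b)
  bound : ∀ t ∈ Ioo a b, ‖A t‖ ≤ M

theorem vol_mono {a b c d : ℝ} (hac : a ≤ c) (hdb : d ≤ b) : vol c d ≤ vol a b :=
  Measure.restrict_mono (Ioo_subset_Ioo hac hdb) le_rfl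

theorem ae_vol_mem (a b : ℝ) : ∀ᵐ t ∂vol a b, t ∈ Ioo a b := ae_restrict_mem measurableSet_Ioo

theorem ae_vol_mono {a b c d : ℝ} (hac : a ≤ c) (hdb : d ≤ b) {P : ℝ → Prop}
    (h : ∀ᵐ t ∂vol a b, P t) : ∀ᵐ t ∂vol c d, P t :=
  ae_mono (vol_mono hac hdb) h

theorem ae_vol_iff {a b : ℝ} {P : ℝ → Prop} :
    (∀ᵐ t ∂vol a b, P t) ↔ ∀ᵐ t, t ∈ Ioo a b → P t := ae_restrict_iff' measurableSet_Ioo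

theorem FamBdd.mono {A : ℝ → D →L[ℝ] X} {a b M c d : ℝ} (hA : FamBdd A a b M)
    (hac : a ≤ c) (hdb : d ≤ b) : FamBdd A c d M :=
  ⟨fun x => (hA.meas x).mono_measure (vol_mono hac hdb),
    fun t ht => hA.bound t ⟨hac.trans_lt ht.1, ht.2.trans_le hdb⟩⟩

theorem FamBdd.const (A : D →L[ℝ] X) (a b : ℝ) : FamBdd (fun _ => A) a b ‖A‖ :=
  ⟨fun _ => aestronglyMeasurable_const, fun _ _ => le_rfl⟩

theorem FamBdd.aesm {A : ℝ → D →L[ℝ] X} {a b M : ℝ} (hA : FamBdd A a b M) {v : ℝ → D}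
    (hv : AEStronglyMeasurable v (vol a b)) :
    AEStronglyMeasurable (fun t => A t (v t)) (vol a b) :=
  aestronglyMeasurable_apply hA.meas hv

theorem FamBdd.ae_le {A : ℝ → D →L[ℝ] X} {a b M : ℝ} (hA : FamBdd A a b M) (v : ℝ → D) :
    ∀ᵐ t ∂vol a b, ‖A t (v t)‖ ≤ M * ‖v t‖ := by
  filter_upwards [ae_vol_mem a b] with t ht
  exact (A t).le_of_opNorm_le (hA.bound t ht) _

theorem FamBdd.memLp {A : ℝ → D →L[ℝ] X} {a b M : ℝ} (hA : FamBdd A a b M) {v : ℝ → D}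
    {p : ℝ≥0∞} (hv : MemLp v p (vol a b)) : MemLp (fun t => A t (v t)) p (vol a b) :=
  hv.of_le_mul (hA.aesm hv.1) (hA.ae_le v)

/-- The real-valued `L^p`-norm on `(a, b)`. -/
noncomputable def lpn {E : Type*} [NormedAddCommGroup E] (p : ℝ≥0∞) (a b : ℝ) (f : ℝ → E) : ℝ :=
  (eLpNorm f p (vol a b)).toReal

theorem lpn_nonneg {E : Type*} [NormedAddCommGroup E] (p : ℝ≥0∞) (a b : ℝ) (f : ℝ → E) :
    0 ≤ lpn p a b f := ENNReal.toReal_nonneg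

theorem lpn_congr {E : Type*} [NormedAddCommGroup E] {p : ℝ≥0∞} {a b : ℝ} {f g : ℝ → E}
    (h : f =ᵐ[vol a b] g) : lpn p a b f = lpn p a b g := by
  rw [lpn, lpn, eLpNorm_congr_ae h]

theorem lpn_add_le {E : Type*} [NormedAddCommGroup E] {p : ℝ≥0∞} (hp : 1 ≤ p) {a b : ℝ}
    {f g : ℝ → E} (hf : MemLp f p (vol a b)) (hg : MemLp g p (vol a b)) :
    lpn p a b (fun t => f t + g t) ≤ lpn p a b f + lpn p a b g := by
  rw [lpn, lpn, lpn, ← ENNReal.toReal_add hf.2.ne hg.2.ne]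
  exact ENNReal.toReal_mono (ENNReal.add_ne_top.2 ⟨hf.2.ne, hg.2.ne⟩) (eLpNorm_add_le hf.1 hg.1 hp)

theorem lpn_sub_le {E : Type*} [NormedAddCommGroup E] {p : ℝ≥0∞} (hp : 1 ≤ p) {a b : ℝ}
    {f g : ℝ → E} (hf : MemLp f p (vol a b)) (hg : MemLp g p (vol a b)) :
    lpn p a b (fun t => f t - g t) ≤ lpn p a b f + lpn p a b g := by
  rw [lpn, lpn, lpn, ← ENNReal.toReal_add hf.2.ne hg.2.ne]
  exact ENNReal.toReal_mono (ENNReal.add_ne_top.2 ⟨hf.2.ne, hg.2.ne⟩) (eLpNorm_sub_le hf.1 hg.1 hp)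

theorem lpn_le_mul {E F : Type*} [NormedAddCommGroup E] [NormedAddCommGroup F] {p : ℝ≥0∞}
    {a b M : ℝ} (hM : 0 ≤ M)
    {f : ℝ → E} {g : ℝ → F} (hg : MemLp g p (vol a b)) (h : ∀ᵐ t ∂vol a b, ‖f t‖ ≤ M * ‖g t‖) :
    lpn p a b f ≤ M * lpn p a b g := by
  have := eLpNorm_le_mul_eLpNorm_of_ae_le_mul h p
  have h2 := ENNReal.toReal_mono (ENNReal.mul_ne_top ENNReal.ofReal_ne_top hg.2.ne) this
  rwa [ENNReal.toReal_mul, ENNReal.toReal_ofReal hM] at h2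

theorem lpn_subinterval {E : Type*} [NormedAddCommGroup E] {p : ℝ≥0∞} {a b c d : ℝ} {f : ℝ → E}
    (hf : MemLp f p (vol a b)) (hac : a ≤ c) (hdb : d ≤ b) : lpn p c d f ≤ lpn p a b f :=
  ENNReal.toReal_mono hf.2.ne (eLpNorm_mono_measure f (vol_mono hac hdb))

theorem memLp_subinterval {E : Type*} [NormedAddCommGroup E] {p : ℝ≥0∞} {a b c d : ℝ} {f : ℝ → E}
    (hf : MemLp f p (vol a b)) (hac : a ≤ c) (hdb : d ≤ b) : MemLp f p (vol c d) :=
  hf.mono_measure (vol_mono hac hdb)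

theorem lpn_le_of_bound {E : Type*} [NormedAddCommGroup E] {p : ℝ≥0∞}
    {a b M : ℝ} (hab : a ≤ b) (hM : 0 ≤ M) {f : ℝ → E}
    (h : ∀ t ∈ Ioo a b, ‖f t‖ ≤ M) : lpn p a b f ≤ M * (b - a) ^ (1 / p.toReal) := by
  have h1 : ∀ᵐ t ∂vol a b, ‖f t‖ ≤ M := by
    filter_upwards [ae_vol_mem a b] with t ht using h t ht
  have := eLpNorm_le_of_ae_bound (p := p) h1
  have h2 := ENNReal.toReal_mono (by finiteness) this
  rw [lpn]
  refine h2.trans (le_of_eq ?_)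
  rw [ENNReal.toReal_mul, ENNReal.toReal_ofReal hM, ← ENNReal.toReal_rpow]
  simp [hab, mul_comm]

theorem lpn_smul {E : Type*} [NormedAddCommGroup E] [NormedSpace ℝ E] {p : ℝ≥0∞} {a b : ℝ}
    (c : ℝ) (f : ℝ → E) : lpn p a b (fun t => c • f t) = |c| * lpn p a b f := by
  have := eLpNorm_const_smul c f p (vol a b)
  rw [lpn, lpn, ← Real.norm_eq_abs, ← toReal_enorm, ← ENNReal.toReal_mul, ← this]
  rfl

theorem intervalIntegrable_of_memLp {E : Type*} [NormedAddCommGroup E] {p : ℝ≥0∞} (hp : 1 ≤ p)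
    {a b : ℝ} {f : ℝ → E} (hf : MemLp f p (vol a b)) {s t : ℝ} (hs : s ∈ Icc a b)
    (ht : t ∈ Icc a b) : IntervalIntegrable f volume s t := by
  have h1 : IntegrableOn f (Ioo a b) volume := hf.integrable hp
  rw [← integrableOn_Icc_iff_integrableOn_Ioo] at h1
  refine (h1.mono_set ?_).intervalIntegrable
  exact uIcc_subset_Icc hs ht

theorem lpn_one_le {E : Type*} [NormedAddCommGroup E] {p : ℝ≥0∞} (hp : 1 ≤ p)
    {a b : ℝ} {f : ℝ → E} (hab : a ≤ b) (hf : MemLp f p (vol a b)) :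
    ∫ s in a..b, ‖f s‖ ≤ (b - a) ^ (1 - 1 / p.toReal) * lpn p a b f := by
  have h1 := eLpNorm_le_eLpNorm_mul_rpow_measure_univ hp hf.1
  have h2 : ∫ s in a..b, ‖f s‖ = (eLpNorm f 1 (vol a b)).toReal := by
    rw [intervalIntegral.integral_of_le hab, integral_Ioc_eq_integral_Ioo,
      eLpNorm_one_eq_lintegral_enorm, integral_norm_eq_lintegral_enorm hf.1]
  have h0 : 0 ≤ 1 - 1 / p.toReal := by
    rcases eq_or_ne p ∞ with rfl | h
    · simp
    · have : 1 ≤ p.toReal := by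
        simpa using ENNReal.toReal_mono h hp
      rw [sub_nonneg, div_le_one (by linarith)]
      exact this
  rw [h2]
  have h3 := ENNReal.toReal_mono (ENNReal.mul_ne_top hf.2.ne
    (ENNReal.rpow_ne_top_of_nonneg (by simpa using h0) (by simp))) h1
  refine h3.trans (le_of_eq ?_)
  rw [ENNReal.toReal_mul, ← ENNReal.toReal_rpow, mul_comm]
  simp [hab, lpn]

theorem norm_volt_le {p : ℝ≥0∞} (hp : 1 ≤ p) {a b : ℝ} {f : ℝ → X} (hf : MemLp f p (vol a b))
    {t : ℝ} (ht : t ∈ Icc a b) :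
    ‖∫ s in a..t, f s‖ ≤ (t - a) ^ (1 - 1 / p.toReal) * lpn p a t f :=
  (intervalIntegral.norm_integral_le_integral_norm ht.1).trans
    (lpn_one_le hp ht.1 (memLp_subinterval hf le_rfl ht.2))

theorem continuousOn_volt {p : ℝ≥0∞} (hp : 1 ≤ p) {a b : ℝ} {f : ℝ → X}
    (hf : MemLp f p (vol a b)) : ContinuousOn (fun t => ∫ s in a..t, f s) (Icc a b) := by
  rcases lt_or_ge b a with h | h
  · simp [h]
  have h1 := intervalIntegrable_of_memLp hp hf (s := a) (t := b) ⟨le_rfl, h⟩ ⟨h, le_rfl⟩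
  have := intervalIntegral.continuousOn_primitive_interval (μ := volume) (f := f) (a := a) (b := b)
    (by rwa [uIcc_of_le h, integrableOn_Icc_iff_integrableOn_Ioc,
      ← intervalIntegrable_iff_integrableOn_Ioc_of_le h])
  rwa [uIcc_of_le h] at this

theorem memLp_of_continuousOn {E : Type*} [NormedAddCommGroup E] {p : ℝ≥0∞} {a b : ℝ} {f : ℝ → E}
    (hf : ContinuousOn f (Icc a b)) : MemLp f p (vol a b) := by
  obtain ⟨C, hC⟩ := isCompact_Icc.exists_bound_of_continuousOn hf
  refine MemLp.of_bound ((hf.mono Ioo_subset_Icc_self).aestronglyMeasurable measurableSet_Ioo) C ?_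
  filter_upwards [ae_vol_mem a b] with t ht using hC t (Ioo_subset_Icc_self ht)

theorem eqOn_of_ae_eq {E : Type*} [NormedAddCommGroup E] {a b : ℝ} (hab : a < b)
    {f g : ℝ → E} (hf : ContinuousOn f (Icc a b))
    (hg : ContinuousOn g (Icc a b)) (h : f =ᵐ[vol a b] g) : EqOn f g (Icc a b) := by
  have h1 : EqOn f g (Ioo a b) :=
    Measure.eqOn_open_of_ae_eq h isOpen_Ioo (hf.mono Ioo_subset_Icc_self)
      (hg.mono Ioo_subset_Icc_self)
  have := h1.of_subset_closure hf hg Ioo_subset_Icc_self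
    (by rw [closure_Ioo hab.ne])
  exact this

theorem volt_congr {a b : ℝ} {f g : ℝ → X} (h : f =ᵐ[vol a b] g) {s t : ℝ} (hs : s ∈ Icc a b)
    (ht : t ∈ Icc a b) : ∫ r in s..t, f r = ∫ r in s..t, g r := by
  wlog hst : s ≤ t generalizing s t
  · rw [intervalIntegral.integral_symm, this ht hs (le_of_not_ge hst),
      ← intervalIntegral.integral_symm]
  rw [intervalIntegral.integral_of_le hst, intervalIntegral.integral_of_le hst,
    integral_Ioc_eq_integral_Ioo, integral_Ioc_eq_integral_Ioo]
  exact integral_congr_ae (ae_vol_mono hs.1 ht.2 h)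

/-- By continuity the primitive vanishes on all of `[a, b]`, and Lebesgue's differentiation theorem
recovers `f` a.e. as its derivative. -/
theorem ae_eq_zero_of_volt_eq_zero [CompleteSpace X] {p : ℝ≥0∞} (hp : 1 ≤ p) {a b : ℝ} {f : ℝ → X}
    (hf : MemLp f p (vol a b)) (h : ∀ᵐ t ∂vol a b, ∫ s in a..t, f s = 0) :
    f =ᵐ[vol a b] 0 := by
  rcases le_or_gt b a with hab | hab
  · simp [vol, Ioo_eq_empty (not_lt.2 hab), EventuallyEq]
  have h1 := intervalIntegrable_of_memLp hp hf (s := a) (t := b) ⟨le_rfl, hab.le⟩ ⟨hab.le, le_rfl⟩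
  have h0 : EqOn (fun t => ∫ s in a..t, f s) (fun _ => 0) (Icc a b) :=
    eqOn_of_ae_eq hab (continuousOn_volt hp hf) continuousOn_const h
  have h2 := h1.ae_hasDerivAt_integral
  rw [EventuallyEq, ae_vol_iff]
  filter_upwards [h2] with t ht hmem
  have h3 := ht (by rw [uIcc_of_le hab.le]; exact Ioo_subset_Icc_self hmem) a (by simp)
  have h4 : HasDerivAt (fun t => ∫ s in a..t, f s) 0 t := by
    refine (hasDerivAt_const t (0 : X)).congr_of_eventuallyEq ?_
    filter_upwards [Ioo_mem_nhds hmem.1 hmem.2] with s hs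
    exact h0 (Ioo_subset_Icc_self hs)
  exact h3.unique h4

/-- Product rule for a `C^1` function and a primitive, in integrated form. -/
theorem smul_volt [CompleteSpace X] {p : ℝ≥0∞} (hp : 1 ≤ p) {a b : ℝ} {f : ℝ → X}
    (hf : MemLp f p (vol a b)) {φ : ℝ → ℝ} (hφ : ContDiff ℝ 1 φ) {t : ℝ} (ht : t ∈ Icc a b) :
    φ t • ∫ s in a..t, f s = ∫ s in a..t, (φ s • f s + deriv φ s • ∫ r in a..s, f r) := by
  have hat : a ≤ t := ht.1
  have hfi : IntervalIntegrable f volume a t :=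
    intervalIntegrable_of_memLp hp hf ⟨le_rfl, ht.1.trans ht.2⟩ ht
  have hc : ContinuousOn (fun t => ∫ s in a..t, f s) (uIcc a t) := by
    rw [uIcc_of_le hat]
    exact continuousOn_volt hp (memLp_subinterval hf le_rfl ht.2)
  have hd : Continuous (deriv φ) := hφ.continuous_deriv le_rfl
  have hi1 : IntervalIntegrable (fun s => φ s • f s) volume a t :=
    hfi.continuousOn_smul hφ.continuous.continuousOn
  have hi2 : IntervalIntegrable (fun s => deriv φ s • ∫ r in a..s, f r) volume a t :=
    (hd.continuousOn.smul hc).intervalIntegrable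
  -- Testing with functionals reduces the identity to integration by parts for scalar absolutely
  -- continuous functions.
  rw [SeparatingDual.eq_iff_forall_dual_eq (R := ℝ)]
  intro l
  rw [← ContinuousLinearMap.intervalIntegral_comp_comm _ (hi1.add hi2), map_smul,
    ← ContinuousLinearMap.intervalIntegral_comp_comm _ hfi]
  have hli : IntervalIntegrable (fun s => l (f s)) volume a t := 
    ⟨l.integrable_comp hfi.1, l.integrable_comp hfi.2⟩
  have hac := hli.absolutelyContinuousOnInterval_intervalIntegral (c := a) (by simp)
  have hphi : AbsolutelyContinuousOnInterval φ a t :=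
    (hφ.contDiffOn (s := uIcc a t)).absolutelyContinuousOnInterval
  have key := AbsolutelyContinuousOnInterval.integral_deriv_mul_eq_sub hphi hac
  simp only [intervalIntegral.integral_same, mul_zero, sub_zero] at key
  rw [smul_eq_mul, ← key]
  refine intervalIntegral.integral_congr_ae ?_
  filter_upwards [hli.ae_hasDerivAt_integral] with s hs hmem
  have hmem' : s ∈ uIcc a t := uIoc_subset_uIcc hmem
  rw [(hs hmem' a (by simp)).deriv, map_add, map_smul, map_smul,
    ← ContinuousLinearMap.intervalIntegral_comp_comm]
  · simp [add_comm]
  · refine hfi.mono_set ?_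
    rw [uIcc_of_le hat] at *
    exact uIcc_subset_Icc ⟨le_rfl, hat⟩ hmem'

end Basic

/-! ### Weak derivatives and primitives -/

section Weak

variable {X : Type*} [NormedAddCommGroup X] [NormedSpace ℝ X]

theorem integral_vol_eq {a b : ℝ} (hab : a ≤ b) (f : ℝ → X) :
    ∫ t, f t ∂(vol a b) = ∫ t in a..b, f t := by
  rw [intervalIntegral.integral_of_le hab, integral_Ioc_eq_integral_Ioo]

theorem hasWeakDeriv_volt [CompleteSpace X] {p : ℝ≥0∞} (hp : 1 ≤ p) {a b : ℝ} (hab : a < b)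
    {g : ℝ → X} (hg : MemLp g p (vol a b)) (x : X) :
    HasWeakDeriv a b (fun t => x + ∫ s in a..t, g s) g := by
  intro φ hφ _ hs
  have hφ1 : ContDiff ℝ 1 φ := hφ.of_le (by exact_mod_cast le_top)
  have ha : φ a = 0 := image_eq_zero_of_notMem_tsupport fun h => lt_irrefl _ (hs h).1
  have hb : φ b = 0 := image_eq_zero_of_notMem_tsupport fun h => lt_irrefl _ (hs h).2
  have key := smul_volt hp hg hφ1 (t := b) ⟨hab.le, le_rfl⟩
  have hgi := intervalIntegrable_of_memLp hp hg (s := a) (t := b) ⟨le_rfl, hab.le⟩ ⟨hab.le, le_rfl⟩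
  have hc : ContinuousOn (fun t => ∫ s in a..t, g s) (uIcc a b) := by
    rw [uIcc_of_le hab.le]; exact continuousOn_volt hp hg
  have hd : Continuous (deriv φ) := hφ1.continuous_deriv le_rfl
  have hi1 : IntervalIntegrable (fun s => φ s • g s) volume a b :=
    hgi.continuousOn_smul hφ.continuous.continuousOn
  have hi2 : IntervalIntegrable (fun s => deriv φ s • ∫ r in a..s, g r) volume a b :=
    (hd.continuousOn.smul hc).intervalIntegrable
  have hi3 : IntervalIntegrable (fun s => deriv φ s • x) volume a b :=
    (hd.smul continuous_const).intervalIntegrable _ _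
  rw [hb, zero_smul, intervalIntegral.integral_add hi1 hi2] at key
  have h3 : ∫ s in a..b, deriv φ s • x = 0 := by
    rw [intervalIntegral.integral_smul_const, intervalIntegral.integral_deriv_eq_sub
      (fun t _ => hφ1.differentiable one_ne_zero t) (hd.intervalIntegrable _ _), ha, hb]
    simp
  rw [integral_vol_eq hab.le, integral_vol_eq hab.le]
  simp_rw [smul_add]
  rw [intervalIntegral.integral_add hi3 hi2, h3, zero_add]
  exact eq_neg_of_add_eq_zero_right key.symm

theorem exists_Icc_superset_of_isCompact {a b : ℝ} (hab : a < b) {K : Set ℝ} (hK : IsCompact K)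
    (hKs : K ⊆ Ioo a b) : ∃ a' b', a < a' ∧ b' < b ∧ K ⊆ Icc a' b' := by
  rcases K.eq_empty_or_nonempty with rfl | hne
  · exact ⟨b, a, hab, hab, empty_subset _⟩
  · obtain ⟨m, hm⟩ := hK.exists_isLeast hne
    obtain ⟨M, hM⟩ := hK.exists_isGreatest hne
    exact ⟨m, M, (hKs hm.1).1, (hKs hM.1).2, fun t ht => ⟨hm.2 ht, hM.2 ht⟩⟩

/-- The primitive of `ψ` from `a` vanishes to the left of the support, and to its right because the
total integral is zero; hence it is again a test function. -/
theorem exists_primitive_of_integral_eq_zero {a b : ℝ} (hab : a < b) {ψ : ℝ → ℝ}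
    (hψ : ContDiff ℝ ∞ ψ) (hc : HasCompactSupport ψ) (hs : tsupport ψ ⊆ Ioo a b)
    (h0 : ∫ t in a..b, ψ t = 0) :
    ∃ φ : ℝ → ℝ, ContDiff ℝ ∞ φ ∧ HasCompactSupport φ ∧ tsupport φ ⊆ Ioo a b ∧ deriv φ = ψ := by
  obtain ⟨a', b', ha, hb, hK⟩ := exists_Icc_superset_of_isCompact hab hc hs
  have hz : ∀ t, t ∉ Icc a' b' → ψ t = 0 := fun t ht =>
    image_eq_zero_of_notMem_tsupport fun h => ht (hK h)
  have hder : ∀ t, HasDerivAt (fun t => ∫ s in a..t, ψ s) (ψ t) t := fun t =>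
    intervalIntegral.integral_hasDerivAt_right (hψ.continuous.intervalIntegrable _ _)
      hψ.continuous.stronglyMeasurable.stronglyMeasurableAtFilter hψ.continuous.continuousAt
  have hderiv : deriv (fun t => ∫ s in a..t, ψ s) = ψ := funext fun t => (hder t).deriv
  have hsub : tsupport (fun t => ∫ s in a..t, ψ s) ⊆ Icc a' b' := by
    refine closure_minimal (fun t ht => ?_) isClosed_Icc
    by_contra hmem
    refine ht ?_
    rcases not_and_or.1 hmem with h | h
    · have : ∫ s in a..t, ψ s = ∫ s in a..t, (0 : ℝ) := by
        refine intervalIntegral.integral_congr fun s hs => hz s fun h' => ?_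
        have := hs.2
        have h2 := h'.1
        rcases le_total a t with h3 | h3
        · rw [max_eq_right h3] at this; exact h (h2.trans this)
        · rw [max_eq_left h3] at this; linarith
      simpa using this
    · have e : ∫ s in t..b, ψ s = ∫ s in t..b, (0 : ℝ) := by
        refine intervalIntegral.integral_congr fun s hs => hz s fun h' => ?_
        have := hs.1
        have h2 := h'.2
        rcases le_total t b with h3 | h3
        · rw [min_eq_left h3] at this; exact h (this.trans h2)
        · rw [min_eq_right h3] at this; linarith
      have e2 := intervalIntegral.integral_add_adjacent_intervals
        (hψ.continuous.intervalIntegrable (μ := volume) a t)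
        (hψ.continuous.intervalIntegrable (μ := volume) t b)
      rw [h0, e] at e2
      simpa using e2
  refine ⟨fun t => ∫ s in a..t, ψ s, ?_, ?_, ?_, hderiv⟩
  · rw [contDiff_infty_iff_deriv, hderiv]
    exact ⟨fun t => (hder t).differentiableAt, hψ⟩
  · exact isCompact_Icc.of_isClosed_subset (isClosed_tsupport _) hsub
  · exact hsub.trans fun t ht => ⟨ha.trans_le ht.1, ht.2.trans_lt hb⟩

theorem exists_test_integral_eq_one {a b : ℝ} (hab : a < b) :
    ∃ ρ : ℝ → ℝ, ContDiff ℝ ∞ ρ ∧ HasCompactSupport ρ ∧ tsupport ρ ⊆ Ioo a b ∧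
      ∫ t in a..b, ρ t = 1 := by
  let f : ContDiffBump ((a + b) / 2) := ⟨(b - a) / 8, (b - a) / 4, by linarith, by linarith⟩
  have hs : tsupport (f.normed volume) ⊆ Ioo a b := by
    rw [f.tsupport_normed_eq, Real.closedBall_eq_Icc]
    intro t ht
    have h1 : f.rOut = (b - a) / 4 := rfl
    rw [h1] at ht
    exact ⟨by linarith [ht.1], by linarith [ht.2]⟩
  refine ⟨f.normed volume, f.contDiff_normed, f.hasCompactSupport_normed, hs, ?_⟩
  rw [← f.integral_normed (μ := volume)]
  refine intervalIntegral.integral_eq_integral_of_support_subset ?_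
  exact (subset_tsupport _).trans (hs.trans Ioo_subset_Ioc_self)

/-- A continuous function with an integrable weak derivative is its primitive. -/
theorem HasWeakDeriv.eq_volt [CompleteSpace X] {p : ℝ≥0∞} (hp : 1 ≤ p) {a b : ℝ} (hab : a < b)
    {u g : ℝ → X} (hu : ContinuousOn u (Icc a b)) (hg : MemLp g p (vol a b))
    (h : HasWeakDeriv a b u g) : ∀ t ∈ Icc a b, u t = u a + ∫ s in a..t, g s := by
  set w : ℝ → X := fun t => u t - ∫ s in a..t, g s with hw
  have hV := continuousOn_volt hp hg
  have hwc : ContinuousOn w (Icc a b) := hu.sub hV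
  have hint : ∀ {φ : ℝ → ℝ} {y : ℝ → X}, Continuous φ → ContinuousOn y (Icc a b) →
      IntervalIntegrable (fun s => φ s • y s) volume a b := fun hφ hy =>
    (hφ.continuousOn.smul (by rwa [uIcc_of_le hab.le])).intervalIntegrable
  have hwd : ∀ φ : ℝ → ℝ, ContDiff ℝ ∞ φ → HasCompactSupport φ → tsupport φ ⊆ Ioo a b →
      ∫ t in a..b, deriv φ t • w t = 0 := by
    intro φ hφ hc hs
    have h1 := h φ hφ hc hs
    have h2 := hasWeakDeriv_volt hp hab hg 0 φ hφ hc hs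
    have hd : Continuous (deriv φ) := hφ.continuous_deriv (by exact_mod_cast le_top)
    simp only [zero_add] at h2
    rw [← h2, integral_vol_eq hab.le, integral_vol_eq hab.le] at h1
    simp_rw [hw, smul_sub]
    rw [intervalIntegral.integral_sub (hint hd hu) (hint hd hV), h1, sub_self]
  -- The argument of du Bois-Reymond: for a test function `ψ`, the function `ψ - (∫ψ) ρ` is the
  -- derivative of a test function, hence is annihilated by `w`. Thus `w - C` with `C = ∫ ρ w`
  -- annihilates every `ψ`.
  obtain ⟨ρ, hρ, hρc, hρs, hρ1⟩ := exists_test_integral_eq_one hab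
  set C := ∫ t in a..b, ρ t • w t with hC
  have hae : ∀ᵐ t, t ∈ Ioo a b → w t - C = 0 := by
    refine isOpen_Ioo.ae_eq_zero_of_integral_contDiff_smul_eq_zero ?_ ?_
    · exact ((hwc.mono Ioo_subset_Icc_self).sub continuousOn_const).locallyIntegrableOn
        measurableSet_Ioo
    · intro ψ hψ hψc hψs
      set c := ∫ t in a..b, ψ t with hc
      obtain ⟨φ, hφ, hφc, hφs, hφd⟩ := exists_primitive_of_integral_eq_zero hab
        (ψ := fun t => ψ t - c * ρ t) (hψ.sub (contDiff_const.mul hρ))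
        (hψc.sub (hρc.mul_left))
        ((tsupport_sub _ _).trans (union_subset hψs ((tsupport_mul_subset_right).trans hρs)))
        (by
          have h4 : IntervalIntegrable (fun t => c * ρ t) volume a b :=
            (continuous_const.mul hρ.continuous).intervalIntegrable _ _
          rw [intervalIntegral.integral_sub (hψ.continuous.intervalIntegrable _ _) h4,
            intervalIntegral.integral_const_mul, hρ1, mul_one, hc, sub_self])
      have h3 := hwd φ hφ hφc hφs
      rw [hφd] at h3
      simp_rw [sub_smul, mul_smul] at h3
      have h5 : IntervalIntegrable (fun t => c • ρ t • w t) volume a b :=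
        (hint hρ.continuous hwc).smul c
      rw [intervalIntegral.integral_sub (hint hψ.continuous hwc) h5, intervalIntegral.integral_smul, ← hC] at h3
      rw [← intervalIntegral.integral_eq_integral_of_support_subset (a := a) (b := b)]
      · simp_rw [smul_sub]
        rw [intervalIntegral.integral_sub (hint hψ.continuous hwc)
          (hint hψ.continuous continuousOn_const), intervalIntegral.integral_smul_const]
        exact h3
      · refine (Function.support_smul_subset_left _ _).trans ?_
        exact (subset_tsupport _).trans (hψs.trans Ioo_subset_Ioc_self)
  have heq : EqOn w (fun _ => C) (Icc a b) := by
    refine eqOn_of_ae_eq hab hwc continuousOn_const ?_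
    rw [EventuallyEq, ae_vol_iff]
    filter_upwards [hae] with t ht hmem using sub_eq_zero.1 (ht hmem)
  intro t ht
  have e1 := heq ht
  have e2 := heq (show a ∈ Icc a b from ⟨le_rfl, hab.le⟩)
  simp only [hw, intervalIntegral.integral_same, sub_zero] at e1 e2
  rw [e2, ← e1]; abel

end Weak

/-! ### The integrated equation: linearity, restriction, concatenation, translation -/

section Sol

variable {X : Type*} [NormedAddCommGroup X] [NormedSpace ℝ X]
variable {D : Type*} [NormedAddCommGroup D] [NormedSpace ℝ D]

/-- Integrated form of `u' + A(·)u = f` on `(a, b)`, `u(a) = x`, for `u = J v`. -/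
structure Sol (J : D →L[ℝ] X) (A : ℝ → D →L[ℝ] X) (p : ℝ≥0∞) (a b : ℝ) (f : ℝ → X) (x : X)
    (v : ℝ → D) : Prop where
  memLp : MemLp v p (vol a b)
  eq : ∀ᵐ t ∂vol a b, J (v t) = x + ∫ s in a..t, (f s - A s (v s))

variable {J : D →L[ℝ] X} {A : ℝ → D →L[ℝ] X} {p : ℝ≥0∞} {a b M : ℝ} {f g : ℝ → X} {x y : X}
  {v w : ℝ → D}

theorem ae_vol_union {a b c : ℝ} {P : ℝ → Prop} (h1 : ∀ᵐ t ∂vol a c, P t)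
    (h2 : ∀ᵐ t ∂vol c b, P t) : ∀ᵐ t ∂vol a b, P t := by
  rw [ae_vol_iff] at *
  have h3 : ∀ᵐ t : ℝ, t ≠ c := by simp [ae_iff, measure_singleton]
  filter_upwards [h1, h2, h3] with t h1 h2 h3 ht
  rcases lt_or_gt_of_ne h3 with h | h
  · exact h1 ⟨ht.1, h⟩
  · exact h2 ⟨h, ht.2⟩

theorem memLp_union {E : Type*} [NormedAddCommGroup E] {a b c : ℝ} {f : ℝ → E}
    (h1 : MemLp f p (vol a c)) (h2 : MemLp f p (vol c b)) : MemLp f p (vol a b) := by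
  have e1 : MemLp ((Ioo a c).indicator f) p (vol a b) := by
    have := (memLp_indicator_iff_restrict (μ := volume) (p := p) (f := f)
      (measurableSet_Ioo (a := a) (b := c))).2 h1
    exact this.mono_measure Measure.restrict_le_self
  have e2 : MemLp ((Ioo c b).indicator f) p (vol a b) := by
    have := (memLp_indicator_iff_restrict (μ := volume) (p := p) (f := f)
      (measurableSet_Ioo (a := c) (b := b))).2 h2
    exact this.mono_measure Measure.restrict_le_self
  refine (memLp_congr_ae ?_).1 (e1.add e2)
  refine ae_vol_union (c := c) ?_ ?_
  · filter_upwards [ae_vol_mem a c] with t ht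
    have : t ∉ Ioo c b := fun h => lt_asymm ht.2 h.1
    simp [indicator_of_mem ht, indicator_of_notMem this]
  · filter_upwards [ae_vol_mem c b] with t ht
    have : t ∉ Ioo a c := fun h => lt_asymm ht.1 h.2
    simp [indicator_of_mem ht, indicator_of_notMem this]

theorem Sol.memLp_rhs (h : Sol J A p a b f x v) (hA : FamBdd A a b M)
    (hf : MemLp f p (vol a b)) : MemLp (fun s => f s - A s (v s)) p (vol a b) :=
  hf.sub (hA.memLp h.memLp)

theorem Sol.congr (h : Sol J A p a b f x v) (hfg : f =ᵐ[vol a b] g) (hvw : v =ᵐ[vol a b] w) :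
    Sol J A p a b g x w := by
  refine ⟨(memLp_congr_ae hvw).1 h.memLp, ?_⟩
  filter_upwards [h.eq, hvw, ae_vol_mem a b] with t ht hvt hmem
  rw [← hvt, ht]
  congr 1
  refine volt_congr ?_ ⟨le_rfl, (hmem.1.trans hmem.2).le⟩ ⟨hmem.1.le, hmem.2.le⟩
  filter_upwards [hfg, hvw] with s h1 h2
  rw [h1, h2]

theorem Sol.congr_family {B : ℝ → D →L[ℝ] X} (h : Sol J A p a b f x v)
    (hAB : ∀ t ∈ Ioo a b, A t = B t) : Sol J B p a b f x v := by
  refine ⟨h.memLp, ?_⟩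
  filter_upwards [h.eq, ae_vol_mem a b] with t ht hmem
  rw [ht]
  congr 1
  refine volt_congr ?_ ⟨le_rfl, (hmem.1.trans hmem.2).le⟩ ⟨hmem.1.le, hmem.2.le⟩
  filter_upwards [ae_vol_mem a b] with s hs
  rw [hAB s hs]

theorem Sol.mono_exponent {q : ℝ≥0∞} (h : Sol J A p a b f x v) (hqp : q ≤ p) :
    Sol J A q a b f x v :=
  ⟨h.memLp.mono_exponent hqp, h.eq⟩

theorem Sol.add (hp : 1 ≤ p) (hA : FamBdd A a b M) (hf : MemLp f p (vol a b))
    (hg : MemLp g p (vol a b)) (h1 : Sol J A p a b f x v) (h2 : Sol J A p a b g y w) :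
    Sol J A p a b (fun t => f t + g t) (x + y) (fun t => v t + w t) := by
  refine ⟨h1.memLp.add h2.memLp, ?_⟩
  filter_upwards [h1.eq, h2.eq, ae_vol_mem a b] with t e1 e2 hmem
  have i1 := intervalIntegrable_of_memLp hp (h1.memLp_rhs hA hf) (s := a) (t := t)
    ⟨le_rfl, (hmem.1.trans hmem.2).le⟩ ⟨hmem.1.le, hmem.2.le⟩
  have i2 := intervalIntegrable_of_memLp hp (h2.memLp_rhs hA hg) (s := a) (t := t)
    ⟨le_rfl, (hmem.1.trans hmem.2).le⟩ ⟨hmem.1.le, hmem.2.le⟩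
  rw [map_add, e1, e2, add_add_add_comm, ← intervalIntegral.integral_add i1 i2]
  congr 1
  refine intervalIntegral.integral_congr fun s _ => ?_
  simp only [map_add]
  abel

theorem Sol.smul (c : ℝ) (h1 : Sol J A p a b f x v) :
    Sol J A p a b (fun t => c • f t) (c • x) (fun t => c • v t) := by
  refine ⟨h1.memLp.const_smul c, ?_⟩
  filter_upwards [h1.eq] with t e1
  rw [map_smul, e1, smul_add, ← intervalIntegral.integral_smul]
  congr 1
  refine intervalIntegral.integral_congr fun s _ => ?_
  simp only [map_smul, smul_sub]

theorem Sol.sub (hp : 1 ≤ p) (hA : FamBdd A a b M) (hf : MemLp f p (vol a b))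
    (hg : MemLp g p (vol a b)) (h1 : Sol J A p a b f x v) (h2 : Sol J A p a b g y w) :
    Sol J A p a b (fun t => f t - g t) (x - y) (fun t => v t - w t) := by
  have h3 := h1.add hp hA hf (hg.const_smul (-1 : ℝ)) (h2.smul (-1))
  simpa [sub_eq_add_neg] using h3

theorem Sol.zero : Sol J A p a b (fun _ => 0) 0 (fun _ => 0) :=
  ⟨MemLp.zero, by simp⟩

theorem Sol.sum {ι : Type*} (s : Finset ι) {f : ι → ℝ → X} {x : ι → X} {v : ι → ℝ → D}
    (hp : 1 ≤ p) (hA : FamBdd A a b M) (hf : ∀ i ∈ s, MemLp (f i) p (vol a b))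
    (h : ∀ i ∈ s, Sol J A p a b (f i) (x i) (v i)) :
    Sol J A p a b (fun t => ∑ i ∈ s, f i t) (∑ i ∈ s, x i) (fun t => ∑ i ∈ s, v i t) := by
  classical
  induction s using Finset.induction_on with
  | empty => simpa using Sol.zero
  | insert i s hi ih =>
    simp_rw [Finset.sum_insert hi]
    refine Sol.add hp hA (hf i (by simp)) (memLp_finsetSum s fun j hj => hf j (by simp [hj]))
      (h i (by simp)) (ih (fun j hj => hf j (by simp [hj])) (fun j hj => h j (by simp [hj])))

theorem Sol.restrict {c d : ℝ} (hp : 1 ≤ p) (hA : FamBdd A a b M) (hf : MemLp f p (vol a b))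
    (h : Sol J A p a b f x v) (hac : a ≤ c) (hcb : c ≤ b) (hdb : d ≤ b) :
    Sol J A p c d f (x + ∫ s in a..c, (f s - A s (v s))) v := by
  refine ⟨memLp_subinterval h.memLp hac hdb, ?_⟩
  filter_upwards [ae_vol_mono hac hdb h.eq, ae_vol_mem c d] with t ht hmem
  rw [ht, add_assoc, intervalIntegral.integral_add_adjacent_intervals]
  · exact intervalIntegrable_of_memLp hp (h.memLp_rhs hA hf)
      ⟨le_rfl, hac.trans hcb⟩ ⟨hac, hcb⟩
  · exact intervalIntegrable_of_memLp hp (h.memLp_rhs hA hf)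
      ⟨hac, hcb⟩ ⟨hac.trans hmem.1.le, hmem.2.le.trans hdb⟩

theorem Sol.restrict_right {d : ℝ} (h : Sol J A p a b f x v) (hdb : d ≤ b) :
    Sol J A p a d f x v :=
  ⟨memLp_subinterval h.memLp le_rfl hdb, ae_vol_mono le_rfl hdb h.eq⟩

/-- The second piece starts at the value which the primitive of the first takes at `c`, so the two
integral identities add up without a boundary term. -/
theorem Sol.concat {c : ℝ} (hp : 1 ≤ p) (hA : FamBdd A a b M) (hf : MemLp f p (vol a b))
    (hac : a ≤ c) (hcb : c ≤ b) (h1 : Sol J A p a c f x v)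
    (h2 : Sol J A p c b f (x + ∫ s in a..c, (f s - A s (v s))) w) :
    Sol J A p a b f x (fun t => if t ≤ c then v t else w t) := by
  set z : ℝ → D := fun t => if t ≤ c then v t else w t with hz
  have e1 : ∀ t ≤ c, z t = v t := fun t ht => by simp [hz, ht]
  have e2 : ∀ t, c < t → z t = w t := fun t ht => by simp [hz, ht]
  have a1 : z =ᵐ[vol a c] v := by
    filter_upwards [ae_vol_mem a c] with t ht using e1 t ht.2.le
  have a2 : z =ᵐ[vol c b] w := by
    filter_upwards [ae_vol_mem c b] with t ht using e2 t ht.1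
  have hm : MemLp z p (vol a b) :=
    memLp_union ((memLp_congr_ae a1).2 h1.memLp) ((memLp_congr_ae a2).2 h2.memLp)
  have hr : MemLp (fun s => f s - A s (z s)) p (vol a b) := hf.sub (hA.memLp hm)
  refine ⟨hm, ae_vol_union (c := c) ?_ ?_⟩
  · filter_upwards [h1.eq, ae_vol_mem a c] with t ht hmem
    rw [e1 t hmem.2.le, ht]
    congr 1
    refine intervalIntegral.integral_congr fun s hs => ?_
    rw [uIcc_of_le hmem.1.le] at hs
    simp only [e1 s (hs.2.trans hmem.2.le)]
  · filter_upwards [h2.eq, ae_vol_mem c b] with t ht hmem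
    rw [e2 t hmem.1, ht, ← intervalIntegral.integral_add_adjacent_intervals (a := a) (b := c)
      (intervalIntegrable_of_memLp hp hr ⟨le_rfl, hac.trans hcb⟩ ⟨hac, hcb⟩)
      (intervalIntegrable_of_memLp hp hr ⟨hac, hcb⟩ ⟨hac.trans hmem.1.le, hmem.2.le⟩), add_assoc]
    congr 2
    · refine intervalIntegral.integral_congr fun s hs => ?_
      rw [uIcc_of_le hac] at hs
      simp only [e1 s hs.2]
    · refine volt_congr ?_ (a := c) (b := b) ⟨le_rfl, hcb⟩ ⟨hmem.1.le, hmem.2.le⟩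
      filter_upwards [a2] with s hs
      rw [hs]

/-- Extension by zero to the left. -/
theorem Sol.extend_left {c : ℝ} (hp : 1 ≤ p) (hA : FamBdd A a b M) (hac : a ≤ c) (hcb : c ≤ b)
    (hf : MemLp f p (vol c b)) (h : Sol J A p c b f x v) (hx : x = 0) :
    Sol J A p a b (fun t => if t ≤ c then 0 else f t) 0 (fun t => if t ≤ c then 0 else v t) := by
  have e1 : (fun t => if t ≤ c then 0 else f t) =ᵐ[vol a c] fun _ => 0 := by
    filter_upwards [ae_vol_mem a c] with t ht
    simp [ht.2.le]
  have e2 : (fun t => if t ≤ c then 0 else f t) =ᵐ[vol c b] f := by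
    filter_upwards [ae_vol_mem c b] with t ht
    simp [ht.1]
  refine Sol.concat (v := fun _ => 0) hp hA
    (memLp_union ((memLp_congr_ae e1).2 MemLp.zero) ((memLp_congr_ae e2).2 hf)) hac hcb
    (Sol.zero.congr e1.symm (ae_eq_refl _)) ?_
  have : (0 : X) + ∫ s in a..c, ((if s ≤ c then 0 else f s) - A s 0) = x := by
    rw [hx, volt_congr (g := fun _ => 0) (a := a) (b := c) _ ⟨le_rfl, hac⟩ ⟨hac, le_rfl⟩]
    · simp
    · filter_upwards [e1] with t ht
      simp [ht]
  rw [this]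
  exact h.congr e2.symm (ae_eq_refl _)

theorem map_volt_comm [CompleteSpace X] [CompleteSpace D] (L : D →L[ℝ] X) (hp : 1 ≤ p)
    (hv : MemLp v p (vol a b)) {s t : ℝ} (hs : s ∈ Icc a b) (ht : t ∈ Icc a b) :
    L (∫ r in s..t, v r) = ∫ r in s..t, L (v r) :=
  (ContinuousLinearMap.intervalIntegral_comp_comm _
    (intervalIntegrable_of_memLp hp hv hs ht)).symm

theorem measurePreserving_vol_sub (a b c : ℝ) :
    MeasurePreserving (fun t => t - c) (vol (a + c) (b + c)) (vol a b) := by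
  have := (measurePreserving_sub_right (volume : Measure ℝ) c).restrict_preimage
    (measurableSet_Ioo (a := a) (b := b))
  rwa [preimage_sub_const_Ioo] at this

theorem lpn_translate {E : Type*} [NormedAddCommGroup E] {f : ℝ → E} (hf : MemLp f p (vol a b))
    (c : ℝ) : lpn p (a + c) (b + c) (fun t => f (t - c)) = lpn p a b f := by
  have := eLpNorm_comp_measurePreserving (p := p) hf.1 (measurePreserving_vol_sub a b c)
  rw [lpn, lpn, ← this]
  rfl

theorem memLp_translate {E : Type*} [NormedAddCommGroup E] {f : ℝ → E} (hf : MemLp f p (vol a b))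
    (c : ℝ) : MemLp (fun t => f (t - c)) p (vol (a + c) (b + c)) :=
  hf.comp_measurePreserving (measurePreserving_vol_sub a b c)

theorem Sol.translate {A₀ : D →L[ℝ] X} (h : Sol J (fun _ => A₀) p a b f x v) (c : ℝ) :
    Sol J (fun _ => A₀) p (a + c) (b + c) (fun t => f (t - c)) x (fun t => v (t - c)) := by
  refine ⟨memLp_translate h.memLp c, ?_⟩
  have := (measurePreserving_vol_sub a b c).quasiMeasurePreserving.ae h.eq
  filter_upwards [this] with t ht
  rw [ht, intervalIntegral.integral_comp_sub_right (fun s => f s - A₀ (v s)), add_sub_cancel_right]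

end Sol

/-! ### Unique solvability, the solution operator, and Neumann series -/

section Operators

variable {X : Type*} [NormedAddCommGroup X] [NormedSpace ℝ X]
variable {D : Type*} [NormedAddCommGroup D] [NormedSpace ℝ D]

/-- Unique solvability of the integrated problem with zero initial value. -/
def US (J : D →L[ℝ] X) (A : ℝ → D →L[ℝ] X) (p : ℝ≥0∞) (a b : ℝ) : Prop :=
  (∀ f, MemLp f p (vol a b) → ∃ v, Sol J A p a b f 0 v) ∧
    ∀ v, Sol J A p a b (fun _ => 0) 0 v → v =ᵐ[vol a b] 0

variable {J : D →L[ℝ] X} {A B : ℝ → D →L[ℝ] X} {p : ℝ≥0∞} {a b M N : ℝ} {f g : ℝ → X} {x y : X}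
  {v w : ℝ → D}

theorem US.unique (h : US J A p a b) (hp : 1 ≤ p) (hA : FamBdd A a b M)
    (hf : MemLp f p (vol a b)) (h1 : Sol J A p a b f x v) (h2 : Sol J A p a b f x w) :
    v =ᵐ[vol a b] w := by
  have h3 := h1.sub hp hA hf hf h2
  simp only [sub_self] at h3
  filter_upwards [h.2 _ h3] with t ht using sub_eq_zero.1 ht

theorem US.congr_family (h : US J A p a b) (hAB : ∀ t ∈ Ioo a b, A t = B t) : US J B p a b := by
  refine ⟨fun f hf => ?_, fun v hv => h.2 v (hv.congr_family fun t ht => (hAB t ht).symm)⟩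
  obtain ⟨v, hv⟩ := h.1 f hf
  exact ⟨v, hv.congr_family hAB⟩

theorem US.translate {A₀ : D →L[ℝ] X} (h : US J (fun _ => A₀) p a b) (c : ℝ) :
    US J (fun _ => A₀) p (a + c) (b + c) := by
  have back : ∀ {E : Type _} (f : ℝ → E), (fun t => (fun t => f (t - -c)) (t - c)) = f :=
    fun f => by ext t; simp
  refine ⟨fun f hf => ?_, fun v hv => ?_⟩
  · have h1 := memLp_translate hf (-c)
    simp only [add_neg_cancel_right] at h1
    obtain ⟨v, hv⟩ := h.1 _ h1
    have h2 := hv.translate c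
    rw [back] at h2
    exact ⟨_, h2⟩
  · have h1 := hv.translate (-c)
    simp only [add_neg_cancel_right] at h1
    have h2 := (measurePreserving_vol_sub a b c).quasiMeasurePreserving.ae (h.2 _ h1)
    filter_upwards [h2] with t ht
    simpa using ht

theorem toReal_lp_norm {E : Type*} [NormedAddCommGroup E] [Fact (1 ≤ p)] (f : Lp E p (vol a b)) : ‖f‖ = lpn p a b f := rfl

theorem lpn_toLp {E : Type*} [NormedAddCommGroup E] {f : ℝ → E} (hf : MemLp f p (vol a b)) : ‖hf.toLp f‖ = lpn p a b f := Lp.norm_toLp f hf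

theorem exists_mulOp [Fact (1 ≤ p)] (hA : FamBdd A a b M) (hM : 0 ≤ M) :
    ∃ T : Lp D p (vol a b) →L[ℝ] Lp X p (vol a b), ∀ v, T v =ᵐ[vol a b] fun t => A t (v t) := by
  let T₀ : Lp D p (vol a b) →ₗ[ℝ] Lp X p (vol a b) :=
    { toFun := fun v => (hA.memLp (Lp.memLp v)).toLp _
      map_add' := fun v w => by
        refine Lp.ext ?_
        filter_upwards [(hA.memLp (Lp.memLp (v + w))).coeFn_toLp,
          Lp.coeFn_add ((hA.memLp (Lp.memLp v)).toLp _) ((hA.memLp (Lp.memLp w)).toLp _),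
          (hA.memLp (Lp.memLp v)).coeFn_toLp, (hA.memLp (Lp.memLp w)).coeFn_toLp,
          Lp.coeFn_add v w] with t h1 h2 h3 h4 h5
        rw [h1, h2, Pi.add_apply, h3, h4, h5, Pi.add_apply, map_add]
      map_smul' := fun c v => by
        refine Lp.ext ?_
        filter_upwards [(hA.memLp (Lp.memLp (c • v))).coeFn_toLp,
          Lp.coeFn_smul c ((hA.memLp (Lp.memLp v)).toLp _),
          (hA.memLp (Lp.memLp v)).coeFn_toLp, Lp.coeFn_smul c v] with t h1 h2 h3 h4
        rw [h1, RingHom.id_apply, h2, Pi.smul_apply, h3, h4, Pi.smul_apply, map_smul] }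
  refine ⟨T₀.mkContinuous M fun v => ?_, fun v => (hA.memLp (Lp.memLp v)).coeFn_toLp⟩
  change ‖(hA.memLp (Lp.memLp v)).toLp _‖ ≤ _
  rw [lpn_toLp]
  exact lpn_le_mul hM (Lp.memLp v) (hA.ae_le v)

theorem exists_voltOp [hp : Fact (1 ≤ p)] (hab : a < b) :
    ∃ I : Lp X p (vol a b) →L[ℝ] Lp X p (vol a b),
      ∀ f, I f =ᵐ[vol a b] fun t => ∫ s in a..t, f s := by
  have hm : ∀ f : Lp X p (vol a b), MemLp (fun t => ∫ s in a..t, f s) p (vol a b) := fun f =>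
    memLp_of_continuousOn (continuousOn_volt hp.out (Lp.memLp f))
  have hi : ∀ f : Lp X p (vol a b), ∀ t ∈ Ioo a b, IntervalIntegrable f volume a t := fun f t ht =>
    intervalIntegrable_of_memLp hp.out (Lp.memLp f) ⟨le_rfl, hab.le⟩ (Ioo_subset_Icc_self ht)
  let T₀ : Lp X p (vol a b) →ₗ[ℝ] Lp X p (vol a b) :=
    { toFun := fun v => (hm v).toLp _
      map_add' := fun v w => by
        refine Lp.ext ?_
        filter_upwards [(hm (v + w)).coeFn_toLp, Lp.coeFn_add ((hm v).toLp _) ((hm w).toLp _),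
          (hm v).coeFn_toLp, (hm w).coeFn_toLp, ae_vol_mem a b] with t h1 h2 h3 h4 hmem
        rw [h1, h2, Pi.add_apply, h3, h4,
          ← intervalIntegral.integral_add (hi v t hmem) (hi w t hmem)]
        exact volt_congr (Lp.coeFn_add v w) ⟨le_rfl, hab.le⟩ (Ioo_subset_Icc_self hmem)
      map_smul' := fun c v => by
        refine Lp.ext ?_
        filter_upwards [(hm (c • v)).coeFn_toLp, Lp.coeFn_smul c ((hm v).toLp _),
          (hm v).coeFn_toLp, ae_vol_mem a b] with t h1 h2 h3 hmem
        rw [h1, RingHom.id_apply, h2, Pi.smul_apply, h3, ← intervalIntegral.integral_smul]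
        exact volt_congr (Lp.coeFn_smul c v) ⟨le_rfl, hab.le⟩ (Ioo_subset_Icc_self hmem) }
  refine ⟨T₀.mkContinuous ((b - a) ^ (1 - 1 / p.toReal) * (b - a) ^ (1 / p.toReal)) fun v => ?_,
    fun v => (hm v).coeFn_toLp⟩
  change ‖(hm v).toLp _‖ ≤ _
  have hba : 0 ≤ b - a := by linarith
  rw [lpn_toLp, mul_right_comm]
  refine lpn_le_of_bound hab.le (by positivity) fun t ht => ?_
  exact (intervalIntegral.norm_integral_le_integral_norm ht.1.le).trans
    ((intervalIntegral.integral_mono_interval le_rfl ht.1.le ht.2.le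
      (Eventually.of_forall fun _ => norm_nonneg _)
      (intervalIntegrable_of_memLp hp.out (Lp.memLp v) ⟨le_rfl, hab.le⟩ ⟨hab.le, le_rfl⟩).norm).trans
      (lpn_one_le hp.out hab.le (Lp.memLp v)))

/-- As an identity between bounded operators on `L^p`, the equation survives limits. This serves
both the closed graph theorem and the density argument for a new exponent. -/
theorem sol_iff_of_ops [Fact (1 ≤ p)] (hab : a < b)
    {T : Lp D p (vol a b) →L[ℝ] Lp X p (vol a b)} (hT : ∀ v, T v =ᵐ[vol a b] fun t => A t (v t))
    {I : Lp X p (vol a b) →L[ℝ] Lp X p (vol a b)}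
    (hI : ∀ f, I f =ᵐ[vol a b] fun t => ∫ s in a..t, f s)
    (f : Lp X p (vol a b)) (v : Lp D p (vol a b)) :
    Sol J A p a b f 0 v ↔ J.compLpL p (vol a b) v = I (f - T v) := by
  have h1 : (fun t => ∫ s in a..t, (f - T v) s) =ᵐ[vol a b]
      fun t => ∫ s in a..t, (f s - A s (v s)) := by
    filter_upwards [ae_vol_mem a b] with t ht
    refine volt_congr ?_ ⟨le_rfl, hab.le⟩ (Ioo_subset_Icc_self ht)
    filter_upwards [hT v, Lp.coeFn_sub f (T v)] with s h2 h3
    rw [h3, Pi.sub_apply, h2]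
  constructor
  · intro h
    refine Lp.ext ?_
    filter_upwards [h.eq, h1, hI (f - T v), J.coeFn_compLpL v] with t h2 h3 h4 h5
    rw [h5, h2, h4, h3, zero_add]
  · intro h
    refine ⟨Lp.memLp v, ?_⟩
    filter_upwards [h1, hI (f - T v), J.coeFn_compLpL v] with t h3 h4 h5
    rw [← h5, h, h4, h3, zero_add]

variable [CompleteSpace X] [CompleteSpace D]

/-- Uniqueness makes the solution map linear; its graph is closed because the equation passes to
limits, so it is bounded. -/
theorem US.exists_solOp [hp : Fact (1 ≤ p)] (h : US J A p a b) (hab : a < b) (hA : FamBdd A a b M)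
    (hM : 0 ≤ M) : ∃ S : Lp X p (vol a b) →L[ℝ] Lp D p (vol a b),
      ∀ f : Lp X p (vol a b), Sol J A p a b f 0 (S f) := by
  obtain ⟨T, hT⟩ := exists_mulOp (p := p) hA hM
  obtain ⟨I, hI⟩ := exists_voltOp (X := X) (p := p) hab
  have hiff := sol_iff_of_ops (J := J) hab hT hI
  have hex : ∀ f : Lp X p (vol a b), ∃ v : Lp D p (vol a b), Sol J A p a b f 0 v := fun f => by
    obtain ⟨v, hv⟩ := h.1 f (Lp.memLp f)
    exact ⟨hv.memLp.toLp v, hv.congr (ae_eq_refl _) hv.memLp.coeFn_toLp.symm⟩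
  choose S hS using hex
  have huniq : ∀ f v, Sol J A p a b f 0 v → ∀ hv : MemLp v p (vol a b), ∀ hf : MemLp f p (vol a b),
      hv.toLp v = S (hf.toLp f) := fun f v hs hv hf => by
    refine Lp.ext (hv.coeFn_toLp.trans ?_)
    exact h.unique hp.out hA hf hs ((hS (hf.toLp f)).congr hf.coeFn_toLp (ae_eq_refl _))
  have huniq' : ∀ f v, J.compLpL p (vol a b) v = I (f - T v) → v = S f := fun f v hv => by
    refine Lp.ext ?_
    exact h.unique hp.out hA (Lp.memLp f) ((hiff f v).2 hv) (hS f)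
  have hS' : ∀ f, J.compLpL p (vol a b) (S f) = I (f - T (S f)) := fun f => (hiff f _).1 (hS f)
  let S₀ : Lp X p (vol a b) →ₗ[ℝ] Lp D p (vol a b) :=
    { toFun := S
      map_add' := fun f g => by
        refine (huniq' _ _ ?_).symm
        rw [map_add, hS', hS', ← map_add, map_add T]
        congr 1; abel
      map_smul' := fun c f => by
        refine (huniq' _ _ ?_).symm
        rw [RingHom.id_apply, map_smul, hS', ← map_smul, map_smul T, smul_sub] }
  refine ⟨⟨S₀, S₀.continuous_of_seq_closed_graph fun u f v hu hv => ?_⟩, hS⟩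
  refine huniq' _ _ ?_
  have l1 : Tendsto (fun n => J.compLpL p (vol a b) (S (u n))) atTop
      (𝓝 (J.compLpL p (vol a b) v)) := ((J.compLpL p (vol a b)).continuous.tendsto v).comp hv
  have l2 : Tendsto (fun n => I (u n - T (S (u n)))) atTop (𝓝 (I (f - T v))) :=
    (I.continuous.tendsto _).comp (hu.sub ((T.continuous.tendsto _).comp hv))
  refine tendsto_nhds_unique l1 (l2.congr fun n => (hS' _).symm)

/-- A priori estimate, by the closed graph theorem. -/
theorem US.exists_bound (hp : 1 ≤ p) (h : US J A p a b) (hab : a < b) (hA : FamBdd A a b M)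
    (hM : 0 ≤ M) : ∃ C, 0 ≤ C ∧ ∀ f v, MemLp f p (vol a b) → Sol J A p a b f 0 v →
      lpn p a b v ≤ C * lpn p a b f := by
  have : Fact (1 ≤ p) := ⟨hp⟩
  obtain ⟨S, hS⟩ := h.exists_solOp hab hA hM
  refine ⟨‖S‖, norm_nonneg _, fun f v hf hv => ?_⟩
  have h1 := S.le_opNorm (hf.toLp f)
  rw [lpn_toLp, toReal_lp_norm] at h1
  refine (lpn_congr ?_).trans_le h1
  exact h.unique hp hA hf hv ((hS (hf.toLp f)).congr hf.coeFn_toLp (ae_eq_refl _))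

/-- With `S` the solution operator of `A` and `T` multiplication by `B`, a solution for `A + B` is
`S g` with `(1 + T S) g = f`, and `1 + T S` is invertible by a Neumann series. For uniqueness, a
homogeneous solution `v` solves the problem for `A` with right-hand side `-B v`, so the norm of `B
v` is at most `κ` times itself; hence `B v = 0`, and then `v = 0`. -/
theorem US.perturb (hp : 1 ≤ p) (h : US J A p a b) (hab : a < b) (hA : FamBdd A a b M)
    (hM : 0 ≤ M) (hB : FamBdd B a b N) (hN : 0 ≤ N) {κ : ℝ} (hκ : κ < 1)
    (hsmall : ∀ f v, MemLp f p (vol a b) → Sol J A p a b f 0 v →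
      lpn p a b (fun t => B t (v t)) ≤ κ * lpn p a b f) :
    US J (fun t => A t + B t) p a b := by
  have : Fact (1 ≤ p) := ⟨hp⟩
  obtain ⟨S, hS⟩ := h.exists_solOp hab hA hM
  obtain ⟨T, hT⟩ := exists_mulOp (p := p) hB hN
  have hnorm : ‖-(T ∘L S)‖ < 1 := by
    rw [norm_neg]
    refine (ContinuousLinearMap.opNorm_le_bound _ (le_max_right κ 0) fun f => ?_).trans_lt
      (max_lt hκ zero_lt_one)
    have h1 := hsmall f (S f) (Lp.memLp f) (hS f)
    rw [toReal_lp_norm, toReal_lp_norm, ContinuousLinearMap.comp_apply, lpn_congr (hT (S f))]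
    exact h1.trans (mul_le_mul_of_nonneg_right (le_max_left _ _) (lpn_nonneg p a b f))
  have hunit := isUnit_one_sub_of_norm_lt_one hnorm
  constructor
  · intro f hf
    obtain ⟨g, hg⟩ : ∃ g, (1 - -(T ∘L S)) g = hf.toLp f := by
      obtain ⟨u, hu⟩ := hunit
      refine ⟨(↑u⁻¹ : Lp X p (vol a b) →L[ℝ] Lp X p (vol a b)) (hf.toLp f), ?_⟩
      rw [← hu, ← mul_apply_eq_comp, Units.mul_inv, one_apply_eq_self]
    have hg' : hf.toLp f = g + T (S g) := by simpa using hg.symm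
    have hae : f =ᵐ[vol a b] fun t => g t + B t (S g t) := by
      refine hf.coeFn_toLp.symm.trans ?_
      rw [hg']
      filter_upwards [Lp.coeFn_add g (T (S g)), hT (S g)] with t h1 h2
      rw [h1, Pi.add_apply, h2]
    refine ⟨S g, (hS g).memLp, ?_⟩
    filter_upwards [(hS g).eq, ae_vol_mem a b] with t ht hmem
    rw [ht]
    congr 1
    refine volt_congr ?_ ⟨le_rfl, hab.le⟩ (Ioo_subset_Icc_self hmem)
    filter_upwards [hae] with s hs
    rw [hs, add_apply]
    abel
  · intro v hv
    have hBv := hB.memLp hv.memLp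
    have h1 : Sol J A p a b (fun t => -(B t (v t))) 0 v := by
      refine ⟨hv.memLp, ?_⟩
      filter_upwards [hv.eq] with t ht
      rw [ht]
      congr 1
      refine intervalIntegral.integral_congr fun s _ => ?_
      simp only [add_apply]
      abel
    have h2 : lpn p a b (fun t => B t (v t)) ≤ κ * lpn p a b (fun t => -(B t (v t))) :=
      hsmall _ v hBv.neg h1
    have h3 : lpn p a b (fun t => -(B t (v t))) = lpn p a b (fun t => B t (v t)) := by
      have := lpn_smul (p := p) (a := a) (b := b) (-1) (fun t => B t (v t))
      simpa using this
    rw [h3] at h2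
    have h4 : lpn p a b (fun t => B t (v t)) = 0 := by
      have := lpn_nonneg p a b (fun t => B t (v t))
      nlinarith
    have h5 : (fun t => B t (v t)) =ᵐ[vol a b] 0 := by
      rw [lpn, ENNReal.toReal_eq_zero_iff] at h4
      rcases h4 with h4 | h4
      · exact (eLpNorm_eq_zero_iff hBv.1 (by positivity)).1 h4
      · exact absurd h4 hBv.2.ne
    refine h.2 v (h1.congr ?_ (ae_eq_refl _))
    filter_upwards [h5] with t ht
    rw [ht]; simp

end Operators

/-! ### From the weak formulation over `𝕜` to the integrated one over `ℝ` -/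

section Transfer

variable {𝕜 : Type*} [RCLike 𝕜]
variable {X : Type*} [NormedAddCommGroup X] [NormedSpace 𝕜 X] [NormedSpace ℝ X] [CompleteSpace X]
variable {D : Type*} [NormedAddCommGroup D] [NormedSpace 𝕜 D] [NormedSpace ℝ D]
  [IsScalarTower ℝ 𝕜 D]
variable {J : D →L[𝕜] X} {A : ℝ → D →L[𝕜] X} {p : ℝ} {a b M : ℝ} {f : ℝ → X} {x : X}
  {u : ℝ → X} {v : ℝ → D}

theorem isSolution_iff (hp : 1 ≤ p) (hab : a < b)
    (hA : FamBdd (fun t => (A t).restrictScalars ℝ) a b M)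
    (hf : MemLp f (ENNReal.ofReal p) (vol a b)) :
    IsSolution J A p a b f x u v ↔
      Sol (J.restrictScalars ℝ) (fun t => (A t).restrictScalars ℝ) (ENNReal.ofReal p) a b f x v ∧
      ∀ t ∈ Icc a b, u t = x + ∫ s in a..t, (f s - A s (v s)) := by
  have hp' : 1 ≤ ENNReal.ofReal p := by simpa using hp
  constructor
  · rintro ⟨g, hM, heq, rfl⟩
    have h1 := hM.hasWeakDeriv.eq_volt hp' hab hM.continuousOn hM.memLp_deriv
    have h2 : g =ᵐ[vol a b] fun s => f s - A s (v s) := by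
      filter_upwards [heq] with t ht
      rw [← ht]; abel
    have h3 : ∀ t ∈ Icc a b, u t = u a + ∫ s in a..t, (f s - A s (v s)) := fun t ht => by
      rw [h1 t ht, volt_congr h2 ⟨le_rfl, hab.le⟩ ht]
    refine ⟨⟨hM.memLp_dom, ?_⟩, h3⟩
    filter_upwards [hM.embed_ae, ae_vol_mem a b] with t ht hmem
    exact ht.trans (h3 t (Ioo_subset_Icc_self hmem))
  · rintro ⟨hs, hu⟩
    have hr : MemLp (fun s => f s - A s (v s)) (ENNReal.ofReal p) (vol a b) := hs.memLp_rhs hA hf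
    have hc : ContinuousOn u (Icc a b) :=
      (continuousOn_const.add (continuousOn_volt hp' hr)).congr hu
    refine ⟨fun s => f s - A s (v s), ⟨hc, memLp_of_continuousOn hc, hr, ?_, hs.memLp, ?_⟩, ?_, ?_⟩
    · intro φ h1 h2 h3
      rw [← hasWeakDeriv_volt hp' hab hr x φ h1 h2 h3]
      refine integral_congr_ae ?_
      filter_upwards [ae_vol_mem a b] with t ht
      rw [hu t (Ioo_subset_Icc_self ht)]
    · filter_upwards [hs.eq, ae_vol_mem a b] with t ht hmem
      rw [hu t (Ioo_subset_Icc_self hmem)]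
      exact ht
    · exact Eventually.of_forall fun t => by simp
    · rw [hu a ⟨le_rfl, hab.le⟩]; simp

/-- Uniqueness on the left concerns `u` on `[a, b]`, on the right the `D`-valued `v` a.e.
Injectivity of `J` leads from `u` to `v`, the integral formula from `v` back to `u`. -/
theorem uniquelySolvable_iff (hJ : Function.Injective J) (hp : 1 ≤ p) (hab : a < b)
    (hA : FamBdd (fun t => (A t).restrictScalars ℝ) a b M) :
    UniquelySolvable J A p a b ↔
      US (J.restrictScalars ℝ) (fun t => (A t).restrictScalars ℝ) (ENNReal.ofReal p) a b := by
  have hp' : 1 ≤ ENNReal.ofReal p := by simpa using hp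
  constructor
  · intro h
    refine ⟨fun f hf => ?_, fun v hv => ?_⟩
    · obtain ⟨u, v, hs, -⟩ := h f hf
      exact ⟨v, ((isSolution_iff hp hab hA hf).1 hs).1⟩
    · obtain ⟨u', v', -, huniq⟩ := h (fun _ => 0) MemLp.zero
      have h0 : EqOn (fun _ => 0) u' (Icc a b) := huniq _ (fun _ => 0)
        ((isSolution_iff hp hab hA MemLp.zero).2 ⟨Sol.zero, by simp⟩)
      have h1 : EqOn _ u' (Icc a b) := huniq _ v
        ((isSolution_iff hp hab hA MemLp.zero).2 ⟨hv, fun t _ => rfl⟩)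
      filter_upwards [hv.eq, ae_vol_mem a b] with t ht hmem
      refine hJ ?_
      rw [Pi.zero_apply, map_zero]
      have h2 := (h1 (Ioo_subset_Icc_self hmem)).trans (h0 (Ioo_subset_Icc_self hmem)).symm
      exact Eq.trans ht h2
  · intro h f hf
    obtain ⟨v, hv⟩ := h.1 f hf
    refine ⟨_, v, (isSolution_iff hp hab hA hf).2 ⟨hv, fun t _ => rfl⟩, fun u' v' h' t ht => ?_⟩
    obtain ⟨h1, h2⟩ := (isSolution_iff hp hab hA hf).1 h'
    rw [h2 t ht]
    congr 1
    refine volt_congr ?_ ⟨le_rfl, hab.le⟩ ht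
    filter_upwards [h.unique hp' hA hf h1 hv] with s hs
    rw [hs]

end Transfer

/-! ### Discrete Calderón–Zygmund decomposition -/

section DiscreteCZ

/-- Stopping-time decomposition of a block of length `2 ^ N`; intervals are recorded as pairs
(starting point, length). -/
theorem exists_stopping_intervals {F : ℕ → ℝ} (hF : ∀ m, 0 ≤ F m) {l : ℝ} (N : ℕ) :
    ∀ a : ℕ, ∑ m ∈ Finset.Ico a (a + 2 ^ N), F m ≤ l * 2 ^ N →
    ∃ s : Finset (ℕ × ℕ), (∀ I ∈ s, a ≤ I.1 ∧ I.1 + I.2 ≤ a + 2 ^ N ∧ 0 < I.2) ∧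
      (∀ I ∈ s, ∀ I' ∈ s, ∀ m, m ∈ Finset.Ico I.1 (I.1 + I.2) →
        m ∈ Finset.Ico I'.1 (I'.1 + I'.2) → I = I') ∧
      (∀ I ∈ s, l * I.2 < ∑ m ∈ Finset.Ico I.1 (I.1 + I.2), F m ∧
        ∑ m ∈ Finset.Ico I.1 (I.1 + I.2), F m ≤ 2 * l * I.2) ∧
      ∀ m ∈ Finset.Ico a (a + 2 ^ N), (∀ I ∈ s, m ∉ Finset.Ico I.1 (I.1 + I.2)) → F m ≤ l := by
  induction N with
  | zero =>
    intro a h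
    refine ⟨∅, by simp, by simp, by simp, ?_⟩
    intro m hm _
    simp at hm h
    have : m = a := by omega
    rwa [this]
  | succ N ih =>
    -- Each half of a block with average at most `l` has average at most `2 l`. If its average is
    -- still at most `l` it is subdivided further; otherwise it is selected, with average in `(l, 2
    -- l]`.
    have half : ∀ a : ℕ, ∑ m ∈ Finset.Ico a (a + 2 ^ N), F m ≤ 2 * l * 2 ^ N →
        ∃ s : Finset (ℕ × ℕ), (∀ I ∈ s, a ≤ I.1 ∧ I.1 + I.2 ≤ a + 2 ^ N ∧ 0 < I.2) ∧
          (∀ I ∈ s, ∀ I' ∈ s, ∀ m, m ∈ Finset.Ico I.1 (I.1 + I.2) →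
            m ∈ Finset.Ico I'.1 (I'.1 + I'.2) → I = I') ∧
          (∀ I ∈ s, l * I.2 < ∑ m ∈ Finset.Ico I.1 (I.1 + I.2), F m ∧
            ∑ m ∈ Finset.Ico I.1 (I.1 + I.2), F m ≤ 2 * l * I.2) ∧
          ∀ m ∈ Finset.Ico a (a + 2 ^ N), (∀ I ∈ s, m ∉ Finset.Ico I.1 (I.1 + I.2)) → F m ≤ l := by
      intro a h
      rcases le_or_gt (∑ m ∈ Finset.Ico a (a + 2 ^ N), F m) (l * 2 ^ N) with h1 | h1
      · exact ih a h1
      · refine ⟨{(a, 2 ^ N)}, ?_, ?_, ?_, ?_⟩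
        · intro I hI
          rw [Finset.mem_singleton.1 hI]
          exact ⟨le_rfl, le_rfl, by positivity⟩
        · intro I hI I' hI' _ _ _
          rw [Finset.mem_singleton.1 hI, Finset.mem_singleton.1 hI']
        · intro I hI
          rw [Finset.mem_singleton.1 hI]
          push_cast
          exact ⟨h1, h⟩
        · intro m hm hI
          exact absurd hm (hI _ (Finset.mem_singleton_self _))
    intro a h
    have hsplit : ∑ m ∈ Finset.Ico a (a + 2 ^ N), F m +
        ∑ m ∈ Finset.Ico (a + 2 ^ N) (a + 2 ^ N + 2 ^ N), F m =
        ∑ m ∈ Finset.Ico a (a + 2 ^ (N + 1)), F m := by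
      rw [Finset.sum_Ico_consecutive _ (Nat.le_add_right _ _) (Nat.le_add_right _ _)]
      congr 2; ring
    have hn1 : 0 ≤ ∑ m ∈ Finset.Ico a (a + 2 ^ N), F m := Finset.sum_nonneg fun _ _ => hF _
    have hn2 : 0 ≤ ∑ m ∈ Finset.Ico (a + 2 ^ N) (a + 2 ^ N + 2 ^ N), F m :=
      Finset.sum_nonneg fun _ _ => hF _
    have hpow : l * 2 ^ (N + 1) = 2 * l * 2 ^ N := by ring
    have hpow' : a + 2 ^ (N + 1) = a + 2 ^ N + 2 ^ N := by ring
    obtain ⟨s, s1, s2, s3, s4⟩ := half a (by linarith)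
    obtain ⟨t, t1, t2, t3, t4⟩ := half (a + 2 ^ N) (by linarith)
    refine ⟨s ∪ t, ?_, ?_, ?_, ?_⟩
    · intro I hI
      rcases Finset.mem_union.1 hI with h | h
      · have := s1 I h; omega
      · have := t1 I h; omega
    · intro I hI I' hI' m hm hm'
      rw [Finset.mem_Ico] at hm hm'
      rcases Finset.mem_union.1 hI with h | h <;> rcases Finset.mem_union.1 hI' with h' | h'
      · exact s2 I h I' h' m (Finset.mem_Ico.2 hm) (Finset.mem_Ico.2 hm')
      · have := s1 I h; have := t1 I' h'; omega
      · have := t1 I h; have := s1 I' h'; omega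
      · exact t2 I h I' h' m (Finset.mem_Ico.2 hm) (Finset.mem_Ico.2 hm')
    · intro I hI
      rcases Finset.mem_union.1 hI with h | h
      · exact s3 I h
      · exact t3 I h
    · intro m hm hI
      rw [Finset.mem_Ico] at hm
      rcases lt_or_ge m (a + 2 ^ N) with h | h
      · exact s4 m (Finset.mem_Ico.2 ⟨hm.1, h⟩) fun I h' => hI I (Finset.mem_union_left _ h')
      · exact t4 m (Finset.mem_Ico.2 ⟨h, by omega⟩) fun I h' => hI I (Finset.mem_union_right _ h')

variable {Y Z : Type*} [NormedAddCommGroup Y] [NormedSpace ℝ Y]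
  [NormedAddCommGroup Z] [NormedSpace ℝ Z]

theorem card_mul_le_sum {n : ℕ} (G : ℕ → ℝ) (hG : ∀ i, 0 ≤ G i) (l : ℝ) (P : ℕ → Prop)
    [DecidablePred P] (hP : ∀ i ∈ Finset.range n, P i → l ≤ G i) :
    l * ((Finset.range n).filter P).card ≤ ∑ i ∈ Finset.range n, G i := by
  calc l * ((Finset.range n).filter P).card = ∑ i ∈ (Finset.range n).filter P, l := by
        rw [Finset.sum_const, nsmul_eq_mul, mul_comm]
    _ ≤ ∑ i ∈ (Finset.range n).filter P, G i := by
        refine Finset.sum_le_sum fun i hi => ?_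
        rw [Finset.mem_filter] at hi
        exact hP i hi.1 hi.2
    _ ≤ _ := Finset.sum_le_sum_of_subset_of_nonneg (Finset.filter_subset _ _) fun i _ _ => hG i

open Classical in
/-- Distributional estimate of Calderon–Zygmund type for a discrete kernel. -/
theorem cz_distribution {N : ℕ} {k : ℕ → ℕ → Y →L[ℝ] Z} {p B l : ℝ} (hp : 1 ≤ p) (hB : 0 ≤ B)
    (hl : 0 < l)
    (hbd : ∀ f : ℕ → Y, ∑ i ∈ Finset.range (2 ^ N), ‖∑ m ∈ Finset.range (2 ^ N), k i m (f m)‖ ^ p ≤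
      B ^ p * ∑ m ∈ Finset.range (2 ^ N), ‖f m‖ ^ p)
    (hH : ∀ a r m, a + r ≤ 2 ^ N → m ∈ Finset.Ico a (a + r) →
      ∑ i ∈ (Finset.range (2 ^ N)).filter (fun i => i + r < a ∨ a + 2 * r ≤ i),
        ‖k i m - k i a‖ ≤ B)
    (f : ℕ → Y) (havg : ∑ m ∈ Finset.range (2 ^ N), ‖f m‖ ≤ l * 2 ^ N) :
    (((Finset.range (2 ^ N)).filter
      (fun i => 2 * l < ‖∑ m ∈ Finset.range (2 ^ N), k i m (f m)‖)).card : ℝ) ≤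
      B ^ p * l ^ (-p) * (∑ m ∈ Finset.range (2 ^ N), if ‖f m‖ ≤ l then ‖f m‖ ^ p else 0) +
      (2 ^ p * B ^ p + 3 + 4 * B) *
        (2 / l * ∑ m ∈ Finset.range (2 ^ N), if l / 2 < ‖f m‖ then ‖f m‖ else 0) := by
  set n := 2 ^ N with hn
  obtain ⟨s, s1, s2, s3, s4⟩ := exists_stopping_intervals (F := fun m => ‖f m‖) (l := l)
    (fun m => norm_nonneg _) N 0 (by
      rw [zero_add, ← Finset.range_eq_Ico]; exact havg)
  simp only [zero_le, true_and, zero_add, ← Finset.range_eq_Ico] at s1 s4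
  let Q : ℕ × ℕ → Finset ℕ := fun I => Finset.Ico I.1 (I.1 + I.2)
  have hQ : Q = fun I => Finset.Ico I.1 (I.1 + I.2) := rfl
  have hQsub : ∀ I ∈ s, Q I ⊆ Finset.range n := fun I hI m hm => by
    have := (s1 I hI).1
    simp only [hQ, Finset.mem_Ico] at hm
    exact Finset.mem_range.2 (by omega)
  have hcard : ∀ I, ((Q I).card : ℝ) = I.2 := fun I => by simp [hQ]
  have hrpos : ∀ I ∈ s, (0 : ℝ) < I.2 := fun I hI => by exact_mod_cast (s1 I hI).2
  -- averages, bad and good parts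
  set av : ℕ × ℕ → Y := fun I => (I.2 : ℝ)⁻¹ • ∑ m ∈ Q I, f m with hav
  set bb : ℕ × ℕ → ℕ → Y := fun I m => if m ∈ Q I then f m - av I else 0 with hbb
  set g : ℕ → Y := fun m => f m - ∑ I ∈ s, bb I m with hg
  have hav_le : ∀ I ∈ s, ‖av I‖ * I.2 ≤ ∑ m ∈ Q I, ‖f m‖ := fun I hI => by
    rw [hav, norm_smul, norm_inv, Real.norm_natCast, mul_comm, ← mul_assoc,
      mul_inv_cancel₀ (hrpos I hI).ne', one_mul]
    exact norm_sum_le _ _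
  have hav_le' : ∀ I ∈ s, ‖av I‖ ≤ 2 * l := fun I hI => by
    have h1 := (hav_le I hI).trans (s3 I hI).2
    exact le_of_mul_le_mul_right h1 (hrpos I hI)
  have hbsum : ∀ I ∈ s, ∀ m ∈ Q I, ∑ I' ∈ s, bb I' m = f m - av I := fun I hI m hm => by
    rw [Finset.sum_eq_single I]
    · simp [hbb, hm]
    · intro I' hI' hne
      simp only [hbb]
      rw [if_neg]
      intro hm'
      exact hne (s2 I' hI' I hI m hm' hm)
    · exact fun h => absurd hI h
  have hboff : ∀ m, (∀ I ∈ s, m ∉ Q I) → ∑ I' ∈ s, bb I' m = 0 := fun m hm =>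
    Finset.sum_eq_zero fun I hI => by simp [hbb, hm I hI]
  -- On a selected interval the average of `‖f‖` exceeds `l`, while the entries of size at most `l /
  -- 2` account for at most `l / 2` of it. Hence the large entries alone control the total length.
  have hΩ : ∑ I ∈ s, (I.2 : ℝ) ≤
      2 / l * ∑ m ∈ Finset.range n, if l / 2 < ‖f m‖ then ‖f m‖ else 0 := by
    have h1 : l * ∑ I ∈ s, (I.2 : ℝ) ≤ (∑ m ∈ Finset.range n, if l / 2 < ‖f m‖ then ‖f m‖ else 0)
        + l / 2 * ∑ I ∈ s, (I.2 : ℝ) := by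
      have h2 : ∀ I ∈ s, l * (I.2 : ℝ) ≤ (∑ m ∈ Q I, if l / 2 < ‖f m‖ then ‖f m‖ else 0) +
          l / 2 * I.2 := fun I hI => by
        refine (s3 I hI).1.le.trans ?_
        rw [← hcard, mul_comm (l / 2), ← nsmul_eq_mul, ← Finset.sum_const,
          ← Finset.sum_add_distrib]
        refine Finset.sum_le_sum fun m _ => ?_
        split_ifs with h
        · linarith
        · linarith [not_lt.1 h]
      rw [Finset.mul_sum, Finset.mul_sum]
      refine (Finset.sum_le_sum h2).trans ?_
      rw [Finset.sum_add_distrib]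
      refine add_le_add_left ?_ _
      rw [← Finset.sum_biUnion]
      · refine Finset.sum_le_sum_of_subset_of_nonneg (Finset.biUnion_subset.2 hQsub) ?_
        intro i _ _
        split_ifs <;> simp
      · intro I hI I' hI' hne
        rw [Function.onFun, Finset.disjoint_left]
        exact fun m hm hm' => hne (s2 I hI I' hI' m hm hm')
    rw [div_mul_eq_mul_div, le_div_iff₀ hl]
    linarith
  -- The good part equals `f`, of size at most `l`, off the selected intervals, and an average of
  -- size at most `2 l` on them.
  have hgp : ∑ m ∈ Finset.range n, ‖g m‖ ^ p ≤
      (∑ m ∈ Finset.range n, if ‖f m‖ ≤ l then ‖f m‖ ^ p else 0) +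
        (2 * l) ^ p * ∑ I ∈ s, (I.2 : ℝ) := by
    have h1 : ∑ I ∈ s, (I.2 : ℝ) = ∑ m ∈ Finset.range n, ∑ I ∈ s, if m ∈ Q I then (1 : ℝ) else 0 := by
      rw [Finset.sum_comm]
      refine Finset.sum_congr rfl fun I hI => ?_
      rw [Finset.sum_ite_mem, Finset.inter_eq_right.2 (hQsub I hI), ← hcard]
      simp
    rw [h1, Finset.mul_sum, ← Finset.sum_add_distrib]
    refine Finset.sum_le_sum fun m hm => ?_
    have hn1 : (0 : ℝ) ≤ if ‖f m‖ ≤ l then ‖f m‖ ^ p else 0 := by split_ifs <;> positivity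
    have hn2 : (0 : ℝ) ≤ ∑ I ∈ s, if m ∈ Q I then (1 : ℝ) else 0 :=
      Finset.sum_nonneg fun I _ => by split_ifs <;> simp
    by_cases hc : ∃ I ∈ s, m ∈ Q I
    · obtain ⟨I, hI, hmI⟩ := hc
      have h2 : g m = av I := by rw [hg]; simp only; rw [hbsum I hI m hmI]; abel
      have h3 : (1 : ℝ) ≤ ∑ I ∈ s, if m ∈ Q I then (1 : ℝ) else 0 := by
        have := Finset.single_le_sum (f := fun I => if m ∈ Q I then (1 : ℝ) else 0)
          (fun I _ => by split_ifs <;> simp) hI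
        simpa [hmI] using this
      rw [h2]
      have h4 : ‖av I‖ ^ p ≤ (2 * l) ^ p :=
        Real.rpow_le_rpow (norm_nonneg _) (hav_le' I hI) (by linarith)
      have h5 : 0 ≤ (2 * l) ^ p := by positivity
      nlinarith
    · push Not at hc
      have h2 : g m = f m := by rw [hg]; simp only; rw [hboff m hc, sub_zero]
      have h3 : ‖f m‖ ≤ l := s4 m hm hc
      rw [h2, if_pos h3]
      have h5 : 0 ≤ (2 * l) ^ p := by positivity
      have := mul_nonneg h5 hn2
      linarith
  -- the two parts of the level set
  set K : (ℕ → Y) → ℕ → Z := fun f i => ∑ m ∈ Finset.range n, k i m (f m) with hK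
  have hKsplit : ∀ i, K f i = K g i + ∑ I ∈ s, K (bb I) i := fun i => by
    simp only [hK, hg]
    rw [Finset.sum_comm, ← Finset.sum_add_distrib]
    refine Finset.sum_congr rfl fun m _ => ?_
    rw [map_sub, map_sum]; abel
  set far : ℕ × ℕ → ℕ → Prop := fun I i => i + I.2 < I.1 ∨ I.1 + 2 * I.2 ≤ i with hfar
  -- The bad part on `I` has mean zero, so `k i m` may be replaced by `k i m - k i I.1`, and
  -- Hörmander's condition applies away from `I`. The factor 4 bounds the mass of `f` minus its
  -- average: `2 l + 2 l` per unit length.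
  have hbad : ∀ I ∈ s, ∑ i ∈ (Finset.range n).filter (far I), ‖K (bb I) i‖ ≤ 4 * B * l * I.2 := by
    intro I hI
    have hzero : ∑ m ∈ Q I, bb I m = 0 := by
      have h1 : ∑ m ∈ Q I, bb I m = ∑ m ∈ Q I, (f m - av I) :=
        Finset.sum_congr rfl fun m hm => by simp [hbb, hm]
      rw [h1, Finset.sum_sub_distrib, Finset.sum_const, ← Nat.cast_smul_eq_nsmul ℝ, hcard, hav,
        smul_smul, mul_inv_cancel₀ (hrpos I hI).ne', one_smul, sub_self]
    have hrep : ∀ i, K (bb I) i = ∑ m ∈ Q I, (k i m - k i I.1) (bb I m) := fun i => by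
      have h1 : K (bb I) i = ∑ m ∈ Q I, k i m (bb I m) := by
        simp only [hK]
        refine (Finset.sum_subset (hQsub I hI) fun m _ hm => ?_).symm
        simp [hbb, hm]
      rw [h1]
      simp only [sub_apply, Finset.sum_sub_distrib]
      rw [← map_sum (k i I.1), hzero, map_zero, sub_zero]
    have hnb : ∑ m ∈ Q I, ‖bb I m‖ ≤ 4 * l * I.2 := by
      have h1 : ∑ m ∈ Q I, ‖bb I m‖ ≤ ∑ m ∈ Q I, (‖f m‖ + ‖av I‖) :=
        Finset.sum_le_sum fun m hm => by
          simp only [hbb, if_pos hm]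
          exact norm_sub_le _ _
      rw [Finset.sum_add_distrib, Finset.sum_const, nsmul_eq_mul, hcard] at h1
      have h2 := (s3 I hI).2
      have h3 := hav_le I hI
      linarith
    calc ∑ i ∈ (Finset.range n).filter (far I), ‖K (bb I) i‖
        ≤ ∑ i ∈ (Finset.range n).filter (far I), ∑ m ∈ Q I, ‖k i m - k i I.1‖ * ‖bb I m‖ := by
          refine Finset.sum_le_sum fun i _ => ?_
          rw [hrep]
          exact norm_sum_le_of_le _ fun m _ => ContinuousLinearMap.le_opNorm _ _
      _ = ∑ m ∈ Q I, (∑ i ∈ (Finset.range n).filter (far I), ‖k i m - k i I.1‖) * ‖bb I m‖ := by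
          rw [Finset.sum_comm]
          simp_rw [Finset.sum_mul]
      _ ≤ ∑ m ∈ Q I, B * ‖bb I m‖ := by
          refine Finset.sum_le_sum fun m hm => mul_le_mul_of_nonneg_right ?_ (norm_nonneg _)
          exact hH I.1 I.2 m (s1 I hI).1 hm
      _ ≤ 4 * B * l * I.2 := by
          rw [← Finset.mul_sum]
          calc _ ≤ B * (4 * l * I.2) := mul_le_mul_of_nonneg_left hnb hB
            _ = _ := by ring
  -- If `2 l < ‖K f i‖`, then the good part exceeds `l` at `i`, or `i` is close to a selected
  -- interval, or `i` is far from all of them and the bad part exceeds `l`.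
  set S1 := (Finset.range n).filter (fun i => l < ‖K g i‖) with hS1
  set S2 := (Finset.range n).filter (fun i => ∃ I ∈ s, ¬ far I i) with hS2
  set S3 := (Finset.range n).filter
    (fun i => (∀ I ∈ s, far I i) ∧ l < ‖∑ I ∈ s, K (bb I) i‖) with hS3
  have hsub : (Finset.range n).filter (fun i => 2 * l < ‖K f i‖) ⊆ S1 ∪ S2 ∪ S3 := by
    intro i hi
    rw [Finset.mem_filter] at hi
    simp only [hS1, hS2, hS3, Finset.mem_union, Finset.mem_filter, hi.1, true_and]
    by_cases h1 : l < ‖K g i‖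
    · exact Or.inl (Or.inl h1)
    by_cases h2 : ∃ I ∈ s, ¬ far I i
    · exact Or.inl (Or.inr h2)
    refine Or.inr ⟨by push Not at h2; exact h2, ?_⟩
    have h3 := hi.2
    rw [hKsplit] at h3
    have h4 := norm_add_le (K g i) (∑ I ∈ s, K (bb I) i)
    linarith [not_lt.1 h1]
  have hc1 : (S1.card : ℝ) ≤ l ^ (-p) * (B ^ p * ∑ m ∈ Finset.range n, ‖g m‖ ^ p) := by
    have h1 := card_mul_le_sum (n := n) (fun i => ‖K g i‖ ^ p) (fun i => by positivity) (l ^ p)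
      (fun i => l < ‖K g i‖) (fun i _ h => Real.rpow_le_rpow hl.le h.le (by linarith))
    have h2 := h1.trans (hbd g)
    rw [Real.rpow_neg hl.le, ← div_eq_inv_mul, le_div_iff₀ (by positivity), mul_comm]
    exact h2
  have hc2 : (S2.card : ℝ) ≤ 3 * ∑ I ∈ s, (I.2 : ℝ) := by
    -- The subtraction is truncated at zero, which only shortens the interval; its length is at most
    -- `3 * I.2` in any case.
    have h1 : S2 ⊆ s.biUnion fun I => Finset.Ico (I.1 - I.2) (I.1 + 2 * I.2) := by
      intro i hi
      simp only [hS2, Finset.mem_filter, hfar] at hi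
      obtain ⟨-, I, hI, h⟩ := hi
      push Not at h
      rw [Finset.mem_biUnion]
      exact ⟨I, hI, Finset.mem_Ico.2 (by omega)⟩
    have h2 := (Finset.card_le_card h1).trans Finset.card_biUnion_le
    have h3 : ∑ I ∈ s, (Finset.Ico (I.1 - I.2) (I.1 + 2 * I.2)).card ≤ ∑ I ∈ s, 3 * I.2 :=
      Finset.sum_le_sum fun I _ => by rw [Nat.card_Ico]; omega
    have h4 : (S2.card : ℝ) ≤ ((∑ I ∈ s, 3 * I.2 : ℕ) : ℝ) := by exact_mod_cast h2.trans h3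
    push_cast at h4
    rwa [Finset.mul_sum]
  have hc3 : (S3.card : ℝ) ≤ 4 * B * ∑ I ∈ s, (I.2 : ℝ) := by
    have h1 : l * S3.card ≤ ∑ i ∈ S3, ‖∑ I ∈ s, K (bb I) i‖ := by
      rw [mul_comm, ← nsmul_eq_mul, ← Finset.sum_const]
      refine Finset.sum_le_sum fun i hi => ?_
      simp only [hS3, Finset.mem_filter] at hi
      exact hi.2.2.le
    have h2 : ∑ i ∈ S3, ‖∑ I ∈ s, K (bb I) i‖ ≤ ∑ I ∈ s, 4 * B * l * I.2 := by
      calc ∑ i ∈ S3, ‖∑ I ∈ s, K (bb I) i‖ ≤ ∑ i ∈ S3, ∑ I ∈ s, ‖K (bb I) i‖ :=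
            Finset.sum_le_sum fun i _ => norm_sum_le _ _
        _ = ∑ I ∈ s, ∑ i ∈ S3, ‖K (bb I) i‖ := Finset.sum_comm
        _ ≤ _ := by
            refine Finset.sum_le_sum fun I hI => le_trans ?_ (hbad I hI)
            refine Finset.sum_le_sum_of_subset_of_nonneg ?_ fun _ _ _ => norm_nonneg _
            intro i hi
            simp only [hS3, Finset.mem_filter] at hi
            exact Finset.mem_filter.2 ⟨hi.1, hi.2.1 I hI⟩
    rw [← Finset.mul_sum] at h2
    have h3 := h1.trans h2
    have : l * S3.card ≤ l * (4 * B * ∑ I ∈ s, (I.2 : ℝ)) := by linarith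
    exact le_of_mul_le_mul_left this hl
  have hcard' : (((Finset.range n).filter (fun i => 2 * l < ‖K f i‖)).card : ℝ) ≤
      S1.card + S2.card + S3.card := by
    have h1 := (Finset.card_le_card hsub).trans
      ((Finset.card_union_le _ _).trans (add_le_add_left (Finset.card_union_le _ _) _))
    exact_mod_cast h1
  have hlp : l ^ (-p) * (2 * l) ^ p = 2 ^ p := by
    rw [Real.mul_rpow (by norm_num) hl.le, mul_left_comm, ← Real.rpow_add hl]
    simp
  have hBp : 0 ≤ B ^ p := by positivity
  have hlp0 : 0 ≤ l ^ (-p) := by positivity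
  have e1 : l ^ (-p) * (B ^ p * ∑ m ∈ Finset.range n, ‖g m‖ ^ p) ≤
      B ^ p * l ^ (-p) * (∑ m ∈ Finset.range n, if ‖f m‖ ≤ l then ‖f m‖ ^ p else 0) +
        2 ^ p * B ^ p * ∑ I ∈ s, (I.2 : ℝ) := by
    calc l ^ (-p) * (B ^ p * ∑ m ∈ Finset.range n, ‖g m‖ ^ p)
        ≤ l ^ (-p) * (B ^ p * ((∑ m ∈ Finset.range n, if ‖f m‖ ≤ l then ‖f m‖ ^ p else 0) +
          (2 * l) ^ p * ∑ I ∈ s, (I.2 : ℝ))) := by gcongr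
      _ = B ^ p * l ^ (-p) * (∑ m ∈ Finset.range n, if ‖f m‖ ≤ l then ‖f m‖ ^ p else 0) +
          (l ^ (-p) * (2 * l) ^ p) * B ^ p * ∑ I ∈ s, (I.2 : ℝ) := by ring
      _ = _ := by rw [hlp]
  have e2 : (2 ^ p * B ^ p + 3 + 4 * B) * ∑ I ∈ s, (I.2 : ℝ) ≤ (2 ^ p * B ^ p + 3 + 4 * B) *
        (2 / l * ∑ m ∈ Finset.range n, if l / 2 < ‖f m‖ then ‖f m‖ else 0) :=
    mul_le_mul_of_nonneg_left hΩ (by positivity)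
  calc _ ≤ (S1.card : ℝ) + S2.card + S3.card := hcard'
    _ ≤ _ := by linarith

end DiscreteCZ

/-! ### From the distributional estimate to `ℓ^q` bounds -/

section DiscreteInterpolation

theorem lintegral_Ioo_rpow {r c : ℝ} (hr : -1 < r) (hc : 0 ≤ c) :
    ∫⁻ l in Ioo 0 c, ENNReal.ofReal (l ^ r) = ENNReal.ofReal (c ^ (r + 1) / (r + 1)) := by
  rw [← ofReal_integral_eq_lintegral_ofReal]
  · rw [← integral_Ioc_eq_integral_Ioo, ← intervalIntegral.integral_of_le hc,
      integral_rpow (Or.inl hr), Real.zero_rpow (by linarith), sub_zero]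
  · have := intervalIntegral.intervalIntegrable_rpow' (a := 0) (b := c) hr
    rw [intervalIntegrable_iff_integrableOn_Ioc_of_le hc] at this
    exact this.mono_set Ioo_subset_Ioc_self
  · filter_upwards [ae_restrict_mem measurableSet_Ioo] with l hl
    exact Real.rpow_nonneg hl.1.le _

theorem lintegral_Ioi_rpow {r c : ℝ} (hr : r < -1) (hc : 0 < c) :
    ∫⁻ l in Ioi c, ENNReal.ofReal (l ^ r) = ENNReal.ofReal (-c ^ (r + 1) / (r + 1)) := by
  rw [← ofReal_integral_eq_lintegral_ofReal]
  · rw [integral_Ioi_rpow_of_lt hr hc]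
  · exact integrableOn_Ioi_rpow_of_lt hr hc
  · filter_upwards [ae_restrict_mem measurableSet_Ioi] with l hl
    exact Real.rpow_nonneg (hc.trans hl).le _

theorem setLIntegral_ite (s : Set ℝ) {t : Set ℝ} (ht : MeasurableSet t) (φ : ℝ → ℝ≥0∞)
    [∀ l, Decidable (l ∈ t)] :
    ∫⁻ l in s, (if l ∈ t then φ l else 0) = ∫⁻ l in t ∩ s, φ l := by
  rw [← setLIntegral_indicator ht]
  congr 1
  ext l
  simp [indicator]

variable {q p : ℝ}

/-- This and the next two lemmas integrate, for one entry of size `a`, the three terms of the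
distributional estimate against the weight `l^(q-1)`. The small-entry term converges at infinity
because `q < p`, the large-entry term at zero because `q > 1`. -/
theorem layer_upper (hq : 1 < q) {a : ℝ} (ha : 0 ≤ a) :
    ∫⁻ l in Ioi (0 : ℝ), (if 2 * l < a then ENNReal.ofReal (l ^ (q - 1)) else 0) =
      ENNReal.ofReal ((a / 2) ^ q / q) := by
  classical
  have h1 : ∀ l : ℝ, (2 * l < a) ↔ l ∈ Iio (a / 2) := fun l => by
    rw [mem_Iio, lt_div_iff₀ two_pos, mul_comm]
  simp_rw [h1]
  rw [setLIntegral_ite _ measurableSet_Iio, inter_comm, Ioi_inter_Iio,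
    lintegral_Ioo_rpow (by linarith) (by linarith), sub_add_cancel]

theorem layer_low (hqp : q < p) (hq : 1 < q) {a : ℝ} (ha : 0 ≤ a) :
    ∫⁻ l in Ioi (0 : ℝ), (if a ≤ l then ENNReal.ofReal (l ^ (q - 1 - p) * a ^ p) else 0) ≤
      ENNReal.ofReal (a ^ q / (p - q)) := by
  classical
  rcases ha.eq_or_lt with rfl | ha
  · rw [Real.zero_rpow (by linarith)]
    simp
  have h1 : ∀ l : ℝ, (a ≤ l) ↔ l ∈ Ici a := fun l => Iff.rfl
  simp_rw [h1]
  rw [setLIntegral_ite _ measurableSet_Ici,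
    inter_eq_left.2 (show Ici a ⊆ Ioi 0 from fun l hl => mem_Ioi.2 (ha.trans_le hl)),
    setLIntegral_congr Ioi_ae_eq_Ici.symm]
  simp_rw [ENNReal.ofReal_mul' (Real.rpow_nonneg ha.le p)]
  rw [lintegral_mul_const' _ _ ENNReal.ofReal_ne_top, lintegral_Ioi_rpow (by linarith) ha,
    ← ENNReal.ofReal_mul' (by positivity)]
  refine ENNReal.ofReal_le_ofReal (le_of_eq ?_)
  have e : a ^ q = a ^ (q - 1 - p + 1) * a ^ p := by rw [← Real.rpow_add ha]; congr 1; ring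
  have h3 : p - q ≠ 0 := by linarith
  have h4 : q - 1 - p + 1 ≠ 0 := by linarith
  rw [e]
  field_simp
  ring

theorem layer_high (hq : 1 < q) {a : ℝ} (ha : 0 ≤ a) :
    ∫⁻ l in Ioi (0 : ℝ), (if l / 2 < a then ENNReal.ofReal (l ^ (q - 2) * a) else 0) ≤
      ENNReal.ofReal (2 ^ (q - 1) * a ^ q / (q - 1)) := by
  classical
  rcases ha.eq_or_lt with rfl | ha
  · simp
  have h1 : ∀ l : ℝ, (l / 2 < a) ↔ l ∈ Iio (2 * a) := fun l => by
    rw [mem_Iio, div_lt_iff₀ two_pos, mul_comm]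
  simp_rw [h1]
  rw [setLIntegral_ite _ measurableSet_Iio, inter_comm, Ioi_inter_Iio]
  simp_rw [ENNReal.ofReal_mul' ha.le]
  rw [lintegral_mul_const' _ _ ENNReal.ofReal_ne_top, lintegral_Ioo_rpow (by linarith)
    (by linarith), ← ENNReal.ofReal_mul' ha.le]
  refine ENNReal.ofReal_le_ofReal (le_of_eq ?_)
  have e : a ^ q = a ^ (q - 1) * a := by
    nth_rewrite 3 [← Real.rpow_one a]
    rw [← Real.rpow_add ha]; congr 1; ring
  rw [e, show q - 2 + 1 = q - 1 by ring, Real.mul_rpow (by norm_num) ha.le]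
  ring

variable {Y Z : Type*} [NormedAddCommGroup Y] [NormedSpace ℝ Y]
  [NormedAddCommGroup Z] [NormedSpace ℝ Z]

/-- The kernel `k` on `{0, …, n-1}` defines an operator bounded by `B` on `ℓ^p`. -/
def KernelBdd (n : ℕ) (k : ℕ → ℕ → Y →L[ℝ] Z) (p B : ℝ) : Prop :=
  ∀ f : ℕ → Y, ∑ i ∈ Finset.range n, ‖∑ m ∈ Finset.range n, k i m (f m)‖ ^ p ≤
    B ^ p * ∑ m ∈ Finset.range n, ‖f m‖ ^ p

/-- Hörmander's condition for a discrete kernel. -/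
def KernelHormander (n : ℕ) (k : ℕ → ℕ → Y →L[ℝ] Z) (B : ℝ) : Prop :=
  ∀ a r m, a + r ≤ n → m ∈ Finset.Ico a (a + r) →
    ∑ i ∈ (Finset.range n).filter (fun i => i + r < a ∨ a + 2 * r ≤ i), ‖k i m - k i a‖ ≤ B

-- For low levels, where the average of `‖f‖` exceeds `l`, no stopping intervals are available. But
-- then the large entries have total mass at least `(l / 2) 2^N`, so the trivial count `2^N` is
-- already of the required size.
open Classical in
theorem cz_distribution_all {N : ℕ} {k : ℕ → ℕ → Y →L[ℝ] Z} {p B l : ℝ} (hp : 1 ≤ p) (hB : 0 ≤ B)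
    (hl : 0 < l) (hbd : KernelBdd (2 ^ N) k p B) (hH : KernelHormander (2 ^ N) k B) (f : ℕ → Y) :
    (((Finset.range (2 ^ N)).filter
      (fun i => 2 * l < ‖∑ m ∈ Finset.range (2 ^ N), k i m (f m)‖)).card : ℝ) ≤
      (B ^ p + 2 * (2 ^ p * B ^ p + 3 + 4 * B)) * (
        l ^ (-p) * (∑ m ∈ Finset.range (2 ^ N), if ‖f m‖ ≤ l then ‖f m‖ ^ p else 0) +
        l⁻¹ * ∑ m ∈ Finset.range (2 ^ N), if l / 2 < ‖f m‖ then ‖f m‖ else 0) := by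
  set T1 := ∑ m ∈ Finset.range (2 ^ N), if ‖f m‖ ≤ l then ‖f m‖ ^ p else 0 with hT1
  set T2 := ∑ m ∈ Finset.range (2 ^ N), if l / 2 < ‖f m‖ then ‖f m‖ else 0 with hT2
  have h1 : 0 ≤ T1 := Finset.sum_nonneg fun m _ => by split_ifs <;> positivity
  have h2 : 0 ≤ T2 := Finset.sum_nonneg fun m _ => by split_ifs <;> positivity
  have h3 : 0 ≤ l ^ (-p) * T1 := mul_nonneg (by positivity) h1
  have h4 : 0 ≤ l⁻¹ * T2 := mul_nonneg (by positivity) h2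
  have hBp : 0 ≤ B ^ p := by positivity
  have h2p : (0 : ℝ) ≤ 2 ^ p * B ^ p := by positivity
  have m1 := mul_nonneg hBp h4
  have m2 := mul_nonneg (by positivity : 0 ≤ 2 ^ p * B ^ p + 3 + 4 * B) h3
  have m3 := mul_nonneg (by positivity : 0 ≤ 2 ^ p * B ^ p + 2 + 4 * B) h4
  have m4 := mul_nonneg hBp h3
  rcases le_or_gt (∑ m ∈ Finset.range (2 ^ N), ‖f m‖) (l * 2 ^ N) with h | h
  · refine (cz_distribution hp hB hl hbd hH f h).trans ?_
    rw [← hT1, ← hT2, show 2 / l = 2 * l⁻¹ from div_eq_mul_inv _ _]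
    nlinarith
  · have h5 : (((Finset.range (2 ^ N)).filter
      (fun i => 2 * l < ‖∑ m ∈ Finset.range (2 ^ N), k i m (f m)‖)).card : ℝ) ≤ 2 ^ N := by
      have := Finset.card_filter_le (Finset.range (2 ^ N))
        (fun i => 2 * l < ‖∑ m ∈ Finset.range (2 ^ N), k i m (f m)‖)
      rw [Finset.card_range] at this
      exact_mod_cast this
    have h6 : ∑ m ∈ Finset.range (2 ^ N), ‖f m‖ ≤ T2 + l / 2 * 2 ^ N := by
      have : (l / 2 * 2 ^ N : ℝ) = ∑ m ∈ Finset.range (2 ^ N), l / 2 := by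
        rw [Finset.sum_const, Finset.card_range, nsmul_eq_mul]; push_cast; ring
      rw [this, hT2, ← Finset.sum_add_distrib]
      refine Finset.sum_le_sum fun m _ => ?_
      split_ifs with h
      · linarith
      · linarith [not_lt.1 h]
    have h7 : (2 : ℝ) ^ N ≤ 2 * (l⁻¹ * T2) := by
      rw [← mul_assoc, mul_comm 2 l⁻¹, mul_assoc, ← div_eq_inv_mul, le_div_iff₀ hl]
      linarith
    nlinarith

/-- Calderon–Zygmund extrapolation to smaller exponents for discrete kernels. -/
theorem kernel_extrapolate_down (hq : 1 < q) (hqp : q < p) {B : ℝ} (hB : 0 ≤ B) :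
    ∃ C, 0 ≤ C ∧ ∀ (N : ℕ) (k : ℕ → ℕ → Y →L[ℝ] Z), KernelBdd (2 ^ N) k p B →
      KernelHormander (2 ^ N) k B → KernelBdd (2 ^ N) k q C := by
  classical
  set C₁ := B ^ p + 2 * (2 ^ p * B ^ p + 3 + 4 * B) with hC₁
  have hC₁0 : 0 ≤ C₁ := by positivity
  set C₂ := q * 2 ^ q * C₁ * (1 / (p - q) + 2 ^ (q - 1) / (q - 1)) with hC₂
  have hpq : 0 < p - q := by linarith
  have hq1 : 0 < q - 1 := by linarith
  have hC₂0 : 0 ≤ C₂ := by positivity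
  refine ⟨C₂ ^ (1 / q), by positivity, fun N k hbd hH f => ?_⟩
  rw [← Real.rpow_mul hC₂0, one_div_mul_cancel (by linarith), Real.rpow_one]
  set n := 2 ^ N with hn
  set G : ℕ → ℝ := fun i => ‖∑ m ∈ Finset.range n, k i m (f m)‖ with hG
  -- The distributional estimate multiplied by `l^(q-1)`; integrating over all levels turns the left
  -- side into a multiple of the `q`-th power sum (layer-cake formula) and the right side into that
  -- of `f`.
  have hpt : ∀ l ∈ Ioi (0 : ℝ), (∑ i ∈ Finset.range n,
      if 2 * l < G i then ENNReal.ofReal (l ^ (q - 1)) else 0) ≤ ENNReal.ofReal C₁ *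
      ((∑ m ∈ Finset.range n, if ‖f m‖ ≤ l then
        ENNReal.ofReal (l ^ (q - 1 - p) * ‖f m‖ ^ p) else 0) +
      ∑ m ∈ Finset.range n, if l / 2 < ‖f m‖ then ENNReal.ofReal (l ^ (q - 2) * ‖f m‖) else 0) := by
    intro l hl
    rw [mem_Ioi] at hl
    have h := cz_distribution_all (by linarith : 1 ≤ p) hB hl hbd hH f
    have hl1 : 0 ≤ l ^ (q - 1) := by positivity
    have conv : ∀ (P : ℕ → Prop) [DecidablePred P] (c : ℕ → ℝ), (∀ m, 0 ≤ c m) →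
        (∑ m ∈ Finset.range n, if P m then ENNReal.ofReal (c m) else 0) =
        ENNReal.ofReal (∑ m ∈ Finset.range n, if P m then c m else 0) := by
      intro P _ c hc
      rw [ENNReal.ofReal_sum_of_nonneg fun m _ => by split_ifs <;> simp [hc]]
      refine Finset.sum_congr rfl fun m _ => ?_
      split_ifs <;> simp
    rw [conv _ _ fun _ => hl1, conv _ _ fun _ => by positivity, conv _ _ fun _ => by positivity,
      ← ENNReal.ofReal_add (Finset.sum_nonneg fun m _ => by split_ifs <;> positivity)
        (Finset.sum_nonneg fun m _ => by split_ifs <;> positivity), ← ENNReal.ofReal_mul hC₁0]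
    refine ENNReal.ofReal_le_ofReal ?_
    have e1 : (∑ i ∈ Finset.range n, if 2 * l < G i then l ^ (q - 1) else 0) =
        l ^ (q - 1) * ((Finset.range n).filter (fun i => 2 * l < G i)).card := by
      rw [← Finset.sum_filter, Finset.sum_const, nsmul_eq_mul, mul_comm]
    have e2 : (∑ m ∈ Finset.range n, if ‖f m‖ ≤ l then l ^ (q - 1 - p) * ‖f m‖ ^ p else 0) =
        l ^ (q - 1) * (l ^ (-p) * ∑ m ∈ Finset.range n, if ‖f m‖ ≤ l then ‖f m‖ ^ p else 0) := by
      rw [← mul_assoc, ← Real.rpow_add hl, ← sub_eq_add_neg, Finset.mul_sum]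
      refine Finset.sum_congr rfl fun m _ => ?_
      split_ifs <;> simp
    have e3 : (∑ m ∈ Finset.range n, if l / 2 < ‖f m‖ then l ^ (q - 2) * ‖f m‖ else 0) =
        l ^ (q - 1) * (l⁻¹ * ∑ m ∈ Finset.range n, if l / 2 < ‖f m‖ then ‖f m‖ else 0) := by
      rw [← mul_assoc, ← Real.rpow_neg_one, ← Real.rpow_add hl, Finset.mul_sum]
      refine Finset.sum_congr rfl fun m _ => ?_
      rw [show q - 1 + -1 = q - 2 by ring]
      split_ifs <;> simp
    rw [e1, e2, e3, ← mul_add, mul_left_comm]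
    exact mul_le_mul_of_nonneg_left h hl1
  have hint := setLIntegral_mono' (μ := volume) measurableSet_Ioi hpt
  have meas1 : ∀ (c r : ℝ) (P : ℝ → Prop) [DecidablePred P], MeasurableSet {l | P l} →
      Measurable fun l : ℝ => if P l then ENNReal.ofReal (l ^ r * c) else 0 := by
    intro c r P _ hP
    exact Measurable.ite hP (by fun_prop) measurable_const
  have meas2 : ∀ m, Measurable fun l : ℝ => if ‖f m‖ ≤ l then
      ENNReal.ofReal (l ^ (q - 1 - p) * ‖f m‖ ^ p) else 0 := fun m =>
    meas1 _ _ (fun l => ‖f m‖ ≤ l) measurableSet_Ici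
  have meas3 : ∀ m, Measurable fun l : ℝ => if l / 2 < ‖f m‖ then
      ENNReal.ofReal (l ^ (q - 2) * ‖f m‖) else 0 := fun m =>
    meas1 _ _ (fun l => l / 2 < ‖f m‖) (measurableSet_lt (by fun_prop) measurable_const)
  have meas4 : ∀ i, Measurable fun l : ℝ => if 2 * l < G i then
      ENNReal.ofReal (l ^ (q - 1)) else 0 := fun i =>
    Measurable.ite (measurableSet_lt (by fun_prop) measurable_const) (by fun_prop) measurable_const
  rw [lintegral_finsetSum _ fun i _ => meas4 i, lintegral_const_mul' _ _ ENNReal.ofReal_ne_top,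
    lintegral_add_left (Finset.measurable_sum _ fun m _ => meas2 m),
    lintegral_finsetSum _ fun m _ => meas2 m, lintegral_finsetSum _ fun m _ => meas3 m] at hint
  have hl1 : ∑ i ∈ Finset.range n, ∫⁻ l in Ioi (0 : ℝ),
      (if 2 * l < G i then ENNReal.ofReal (l ^ (q - 1)) else 0) =
      ENNReal.ofReal (∑ i ∈ Finset.range n, (G i / 2) ^ q / q) := by
    rw [ENNReal.ofReal_sum_of_nonneg fun i _ => by positivity]
    exact Finset.sum_congr rfl fun i _ => layer_upper hq (norm_nonneg _)
  have hl2 : ∑ m ∈ Finset.range n, ∫⁻ l in Ioi (0 : ℝ), (if ‖f m‖ ≤ l then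
      ENNReal.ofReal (l ^ (q - 1 - p) * ‖f m‖ ^ p) else 0) ≤
      ENNReal.ofReal (∑ m ∈ Finset.range n, ‖f m‖ ^ q / (p - q)) := by
    rw [ENNReal.ofReal_sum_of_nonneg fun i _ => by positivity]
    exact Finset.sum_le_sum fun m _ => layer_low hqp hq (norm_nonneg _)
  have hl3 : ∑ m ∈ Finset.range n, ∫⁻ l in Ioi (0 : ℝ), (if l / 2 < ‖f m‖ then
      ENNReal.ofReal (l ^ (q - 2) * ‖f m‖) else 0) ≤
      ENNReal.ofReal (∑ m ∈ Finset.range n, 2 ^ (q - 1) * ‖f m‖ ^ q / (q - 1)) := by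
    rw [ENNReal.ofReal_sum_of_nonneg fun i _ => by positivity]
    exact Finset.sum_le_sum fun m _ => layer_high hq (norm_nonneg _)
  rw [hl1] at hint
  have hfin := hint.trans (mul_le_mul_right (add_le_add hl2 hl3) _)
  rw [← ENNReal.ofReal_add (Finset.sum_nonneg fun _ _ => by positivity)
    (Finset.sum_nonneg fun _ _ => by positivity), ← ENNReal.ofReal_mul hC₁0,
    ENNReal.ofReal_le_ofReal_iff (by positivity)] at hfin
  have g1 : ∑ i ∈ Finset.range n, (G i / 2) ^ q / q =
      (q * 2 ^ q)⁻¹ * ∑ i ∈ Finset.range n, G i ^ q := by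
    rw [Finset.mul_sum]
    refine Finset.sum_congr rfl fun i _ => ?_
    rw [Real.div_rpow (norm_nonneg _) (by norm_num)]
    field_simp
    rfl
  have g2 : ∑ m ∈ Finset.range n, ‖f m‖ ^ q / (p - q) +
      ∑ m ∈ Finset.range n, 2 ^ (q - 1) * ‖f m‖ ^ q / (q - 1) =
      (1 / (p - q) + 2 ^ (q - 1) / (q - 1)) * ∑ m ∈ Finset.range n, ‖f m‖ ^ q := by
    rw [add_mul, Finset.mul_sum, Finset.mul_sum]
    congr 1 <;> refine Finset.sum_congr rfl fun i _ => ?_ <;> ring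
  rw [g1, g2, inv_mul_le_iff₀ (by positivity)] at hfin
  refine hfin.trans (le_of_eq ?_)
  rw [hC₂]; ring

end DiscreteInterpolation

/-! ### Duality and extrapolation to all exponents -/

section DiscreteDuality

variable {Y Z : Type*} [NormedAddCommGroup Y] [NormedSpace ℝ Y]
  [NormedAddCommGroup Z] [NormedSpace ℝ Z]

/-- The Banach space adjoint. -/
noncomputable def dualMap (T : Y →L[ℝ] Z) : StrongDual ℝ Z →L[ℝ] StrongDual ℝ Y :=
  (ContinuousLinearMap.compL ℝ Y Z ℝ).flip T

theorem dualMap_apply (T : Y →L[ℝ] Z) (φ : StrongDual ℝ Z) (y : Y) : dualMap T φ y = φ (T y) := rfl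

theorem norm_dualMap_sub_le (S T : Y →L[ℝ] Z) : ‖dualMap S - dualMap T‖ ≤ ‖S - T‖ := by
  refine ContinuousLinearMap.opNorm_le_bound _ (norm_nonneg _) fun φ => ?_
  have : (dualMap S - dualMap T) φ = φ.comp (S - T) := by
    ext y
    simp [dualMap_apply]
  rw [this, mul_comm]
  exact ContinuousLinearMap.opNorm_comp_le _ _

theorem exists_almost_norming (ψ : StrongDual ℝ Y) {c : ℝ} (hc : c < 1) :
    ∃ y : Y, ‖y‖ ≤ 1 ∧ c * ‖ψ‖ ≤ ψ y := by
  rcases eq_or_ne ψ 0 with rfl | h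
  · exact ⟨0, by simp⟩
  · have h1 : c * ‖ψ‖ < ‖ψ‖ := by
      have := norm_pos_iff.2 h
      nlinarith
    obtain ⟨y, hy, hy'⟩ := ψ.exists_lt_apply_of_lt_opNorm h1
    rcases le_total 0 (ψ y) with h2 | h2
    · exact ⟨y, hy.le, by rw [Real.norm_of_nonneg h2] at hy'; exact hy'.le⟩
    · refine ⟨-y, by rw [norm_neg]; exact hy.le, ?_⟩
      rw [Real.norm_of_nonpos h2] at hy'
      rw [map_neg]
      exact hy'.le

theorem le_rpow_of_le_mul {p p' B S F : ℝ} (hpp : p.HolderConjugate p') (hB : 0 ≤ B) (hS : 0 ≤ S)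
    (hF : 0 ≤ F) (h : S ≤ S ^ (1 / p) * (B * F ^ (1 / p'))) : S ≤ B ^ p' * F := by
  rcases hS.eq_or_lt with rfl | hS
  · positivity
  have hp' := hpp.symm.pos
  have h1 : S = S ^ (1 / p) * S ^ (1 / p') := by
    rw [← Real.rpow_add hS, one_div, one_div, hpp.inv_add_inv_eq_one, Real.rpow_one]
  have h2 : S ^ (1 / p') ≤ B * F ^ (1 / p') := by
    nth_rewrite 1 [h1] at h
    exact le_of_mul_le_mul_left h (by positivity)
  have h3 := Real.rpow_le_rpow (by positivity) h2 hp'.le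
  rw [← Real.rpow_mul hS.le, one_div_mul_cancel hp'.ne', Real.rpow_one,
    Real.mul_rpow hB (by positivity), ← Real.rpow_mul hF, one_div_mul_cancel hp'.ne',
    Real.rpow_one] at h3
  exact h3

/-- The transposed sums `ψ m` are tested against `f m = ‖ψ m‖^(p'-1) y m`, where the unit-ball
vector `y m` almost norms `ψ m`. As the norm need not be attained, a factor `c < 1` is kept and sent
to 1; the power `S^(1/p)` is then absorbed by `le_rpow_of_le_mul`. -/
theorem KernelBdd.dual {n : ℕ} {k : ℕ → ℕ → Y →L[ℝ] Z} {p p' B : ℝ} (hpp : p.HolderConjugate p')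
    (hB : 0 ≤ B) (h : KernelBdd n k p B) :
    KernelBdd n (fun m i => dualMap (k i m)) p' B := by
  intro φ
  have hp := hpp.pos
  have hp' := hpp.symm.pos
  set ψ : ℕ → StrongDual ℝ Y := fun m => ∑ i ∈ Finset.range n, dualMap (k i m) (φ i) with hψ
  set S := ∑ m ∈ Finset.range n, ‖ψ m‖ ^ p' with hS
  have hS0 : 0 ≤ S := Finset.sum_nonneg fun _ _ => by positivity
  set Φ := ∑ i ∈ Finset.range n, ‖φ i‖ ^ p' with hΦ
  have hΦ0 : 0 ≤ Φ := Finset.sum_nonneg fun _ _ => by positivity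
  refine le_rpow_of_le_mul hpp hB hS0 hΦ0 ?_
  have key : ∀ c : ℝ, c < 1 → c * S ≤ S ^ (1 / p) * (B * Φ ^ (1 / p')) := by
    intro c hc
    choose y hy1 hy2 using fun m => exists_almost_norming (ψ m) hc
    set f : ℕ → Y := fun m => ‖ψ m‖ ^ (p' - 1) • y m with hf
    have hfn : ∑ m ∈ Finset.range n, ‖f m‖ ^ p ≤ S := by
      refine Finset.sum_le_sum fun m _ => ?_
      have h1 : ‖f m‖ ≤ ‖ψ m‖ ^ (p' - 1) := by
        rw [hf, norm_smul, Real.norm_of_nonneg (by positivity)]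
        exact mul_le_of_le_one_right (by positivity) (hy1 m)
      refine (Real.rpow_le_rpow (norm_nonneg _) h1 hp.le).trans (le_of_eq ?_)
      rw [← Real.rpow_mul (norm_nonneg _)]
      congr 1
      have := hpp.symm.sub_one_mul_conj
      linarith
    have hpair : c * S ≤ ∑ i ∈ Finset.range n, φ i (∑ m ∈ Finset.range n, k i m (f m)) := by
      have e1 : ∑ i ∈ Finset.range n, φ i (∑ m ∈ Finset.range n, k i m (f m)) =
          ∑ m ∈ Finset.range n, ψ m (f m) := by
        simp_rw [map_sum, hψ, sum_apply, dualMap_apply]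
        exact Finset.sum_comm
      rw [e1, hS, Finset.mul_sum]
      refine Finset.sum_le_sum fun m _ => ?_
      rw [hf, map_smul, smul_eq_mul]
      have h1 : ‖ψ m‖ ^ p' = ‖ψ m‖ ^ (p' - 1) * ‖ψ m‖ := by
        rcases (norm_nonneg (ψ m)).eq_or_lt with h0 | h0
        · rw [← h0, Real.zero_rpow hp'.ne', mul_zero]
        · nth_rewrite 3 [← Real.rpow_one ‖ψ m‖]
          rw [← Real.rpow_add h0, sub_add_cancel]
      rw [h1, mul_left_comm]
      exact mul_le_mul_of_nonneg_left (hy2 m) (by positivity)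
    have hholder : ∑ i ∈ Finset.range n, φ i (∑ m ∈ Finset.range n, k i m (f m)) ≤
        Φ ^ (1 / p') * (∑ i ∈ Finset.range n, ‖∑ m ∈ Finset.range n, k i m (f m)‖ ^ p) ^ (1 / p) := by
      have h1 := Real.inner_le_Lp_mul_Lq (Finset.range n) (fun i => ‖φ i‖)
        (fun i => ‖∑ m ∈ Finset.range n, k i m (f m)‖) hpp.symm
      simp only [abs_norm] at h1
      refine le_trans (Finset.sum_le_sum fun i _ => ?_) h1
      exact (le_abs_self _).trans ((φ i).le_opNorm _)
    refine hpair.trans (hholder.trans ?_)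
    have h2 : (∑ i ∈ Finset.range n, ‖∑ m ∈ Finset.range n, k i m (f m)‖ ^ p) ^ (1 / p) ≤
        B * S ^ (1 / p) := by
      have h3 := (h f).trans (mul_le_mul_of_nonneg_left hfn (by positivity : 0 ≤ B ^ p))
      have h4 := Real.rpow_le_rpow (Finset.sum_nonneg fun _ _ => by positivity) h3
        (by positivity : 0 ≤ 1 / p)
      rwa [Real.mul_rpow (by positivity) hS0, ← Real.rpow_mul hB, mul_one_div_cancel hp.ne',
        Real.rpow_one] at h4
    calc _ ≤ Φ ^ (1 / p') * (B * S ^ (1 / p)) := mul_le_mul_of_nonneg_left h2 (by positivity)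
      _ = _ := by ring
  have hlim : Tendsto (fun c : ℝ => c * S) (𝓝[<] 1) (𝓝 (1 * S)) :=
    ((continuous_id.mul continuous_const).tendsto 1).mono_left nhdsWithin_le_nhds
  rw [one_mul] at hlim
  exact le_of_tendsto hlim (by filter_upwards [self_mem_nhdsWithin] with c hc using key c hc)

/-- The bidual kernel restricts to the original one along the isometric embedding into the bidual,
so dualizing once more suffices and no reflexivity is needed. -/
theorem KernelBdd.of_dual {n : ℕ} {k : ℕ → ℕ → Y →L[ℝ] Z} {p p' B : ℝ}
    (hpp : p.HolderConjugate p') (hB : 0 ≤ B)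
    (h : KernelBdd n (fun m i => dualMap (k i m)) p B) : KernelBdd n k p' B := by
  intro f
  have h1 := h.dual hpp hB (fun m => NormedSpace.inclusionInDoubleDualLi ℝ (f m))
  have e : ∀ i, ∑ m ∈ Finset.range n,
      dualMap (dualMap (k i m)) (NormedSpace.inclusionInDoubleDualLi ℝ (f m)) =
      NormedSpace.inclusionInDoubleDualLi ℝ (∑ m ∈ Finset.range n, k i m (f m)) := fun i => by
    ext φ
    rw [sum_apply]
    change _ = φ (∑ m ∈ Finset.range n, k i m (f m))
    rw [map_sum]
    rfl
  simp only [e, LinearIsometry.norm_map] at h1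
  exact h1

/-- `ℓ^p`-boundedness extrapolates to `ℓ^q` if the kernel and its transpose satisfy
Hörmander's condition. -/
theorem kernel_extrapolate {p q B : ℝ} (hp : 1 < p) (hq : 1 < q) (hB : 0 ≤ B) :
    ∃ C, 0 ≤ C ∧ ∀ (N : ℕ) (k : ℕ → ℕ → Y →L[ℝ] Z), KernelBdd (2 ^ N) k p B →
      KernelHormander (2 ^ N) k B → KernelHormander (2 ^ N) (fun m i => k i m) B →
      KernelBdd (2 ^ N) k q C := by
  rcases lt_trichotomy q p with h | rfl | h
  · obtain ⟨C, hC, H⟩ := kernel_extrapolate_down (Y := Y) (Z := Z) hq h hB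
    exact ⟨C, hC, fun N k h1 h2 _ => H N k h1 h2⟩
  · exact ⟨B, hB, fun N k h1 _ _ => h1⟩
  -- For `p < q` the conjugate exponents are in the opposite order, so the adjoint kernel can be
  -- extrapolated downwards; this is where Hörmander's condition for the transpose enters.
  · have hpp := Real.HolderConjugate.conjExponent hp
    have hqq := Real.HolderConjugate.conjExponent hq
    have hlt : q.conjExponent < p.conjExponent := by
      have h1 := hpp.inv_add_inv_eq_one
      have h2 := hqq.inv_add_inv_eq_one
      have h3 : q⁻¹ < p⁻¹ := inv_strictAnti₀ hpp.pos h
      exact (inv_lt_inv₀ hpp.symm.pos hqq.symm.pos).1 (by linarith)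
    obtain ⟨C, hC, H⟩ := kernel_extrapolate_down (Y := StrongDual ℝ Z) (Z := StrongDual ℝ Y)
      hqq.symm.lt hlt hB
    refine ⟨C, hC, fun N k h1 _ h3 => KernelBdd.of_dual hqq.symm hC (H N _ (h1.dual hpp hB) ?_)⟩
    intro a r m har hm
    exact (Finset.sum_le_sum fun i _ => norm_dualMap_sub_le _ _).trans (h3 a r m har hm)

end DiscreteDuality

/-! ### Splitting `L^p` norms and bounding increments of primitives -/

section Norms

variable {E : Type*} [NormedAddCommGroup E] {p : ℝ≥0∞} {a b c d : ℝ} {f : ℝ → E}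

theorem restrict_vol_of_subset (hac : a ≤ c) (hdb : d ≤ b) :
    (vol a b).restrict (Ioo c d) = vol c d := by
  rw [vol, Measure.restrict_restrict measurableSet_Ioo,
    inter_eq_left.2 (Ioo_subset_Ioo hac hdb)]

theorem lpn_indicator (hac : a ≤ c) (hdb : d ≤ b) :
    lpn p a b ((Ioo c d).indicator f) = lpn p c d f := by
  rw [lpn, eLpNorm_indicator_eq_eLpNorm_restrict measurableSet_Ioo, restrict_vol_of_subset hac hdb,
    lpn]

theorem memLp_indicator_Ioo (hac : a ≤ c) (hdb : d ≤ b) (hf : MemLp f p (vol c d)) :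
    MemLp ((Ioo c d).indicator f) p (vol a b) := by
  rw [memLp_indicator_iff_restrict measurableSet_Ioo, restrict_vol_of_subset hac hdb]
  exact hf

theorem lpn_rpow (hp0 : p ≠ 0) (hp : p ≠ ⊤) :
    lpn p a b f ^ p.toReal = (∫⁻ t in Ioo a b, ‖f t‖ₑ ^ p.toReal).toReal := by
  rw [lpn, ENNReal.toReal_rpow, eLpNorm_eq_lintegral_rpow_enorm_toReal hp0 hp,
    ← ENNReal.rpow_mul, one_div, inv_mul_cancel₀ (ENNReal.toReal_pos hp0 hp).ne', ENNReal.rpow_one]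

theorem lintegral_rpow_ne_top (hp0 : p ≠ 0) (hp : p ≠ ⊤) (hf : MemLp f p (vol a b)) :
    ∫⁻ t in Ioo a b, ‖f t‖ₑ ^ p.toReal ≠ ⊤ :=
  (lintegral_rpow_enorm_lt_top_of_eLpNorm_lt_top hp0 hp hf.2).ne

theorem lpn_rpow_add (hp0 : p ≠ 0) (hp : p ≠ ⊤) (hf : MemLp f p (vol a b)) (hac : a ≤ c)
    (hcb : c ≤ b) : lpn p a b f ^ p.toReal = lpn p a c f ^ p.toReal + lpn p c b f ^ p.toReal := by
  rw [lpn_rpow hp0 hp, lpn_rpow hp0 hp, lpn_rpow hp0 hp, ← ENNReal.toReal_add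
    (lintegral_rpow_ne_top hp0 hp (memLp_subinterval hf le_rfl hcb))
    (lintegral_rpow_ne_top hp0 hp (memLp_subinterval hf hac le_rfl))]
  congr 1
  rw [setLIntegral_congr Ioo_ae_eq_Ioc, setLIntegral_congr (Ioo_ae_eq_Ioc (a := a) (b := c)),
    setLIntegral_congr (Ioo_ae_eq_Ioc (a := c) (b := b)), ← lintegral_union measurableSet_Ioc,
    Ioc_union_Ioc_eq_Ioc hac hcb]
  rw [Set.disjoint_left]
  exact fun t h1 h2 => absurd h2.1 (not_lt.2 h1.2)

theorem lpn_rpow_sum (hp0 : p ≠ 0) (hp : p ≠ ⊤) {h : ℝ} (hh : 0 ≤ h) (n : ℕ)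
    (hf : MemLp f p (vol 0 (n * h))) :
    lpn p 0 (n * h) f ^ p.toReal =
      ∑ k ∈ Finset.range n, lpn p (k * h) ((k + 1 : ℕ) * h) f ^ p.toReal := by
  induction n with
  | zero =>
    have := ENNReal.toReal_pos hp0 hp
    simp [lpn, vol, this.ne']
  | succ n ih =>
    have h1 : (n : ℝ) * h ≤ (n + 1 : ℕ) * h := by
      push_cast; nlinarith
    rw [Finset.sum_range_succ, ← ih (memLp_subinterval hf le_rfl h1)]
    exact lpn_rpow_add hp0 hp hf (by positivity) h1

/-- Translation differences of a primitive are controlled by the derivative. -/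
theorem lpn_window_le [NormedSpace ℝ E] (hp1 : 1 ≤ p) (hp : p ≠ ⊤) {h : ℝ} (hh : 0 < h)
    (hf : MemLp f p (vol a b)) :
    lpn p a (b - h) (fun t => ∫ s in t..t + h, f s) ≤ h * lpn p a b f := by
  have hp0 : p ≠ 0 := (zero_lt_one.trans_le hp1).ne'
  have hr : 0 < p.toReal := ENNReal.toReal_pos hp0 hp
  set r := p.toReal with hrdef
  obtain ⟨g, hg, hfg⟩ := hf.1
  set G : ℝ → ℝ≥0∞ := (Ioo a b).indicator (fun s => ‖g s‖ₑ ^ r) with hG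
  have hGm : Measurable G := (hg.enorm.pow_const r).indicator measurableSet_Ioo
  have hGint : ∫⁻ s, G s = ∫⁻ s in Ioo a b, ‖f s‖ₑ ^ r := by
    rw [hG, lintegral_indicator measurableSet_Ioo]
    refine lintegral_congr_ae ?_
    filter_upwards [hfg] with s hs
    rw [hs]
  -- Hölder's inequality on the window `(t, t + h)` costs `h^(r-1)`; integrating the window over `t`
  -- by Fubini gives another `h`, in total `h^r`.
  have hpt : ∀ t ∈ Ioo a (b - h), ‖∫ s in t..t + h, f s‖ₑ ^ r ≤
      ENNReal.ofReal (h ^ (r - 1)) * ∫⁻ s in Ioo t (t + h), G s := by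
    intro t ht
    have hsub : MemLp f p (vol t (t + h)) := memLp_subinterval hf ht.1.le (by linarith [ht.2])
    have h1 := norm_volt_le hp1 hsub (t := t + h) ⟨by linarith, le_rfl⟩
    have h2 := Real.rpow_le_rpow (norm_nonneg _) h1 hr.le
    rw [add_sub_cancel_left, Real.mul_rpow (by positivity) (lpn_nonneg p t (t + h) f), lpn_rpow hp0 hp,
      ← Real.rpow_mul hh.le] at h2
    have e : (1 - 1 / p.toReal) * r = r - 1 := by rw [← hrdef]; field_simp
    have e2 : ∫⁻ s in Ioo t (t + h), ‖f s‖ₑ ^ r = ∫⁻ s in Ioo t (t + h), G s := by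
      refine lintegral_congr_ae ?_
      filter_upwards [ae_vol_mono (c := t) (d := t + h) ht.1.le (by linarith [ht.2]) hfg,
        ae_vol_mem t (t + h)] with s hs hmem
      have hs' : s ∈ Ioo a b := ⟨ht.1.trans hmem.1, by linarith [ht.2, hmem.2]⟩
      simp only [hG, hs]
      exact (indicator_of_mem hs' (fun s => ‖g s‖ₑ ^ r)).symm
    rw [e, ← hrdef, e2] at h2
    have hfin : ∫⁻ s in Ioo t (t + h), G s ≠ ⊤ := by
      rw [← e2]; exact lintegral_rpow_ne_top hp0 hp hsub
    rw [← ofReal_norm, ENNReal.ofReal_rpow_of_nonneg (norm_nonneg _) hr.le,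
      ← ENNReal.ofReal_toReal hfin, ← ENNReal.ofReal_mul (by positivity)]
    exact ENNReal.ofReal_le_ofReal h2
  have hfub : ∫⁻ t in Ioo a (b - h), ∫⁻ s in Ioo t (t + h), G s ≤ ENNReal.ofReal h * ∫⁻ s, G s := by
    calc ∫⁻ t in Ioo a (b - h), ∫⁻ s in Ioo t (t + h), G s
        ≤ ∫⁻ t, ∫⁻ s in Ioo t (t + h), G s := setLIntegral_le_lintegral _ _
      _ = ∫⁻ t, ∫⁻ s, (Ioo 0 h).indicator (fun _ => 1) (s - t) * G s := by
          refine lintegral_congr fun t => ?_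
          rw [← lintegral_indicator measurableSet_Ioo]
          refine lintegral_congr fun s => ?_
          by_cases hs : s ∈ Ioo t (t + h)
          · have hs' : s - t ∈ Ioo 0 h := ⟨by linarith [hs.1], by linarith [hs.2]⟩
            rw [indicator_of_mem hs, indicator_of_mem hs', one_mul]
          · have hs' : s - t ∉ Ioo 0 h := fun h' => hs ⟨by linarith [h'.1], by linarith [h'.2]⟩
            rw [indicator_of_notMem hs, indicator_of_notMem hs', zero_mul]
      _ = ∫⁻ s, ∫⁻ t, (Ioo 0 h).indicator (fun _ => 1) (s - t) * G s := by
          refine lintegral_lintegral_swap (Measurable.aemeasurable ?_)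
          exact ((measurable_const.indicator measurableSet_Ioo).comp
            (measurable_snd.sub measurable_fst)).mul (hGm.comp measurable_snd)
      _ = ∫⁻ s, ENNReal.ofReal h * G s := by
          refine lintegral_congr fun s => ?_
          have hm : Measurable fun t => (Ioo 0 h).indicator (fun _ => (1 : ℝ≥0∞)) (s - t) :=
            (measurable_const.indicator measurableSet_Ioo).comp (measurable_const.sub measurable_id)
          rw [lintegral_mul_const _ hm, lintegral_sub_left_eq_self (fun t => (Ioo 0 h).indicator (fun _ => (1 : ℝ≥0∞)) t) s,
            lintegral_indicator measurableSet_Ioo]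
          simp
      _ = _ := lintegral_const_mul _ hGm
  have hmain : ∫⁻ t in Ioo a (b - h), ‖∫ s in t..t + h, f s‖ₑ ^ r ≤
      ENNReal.ofReal (h ^ r) * ∫⁻ s in Ioo a b, ‖f s‖ₑ ^ r := by
    calc _ ≤ ∫⁻ t in Ioo a (b - h), ENNReal.ofReal (h ^ (r - 1)) * ∫⁻ s in Ioo t (t + h), G s :=
          setLIntegral_mono' measurableSet_Ioo hpt
      _ = ENNReal.ofReal (h ^ (r - 1)) * ∫⁻ t in Ioo a (b - h), ∫⁻ s in Ioo t (t + h), G s :=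
          lintegral_const_mul' _ _ ENNReal.ofReal_ne_top
      _ ≤ ENNReal.ofReal (h ^ (r - 1)) * (ENNReal.ofReal h * ∫⁻ s, G s) := by gcongr
      _ = _ := by
          rw [← mul_assoc, ← ENNReal.ofReal_mul (by positivity), hGint]
          congr 2
          nth_rewrite 2 [← Real.rpow_one h]
          rw [← Real.rpow_add hh, sub_add_cancel]
  have h3 := ENNReal.toReal_mono (ENNReal.mul_ne_top ENNReal.ofReal_ne_top
    (lintegral_rpow_ne_top hp0 hp hf)) hmain
  rw [ENNReal.toReal_mul, ENNReal.toReal_ofReal (by positivity), ← lpn_rpow hp0 hp,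
    ← lpn_rpow hp0 hp, ← Real.mul_rpow hh.le (lpn_nonneg p a b f)] at h3
  exact (Real.rpow_le_rpow_iff (lpn_nonneg p a (b - h) fun t => ∫ s in t..t + h, f s)
    (mul_nonneg hh.le (lpn_nonneg p a b f)) hr).1 h3

end Norms

/-! ### Time-weighted smoothing estimates for a single operator -/

section Autonomous

variable {X : Type*} [NormedAddCommGroup X] [NormedSpace ℝ X]
variable {D : Type*} [NormedAddCommGroup D] [NormedSpace ℝ D]
variable {J A₀ : D →L[ℝ] X} {p : ℝ≥0∞} {c d : ℝ} {f g y z : ℝ → X} {v w : ℝ → D}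

/-- `y` is the trajectory of a (not necessarily zero at `c`) solution of `y' + A₀ y = f`. -/
structure Traj (J A₀ : D →L[ℝ] X) (p : ℝ≥0∞) (c d : ℝ) (f y : ℝ → X) (v : ℝ → D) : Prop where
  memLp : MemLp v p (vol c d)
  eq : ∀ t ∈ Icc c d, y t = y c + ∫ s in c..t, (f s - A₀ (v s))
  ae : ∀ᵐ t ∂vol c d, J (v t) = y t

/-- A priori bound with constant `K` for the time derivative on intervals of length at most `L`. -/
def APriori (J A₀ : D →L[ℝ] X) (p : ℝ≥0∞) (L K : ℝ) : Prop :=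
  ∀ c d, c < d → d - c ≤ L → ∀ f v, MemLp f p (vol c d) → Sol J (fun _ => A₀) p c d f 0 v →
    lpn p c d (fun t => f t - A₀ (v t)) ≤ K * lpn p c d f

/-- One constant serves all intervals of length at most `L`: translate to the origin, extend `f` by
zero to `(0, L)`, and restrict the solution again. Causality ensures that the restriction is the
original solution. -/
theorem exists_bound_uniform [CompleteSpace X] [CompleteSpace D] (hp : 1 ≤ p) {L : ℝ} (hL : 0 < L)
    (h : ∀ a b, a < b → US J (fun _ => A₀) p a b) :
    ∃ C, 0 ≤ C ∧ ∀ c d, c < d → d - c ≤ L → ∀ f v, MemLp f p (vol c d) →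
      Sol J (fun _ => A₀) p c d f 0 v → lpn p c d v ≤ C * lpn p c d f := by
  obtain ⟨C, hC0, hC⟩ := (h 0 L hL).exists_bound hp hL (FamBdd.const A₀ 0 L) (norm_nonneg _)
  refine ⟨C, hC0, fun c d hcd hL' f v hf hv => ?_⟩
  have hdc : 0 ≤ d - c := by linarith
  have hf1 : MemLp (fun t => f (t - -c)) p (vol 0 (d - c)) := by
    have := memLp_translate hf (-c)
    rwa [add_neg_cancel, ← sub_eq_add_neg] at this
  set f2 := (Ioo 0 (d - c)).indicator (fun t => f (t - -c)) with hf2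
  have hf2m : MemLp f2 p (vol 0 L) := memLp_indicator_Ioo le_rfl hL' hf1
  obtain ⟨w, hw⟩ := (h 0 L hL).1 f2 hf2m
  have h1 := hC f2 w hf2m hw
  have h2 : lpn p 0 L f2 = lpn p c d f := by
    rw [hf2, lpn_indicator le_rfl hL']
    have := lpn_translate hf (-c)
    rwa [add_neg_cancel, ← sub_eq_add_neg] at this
  have h3 : Sol J (fun _ => A₀) p 0 (d - c) (fun t => f (t - -c)) 0 w := by
    refine (hw.restrict_right hL').congr ?_ (ae_eq_refl _)
    filter_upwards [ae_vol_mem 0 (d - c)] with t ht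
    rw [hf2, indicator_of_mem ht]
  have h4 := h3.translate c
  simp only [zero_add, sub_add_cancel, sub_neg_eq_add] at h4
  have h5 := lpn_translate h3.memLp c
  rw [zero_add, sub_add_cancel] at h5
  have h6 := (h c d hcd).unique hp (FamBdd.const A₀ c d) hf hv h4
  rw [lpn_congr h6, h5, ← h2]
  exact (lpn_subinterval hw.memLp le_rfl hL').trans h1

theorem exists_aPriori [CompleteSpace X] [CompleteSpace D] (hp : 1 ≤ p) {L : ℝ} (hL : 0 < L)
    (h : ∀ a b, a < b → US J (fun _ => A₀) p a b) : ∃ K, 0 ≤ K ∧ APriori J A₀ p L K := by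
  obtain ⟨C, hC0, hC⟩ := exists_bound_uniform hp hL h
  refine ⟨1 + ‖A₀‖ * C, by positivity, fun c d hcd hL' f v hf hv => ?_⟩
  have h1 := lpn_sub_le hp hf ((FamBdd.const A₀ c d).memLp hv.memLp)
  have h2 := lpn_le_mul (norm_nonneg A₀) hv.memLp ((FamBdd.const A₀ c d).ae_le v)
  have h3 := mul_le_mul_of_nonneg_left (hC c d hcd hL' f v hf hv) (norm_nonneg A₀)
  linarith

theorem Traj.memLp_deriv (h : Traj J A₀ p c d f y v) (hf : MemLp f p (vol c d)) :
    MemLp (fun s => f s - A₀ (v s)) p (vol c d) :=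
  hf.sub ((FamBdd.const A₀ c d).memLp h.memLp)

theorem Traj.continuousOn (h : Traj J A₀ p c d f y v) (hp : 1 ≤ p) (hf : MemLp f p (vol c d)) :
    ContinuousOn y (Icc c d) :=
  (continuousOn_const.add (continuousOn_volt hp (h.memLp_deriv hf))).congr h.eq

theorem Traj.sol (h : Traj J A₀ p c d f y v) : Sol J (fun _ => A₀) p c d f (y c) v := by
  refine ⟨h.memLp, ?_⟩
  filter_upwards [h.ae, ae_vol_mem c d] with t ht hmem
  rw [ht, h.eq t (Ioo_subset_Icc_self hmem)]

theorem Sol.traj {x : X} (h : Sol J (fun _ => A₀) p c d f x v) :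
    Traj J A₀ p c d f (fun t => x + ∫ s in c..t, (f s - A₀ (v s))) v :=
  ⟨h.memLp, fun t _ => by simp, h.eq⟩

theorem Traj.eq_sub (h : Traj J A₀ p c d f y v) (hp : 1 ≤ p) (hf : MemLp f p (vol c d)) {s t : ℝ}
    (hs : s ∈ Icc c d) (ht : t ∈ Icc c d) : y t - y s = ∫ r in s..t, (f r - A₀ (v r)) := by
  have hcd : c ≤ d := hs.1.trans hs.2
  rw [h.eq t ht, h.eq s hs, add_sub_add_left_eq_sub,
    intervalIntegral.integral_interval_sub_left]
  · exact intervalIntegrable_of_memLp hp (h.memLp_deriv hf) ⟨le_rfl, hcd⟩ ht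
  · exact intervalIntegrable_of_memLp hp (h.memLp_deriv hf) ⟨le_rfl, hcd⟩ hs

theorem Traj.restrict {c' d' : ℝ} (h : Traj J A₀ p c d f y v) (hp : 1 ≤ p)
    (hf : MemLp f p (vol c d)) (hc : c ≤ c') (hcd : c' ≤ d) (hd : d' ≤ d) :
    Traj J A₀ p c' d' f y v := by
  refine ⟨memLp_subinterval h.memLp hc hd, fun t ht => ?_, ae_vol_mono hc hd h.ae⟩
  rw [← h.eq_sub hp hf (s := c') (t := t) ⟨hc, hcd⟩ ⟨hc.trans ht.1, ht.2.trans hd⟩,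
    add_sub_cancel]

theorem Traj.shift (h : Traj J A₀ p c d f y v) (r : ℝ) :
    Traj J A₀ p (c - r) (d - r) (fun t => f (t + r)) (fun t => y (t + r)) (fun t => v (t + r)) := by
  have hmp := measurePreserving_vol_sub c d (-r)
  simp only [← sub_eq_add_neg, sub_neg_eq_add] at hmp
  refine ⟨h.memLp.comp_measurePreserving hmp, fun t ht => ?_,
    hmp.quasiMeasurePreserving.ae h.ae⟩
  rw [h.eq (t + r) ⟨by linarith [ht.1], by linarith [ht.2]⟩, sub_add_cancel,
    intervalIntegral.integral_comp_add_right (fun s => f s - A₀ (v s)), sub_add_cancel]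

theorem Traj.sub (h : Traj J A₀ p c d f y v) (h' : Traj J A₀ p c d g z w) (hp : 1 ≤ p)
    (hf : MemLp f p (vol c d)) (hg : MemLp g p (vol c d)) :
    Traj J A₀ p c d (fun t => f t - g t) (fun t => y t - z t) (fun t => v t - w t) := by
  refine ⟨h.memLp.sub h'.memLp, fun t ht => ?_, ?_⟩
  · have hcd : c ≤ d := ht.1.trans ht.2
    rw [h.eq t ht, h'.eq t ht, add_sub_add_comm, ← intervalIntegral.integral_sub]
    · congr 1
      refine intervalIntegral.integral_congr fun s _ => ?_
      simp only [map_sub]; abel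
    · exact intervalIntegrable_of_memLp hp (h.memLp_deriv hf) ⟨le_rfl, hcd⟩ ht
    · exact intervalIntegrable_of_memLp hp (h'.memLp_deriv hg) ⟨le_rfl, hcd⟩ ht
  · filter_upwards [h.ae, h'.ae] with t h1 h2
    rw [map_sub, h1, h2]

theorem Traj.diff {x : X} (h : Traj J A₀ p c d (fun _ => x) y v) (hp : 1 ≤ p) {r : ℝ} (hr : 0 ≤ r)
    (hrd : c ≤ d - r) :
    Traj J A₀ p c (d - r) (fun _ => 0) (fun t => y (t + r) - y t) (fun t => v (t + r) - v t) := by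
  have hx : ∀ a b : ℝ, MemLp (fun _ : ℝ => x) p (vol a b) := fun a b => memLp_const x
  have h1 := (h.shift r).restrict hp (hx _ _) (c' := c) (d' := d - r) (by linarith) hrd le_rfl
  have h2 := h.restrict hp (hx _ _) (c' := c) (d' := d - r) le_rfl (by linarith) (by linarith)
  simpa using h1.sub h2 hp (hx _ _) (hx _ _)

theorem Traj.memLp_traj (h : Traj J A₀ p c d f y v) (hp : 1 ≤ p) (hf : MemLp f p (vol c d)) :
    MemLp y p (vol c d) := memLp_of_continuousOn (h.continuousOn hp hf)

variable [CompleteSpace X]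

/-- Multiplying a homogeneous solution by `t - c`. -/
theorem Traj.mul_time (h : Traj J A₀ p c d (fun _ => 0) y v) (hp : 1 ≤ p) :
    Sol J (fun _ => A₀) p c d y 0 (fun t => (t - c) • v t) := by
  have h0 : MemLp (fun _ : ℝ => (0 : X)) p (vol c d) := MemLp.zero
  have hg := h.memLp_deriv h0
  refine ⟨?_, ?_⟩
  · refine h.memLp.of_le_mul (c := d - c) ((by fun_prop : Continuous fun t : ℝ =>
      t - c).aestronglyMeasurable.smul h.memLp.1) ?_
    filter_upwards [ae_vol_mem c d] with t ht
    rw [norm_smul, Real.norm_of_nonneg (by linarith [ht.1])]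
    gcongr
    exact ht.2.le
  · filter_upwards [h.ae, ae_vol_mem c d] with t ht hmem
    have hmem' := Ioo_subset_Icc_self hmem
    have hcd : c ≤ d := (hmem.1.trans hmem.2).le
    -- Product rule: the derivative of `(t - c) y` is `y + (t - c) y'`, and the homogeneous equation
    -- turns the second term into `-A₀ ((t - c) v)`.
    have key := smul_volt hp hg (φ := fun s => s - c) (by fun_prop) hmem'
    have hder : deriv (fun s : ℝ => s - c) = fun _ => 1 := by
      ext s; simp
    rw [map_smul, ht, h.eq t hmem', smul_add, key, zero_add, hder]
    have e : (t - c) • y c = ∫ s in c..t, y c := by simp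
    rw [e, ← intervalIntegral.integral_add]
    · refine intervalIntegral.integral_congr fun s hs => ?_
      rw [uIcc_of_le hmem.1.le] at hs
      simp only [map_smul]
      rw [h.eq s ⟨hs.1, hs.2.trans hmem.2.le⟩]
      simp only [one_smul, zero_sub, smul_neg]
      abel
    · simp
    · have hi := intervalIntegrable_of_memLp hp hg (s := c) (t := t) ⟨le_rfl, hcd⟩ hmem'
      have hc := continuousOn_volt hp (memLp_subinterval hg le_rfl hmem.2.le)
      rw [← uIcc_of_le hmem.1.le] at hc
      refine (hi.continuousOn_smul (by fun_prop)).add ?_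
      exact (continuousOn_const.smul hc).intervalIntegrable

/-- Pointwise bound for homogeneous solutions. -/
theorem Traj.norm_end_le {L K : ℝ} (hK : APriori J A₀ p L K)
    (h : Traj J A₀ p c d (fun _ => 0) y v) (hp : 1 ≤ p) (hcd : c < d) (hL : d - c ≤ L) :
    ‖y d‖ ≤ (d - c) ^ (-(1 / p.toReal)) * (K * lpn p c d y) := by
  have hs := h.mul_time hp
  have hy := h.memLp_traj hp MemLp.zero
  have hr : MemLp (fun t => y t - A₀ ((t - c) • v t)) p (vol c d) :=
    hs.memLp_rhs (FamBdd.const A₀ c d) hy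
  have h1 := hK c d hcd hL y _ hy hs
  have h2 := norm_volt_le hp hr (t := d) ⟨hcd.le, le_rfl⟩
  have hc := h.continuousOn hp MemLp.zero
  have h3 : EqOn (fun t => (t - c) • y t) (fun t => ∫ s in c..t, (y s - A₀ ((s - c) • v s)))
      (Icc c d) := by
    refine eqOn_of_ae_eq hcd (by fun_prop) (continuousOn_volt hp hr) ?_
    filter_upwards [hs.eq, h.ae] with t e1 e2
    rw [map_smul, e2, zero_add] at e1
    exact e1
  have h4 := h3 (show d ∈ Icc c d from ⟨hcd.le, le_rfl⟩)
  simp only at h4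
  have hpos : 0 < d - c := by linarith
  -- The primitive of the derivative of `(t - c) y` gains `(d - c)^(1 - 1/p)` by Hölder; division by
  -- `d - c` leaves the exponent `-1/p`.
  rw [← h4, norm_smul, Real.norm_of_nonneg hpos.le, sub_eq_add_neg 1, Real.rpow_add hpos,
    Real.rpow_one, mul_assoc] at h2
  refine (le_of_mul_le_mul_left h2 hpos).trans ?_
  gcongr

/-- Smoothing of homogeneous solutions, in terms of differences. -/
theorem Traj.lpn_diff_le {L K : ℝ} (hK : APriori J A₀ p L K)
    (h : Traj J A₀ p c d (fun _ => 0) y v) (hp : 1 ≤ p) (hp' : p ≠ ⊤) (hcd : c < d)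
    (hL : d - c ≤ L) {r m : ℝ} (hr : 0 < r) (hcm : c < m) :
    lpn p m (d - r) (fun t => y (t + r) - y t) ≤ r / (m - c) * ((K + 1) * lpn p c d y) := by
  have hs := h.mul_time hp
  have hy := h.memLp_traj hp MemLp.zero
  have hrm : MemLp (fun t => y t - A₀ ((t - c) • v t)) p (vol c d) :=
    hs.memLp_rhs (FamBdd.const A₀ c d) hy
  have h1 := hK c d hcd hL y _ hy hs
  have h0 : MemLp (fun _ : ℝ => (0 : X)) p (vol c d) := MemLp.zero
  have hg := h.memLp_deriv h0
  have hgm := memLp_subinterval hg hcm.le le_rfl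
  have h2 := lpn_window_le hp hp' hr hgm
  have h3 : lpn p m (d - r) (fun t => y (t + r) - y t) =
      lpn p m (d - r) (fun t => ∫ s in t..t + r, ((0 : X) - A₀ (v s))) := by
    refine lpn_congr ?_
    filter_upwards [ae_vol_mem m (d - r)] with t ht
    exact h.eq_sub hp h0 (s := t) (t := t + r) ⟨by linarith [ht.1], by linarith [ht.2]⟩
      ⟨by linarith [ht.1], by linarith [ht.2]⟩
  have hmc : 0 < m - c := by linarith
  have hsubm : MemLp (fun t => (y t - A₀ ((t - c) • v t)) - y t) p (vol c d) := hrm.sub hy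
  -- With `z = (t - c) y` one has `(t - c) y' = z' - y`, and `t - c ≥ m - c` on `(m, d)`. The a
  -- priori bound for `z'` together with the term `y` produces `K + 1`.
  have h4 : lpn p m d (fun s => (0 : X) - A₀ (v s)) ≤
      (1 / (m - c)) * lpn p m d (fun t => (y t - A₀ ((t - c) • v t)) - y t) := by
    refine lpn_le_mul (by positivity) (memLp_subinterval hsubm hcm.le le_rfl) ?_
    filter_upwards [ae_vol_mem m d] with t ht
    have htc : 0 < t - c := by linarith [ht.1]
    rw [zero_sub, norm_neg, map_smul, sub_sub_cancel_left, norm_neg, norm_smul,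
      Real.norm_of_nonneg htc.le, ← mul_assoc]
    refine le_mul_of_one_le_left (norm_nonneg _) ?_
    rw [one_div, ← div_eq_inv_mul, one_le_div hmc]
    linarith [ht.1]
  have h5 := lpn_subinterval hsubm hcm.le (le_refl d)
  have h6 := lpn_sub_le hp hrm hy
  have h7 : lpn p m d (fun s => (0 : X) - A₀ (v s)) ≤ (1 / (m - c)) * ((K + 1) * lpn p c d y) :=
    h4.trans (mul_le_mul_of_nonneg_left (by linarith) (by positivity))
  rw [h3]
  refine h2.trans ((mul_le_mul_of_nonneg_left h7 hr.le).trans (le_of_eq ?_))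
  ring

end Autonomous

/-! ### Decay of third differences and Hörmander's condition for Toeplitz kernels -/

section Kernel

variable {X : Type*} [NormedAddCommGroup X] [NormedSpace ℝ X] [CompleteSpace X]
variable {D : Type*} [NormedAddCommGroup D] [NormedSpace ℝ D]
variable {J A₀ : D →L[ℝ] X} {p : ℝ≥0∞} {L K b : ℝ} {y : ℝ → X} {v : ℝ → D} {x : X}

/-- Decay of third differences of the solution with constant right-hand side. -/
theorem third_diff_le (hK : APriori J A₀ p L K) (hK0 : 0 ≤ K) (hp : 1 ≤ p) (hp' : p ≠ ⊤)
    (h : Traj J A₀ p 0 b (fun _ => x) y v) (hy0 : y 0 = 0) (hb : b ≤ L) {r T : ℝ} (hr : 0 < r)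
    (hrT : r ≤ T) (hT : T + 3 * r ≤ b) :
    ‖((y (T + r + r + r) - y (T + r + r)) - (y (T + r + r) - y (T + r))) -
      ((y (T + r + r) - y (T + r)) - (y (T + r) - y T))‖ ≤
      108 * K ^ 2 * (K + 1) ^ 2 * (r * (r / T) ^ 2) * ‖x‖ := by
  have hT0 : 0 < T := hr.trans_le hrT
  have hx : ∀ a b : ℝ, MemLp (fun _ : ℝ => x) p (vol a b) := fun a b => memLp_const x
  have hz : ∀ a b : ℝ, MemLp (fun _ : ℝ => (0 : X)) p (vol a b) := fun a b => MemLp.zero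
  have h3 : Traj J A₀ p 0 (T + 3 * r) (fun _ => x) y v :=
    h.restrict hp (hx _ _) le_rfl (by linarith) hT
  have hr1 : 1 ≤ p.toReal := by simpa using ENNReal.toReal_mono hp' hp
  -- The first difference solves the homogeneous equation and has norm of order `r` by the a priori
  -- bound. Each further difference gives up a third of `(0, T)` on the left and gains `(K + 1) r /
  -- (T / 3)`; the last third turns the `L^p` bound into a pointwise one.
  have t1 : Traj J A₀ p 0 (T + 2 * r) (fun _ => 0) (fun t => y (t + r) - y t)
      (fun t => v (t + r) - v t) := by
    have := h3.diff hp hr.le (by linarith)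
    rwa [show T + 3 * r - r = T + 2 * r by ring] at this
  have n1 : lpn p 0 (T + 2 * r) (fun t => y (t + r) - y t) ≤
      r * (K * (‖x‖ * (4 * T) ^ (1 / p.toReal))) := by
    have e1 : lpn p 0 (T + 2 * r) (fun t => y (t + r) - y t) =
        lpn p 0 (T + 3 * r - r) (fun t => ∫ s in t..t + r, (x - A₀ (v s))) := by
      rw [show T + 3 * r - r = T + 2 * r by ring]
      refine lpn_congr ?_
      filter_upwards [ae_vol_mem 0 (T + 2 * r)] with t ht
      exact h3.eq_sub hp (hx _ _) (s := t) (t := t + r) ⟨ht.1.le, by linarith [ht.2]⟩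
        ⟨by linarith [ht.1], by linarith [ht.2]⟩
    rw [e1]
    refine (lpn_window_le hp hp' hr (h3.memLp_deriv (hx _ _))).trans ?_
    refine mul_le_mul_of_nonneg_left ?_ hr.le
    have hs := h3.sol
    rw [hy0] at hs
    refine (hK 0 (T + 3 * r) (by linarith) (by linarith) _ v (hx _ _) hs).trans ?_
    refine mul_le_mul_of_nonneg_left ?_ hK0
    refine (lpn_le_of_bound (by linarith) (norm_nonneg x) fun t _ => le_rfl).trans ?_
    have : (T + 3 * r - 0) ^ (1 / p.toReal) ≤ (4 * T) ^ (1 / p.toReal) :=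
      Real.rpow_le_rpow (by linarith) (by linarith) (by positivity)
    gcongr
  have t2 : Traj J A₀ p (T / 3) (T + r) (fun _ => 0)
      (fun t => (y (t + r + r) - y (t + r)) - (y (t + r) - y t))
      (fun t => (v (t + r + r) - v (t + r)) - (v (t + r) - v t)) := by
    have := t1.diff hp hr.le (by linarith)
    rw [show T + 2 * r - r = T + r by ring] at this
    exact this.restrict hp (hz _ _) (by linarith) (by linarith) le_rfl
  have n2 : lpn p (T / 3) (T + r) (fun t => (y (t + r + r) - y (t + r)) - (y (t + r) - y t)) ≤
      r / (T / 3) * ((K + 1) * (r * (K * (‖x‖ * (4 * T) ^ (1 / p.toReal))))) := by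
    have := t1.lpn_diff_le hK hp hp' (by linarith) (by linarith) hr (m := T / 3) (by linarith)
    rw [show T + 2 * r - r = T + r by ring, sub_zero] at this
    refine this.trans ?_
    gcongr
  have t3 : Traj J A₀ p (2 * T / 3) T (fun _ => 0)
      (fun t => ((y (t + r + r + r) - y (t + r + r)) - (y (t + r + r) - y (t + r))) -
        ((y (t + r + r) - y (t + r)) - (y (t + r) - y t)))
      (fun t => ((v (t + r + r + r) - v (t + r + r)) - (v (t + r + r) - v (t + r))) -
        ((v (t + r + r) - v (t + r)) - (v (t + r) - v t))) := by
    have := t2.diff hp hr.le (by linarith)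
    rw [show T + r - r = T by ring] at this
    exact this.restrict hp (hz _ _) (by linarith) (by linarith) le_rfl
  have n3 : lpn p (2 * T / 3) T
      (fun t => ((y (t + r + r + r) - y (t + r + r)) - (y (t + r + r) - y (t + r))) -
        ((y (t + r + r) - y (t + r)) - (y (t + r) - y t))) ≤ r / (T / 3) * ((K + 1) *
      (r / (T / 3) * ((K + 1) * (r * (K * (‖x‖ * (4 * T) ^ (1 / p.toReal))))))) := by
    have := t2.lpn_diff_le hK hp hp' (by linarith) (by linarith) hr (m := 2 * T / 3) (by linarith)
    rw [show T + r - r = T by ring, show 2 * T / 3 - T / 3 = T / 3 by ring] at this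
    refine this.trans ?_
    gcongr
  have fin := t3.norm_end_le hK hp (by linarith) (by linarith)
  rw [show T - 2 * T / 3 = T / 3 by ring] at fin
  -- The ratio of `4 T` to `T / 3` is 12 and its exponent `1/p` is at most 1. Together with the 9
  -- from the two factors `T / 3` this gives 108.
  have hq : (T / 3) ^ (-(1 / p.toReal)) * (4 * T) ^ (1 / p.toReal) ≤ 12 := by
    rw [Real.rpow_neg (by positivity), ← div_eq_inv_mul, ← Real.div_rpow (by positivity)
      (by positivity), show 4 * T / (T / 3) = 12 by field_simp; norm_num]
    calc (12 : ℝ) ^ (1 / p.toReal) ≤ 12 ^ (1 : ℝ) :=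
          Real.rpow_le_rpow_of_exponent_le (by norm_num) (by rw [div_le_one (by linarith)]; exact hr1)
      _ = 12 := Real.rpow_one _
  calc _ ≤ (T / 3) ^ (-(1 / p.toReal)) * (K * (r / (T / 3) * ((K + 1) *
      (r / (T / 3) * ((K + 1) * (r * (K * (‖x‖ * (4 * T) ^ (1 / p.toReal))))))))) := by
        refine fin.trans ?_
        gcongr
    _ = ((T / 3) ^ (-(1 / p.toReal)) * (4 * T) ^ (1 / p.toReal)) *
        (9 * K ^ 2 * (K + 1) ^ 2 * (r * (r / T) ^ 2) * ‖x‖) := by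
        field_simp
        ring
    _ ≤ 12 * (9 * K ^ 2 * (K + 1) ^ 2 * (r * (r / T) ^ 2) * ‖x‖) := by gcongr
    _ = _ := by ring

omit [CompleteSpace X] in
theorem sum_inv_sq_le (r : ℕ) (hr : 0 < r) (s : Finset ℕ) (hs : ∀ j ∈ s, r < j) :
    ∑ j ∈ s, ((j : ℝ) ^ 2)⁻¹ ≤ (r : ℝ)⁻¹ := by
  obtain ⟨M, hM⟩ := s.exists_nat_subset_range
  have h1 : ∀ M : ℕ, r < M → ∑ j ∈ Finset.Ico (r + 1) M, ((j : ℝ) ^ 2)⁻¹ ≤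
      (r : ℝ)⁻¹ - ((M : ℝ) - 1)⁻¹ := by
    intro M hM
    induction M, hM using Nat.le_induction with
    | base => simp
    | succ M hM ih =>
      rw [Finset.sum_Ico_succ_top hM]
      have hMr : (1 : ℝ) < M := by exact_mod_cast (by omega : 1 < M)
      have : ((M : ℝ) ^ 2)⁻¹ ≤ ((M : ℝ) - 1)⁻¹ - (M : ℝ)⁻¹ := by
        rw [inv_sub_inv (by linarith) (by linarith), inv_eq_one_div, sub_sub_cancel]
        gcongr
        nlinarith
      push_cast
      rw [add_sub_cancel_right]
      linarith
  have h2 : s ⊆ Finset.Ico (r + 1) (max M (r + 1)) := fun j hj => by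
    have := Finset.mem_range.1 (hM hj)
    rw [Finset.mem_Ico]
    exact ⟨hs j hj, lt_max_of_lt_left this⟩
  refine (Finset.sum_le_sum_of_subset_of_nonneg h2 fun _ _ _ => by positivity).trans
    ((h1 _ (lt_max_of_lt_right (by omega))).trans ?_)
  have : (1 : ℝ) ≤ (max M (r + 1) : ℕ) := by
    exact_mod_cast (le_max_of_le_right (by omega) : 1 ≤ max M (r + 1))
  have h3 : 0 ≤ (((max M (r + 1) : ℕ) : ℝ) - 1)⁻¹ := inv_nonneg.2 (by linarith)
  linarith

omit [CompleteSpace X] in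
theorem norm_sub_le_of_step {n : ℕ} {κ : ℕ → X →L[ℝ] X} {C : ℝ} (hC : 0 ≤ C)
    (hκ : ∀ j, 1 ≤ j → j + 1 < n → ‖κ (j + 1) - κ j‖ ≤ C * ((j : ℝ) ^ 2)⁻¹) {i r : ℕ} (hi : 1 ≤ i)
    (hir : i + r < n) : ‖κ (i + r) - κ i‖ ≤ r * (C * ((i : ℝ) ^ 2)⁻¹) := by
  induction r with
  | zero => simp
  | succ r ih =>
    have h1 := ih (by omega)
    have h2 := hκ (i + r) (by omega) (by omega)
    have h3 : C * (((i + r : ℕ) : ℝ) ^ 2)⁻¹ ≤ C * ((i : ℝ) ^ 2)⁻¹ := by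
      have : (0 : ℝ) < i := by exact_mod_cast hi
      push_cast
      gcongr
      linarith [(Nat.cast_nonneg r : (0 : ℝ) ≤ r)]
    calc ‖κ (i + (r + 1)) - κ i‖ = ‖(κ (i + r + 1) - κ (i + r)) + (κ (i + r) - κ i)‖ := by
          rw [← add_assoc]; congr 1; abel
      _ ≤ _ := norm_add_le _ _
      _ ≤ C * ((i : ℝ) ^ 2)⁻¹ + r * (C * ((i : ℝ) ^ 2)⁻¹) := add_le_add (h2.trans h3) h1
      _ = _ := by push_cast; ring

/-- The lower triangular Toeplitz kernel with symbol `κ`. -/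
noncomputable def toeplitz (κ : ℕ → X →L[ℝ] X) (i m : ℕ) : X →L[ℝ] X :=
  if m ≤ i then κ (i - m) else 0

-- For `i + r < a` both entries vanish by triangularity. For `i ≥ a + 2 r` the two columns are fewer
-- than `r` steps apart, each step costs `C / (i - m)^2`, and `i - m > r`, so that the inverse
-- squares sum to at most `1 / r`.
omit [CompleteSpace X] in
theorem toeplitz_hormander {n : ℕ} {κ : ℕ → X →L[ℝ] X} {C : ℝ} (hC : 0 ≤ C)
    (hκ : ∀ j, 1 ≤ j → j + 1 < n → ‖κ (j + 1) - κ j‖ ≤ C * ((j : ℝ) ^ 2)⁻¹) :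
    KernelHormander n (toeplitz κ) C := by
  intro a r m har hm
  rw [Finset.mem_Ico] at hm
  have hr : 0 < r := by omega
  have hr' : (0 : ℝ) < r := by exact_mod_cast hr
  set S := (Finset.range n).filter (fun i => i + r < a ∨ a + 2 * r ≤ i) with hS
  set S' := (Finset.range n).filter (fun i => a + 2 * r ≤ i) with hS'
  have h1 : ∑ i ∈ S, ‖toeplitz κ i m - toeplitz κ i a‖ ≤
      ∑ i ∈ S', ‖toeplitz κ i m - toeplitz κ i a‖ := by
    refine le_of_eq (Finset.sum_subset_zero_on_sdiff ?_ ?_ fun _ _ => rfl).symm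
    · intro i hi
      simp only [hS, hS', Finset.mem_filter] at hi ⊢
      exact ⟨hi.1, Or.inr hi.2⟩
    · intro i hi
      simp only [hS, hS', Finset.mem_sdiff, Finset.mem_filter, Finset.mem_range] at hi
      have h1 : ¬ m ≤ i := by omega
      have h2 : ¬ a ≤ i := by omega
      simp [toeplitz, h1, h2]
  have h2 : ∀ i ∈ S', ‖toeplitz κ i m - toeplitz κ i a‖ ≤ r * C * (((i - m : ℕ) : ℝ) ^ 2)⁻¹ := by
    intro i hi
    simp only [hS', Finset.mem_filter, Finset.mem_range] at hi
    have e1 : m ≤ i := by omega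
    have e2 : a ≤ i := by omega
    simp only [toeplitz, e1, e2, if_true]
    rw [norm_sub_rev, show i - a = (i - m) + (m - a) by omega]
    refine (norm_sub_le_of_step hC hκ (by omega) (by omega)).trans ?_
    have : ((m - a : ℕ) : ℝ) ≤ r := by exact_mod_cast (by omega : m - a ≤ r)
    rw [mul_assoc]
    gcongr
  have h3 : ∑ i ∈ S', (((i - m : ℕ) : ℝ) ^ 2)⁻¹ ≤ (r : ℝ)⁻¹ := by
    have hinj : Set.InjOn (fun i => i - m) (S' : Set ℕ) := by
      intro i hi j hj hij
      simp only [hS', Finset.coe_filter, Set.mem_ofPred_eq, Finset.mem_range] at hi hj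
      simp only at hij
      omega
    rw [← Finset.sum_image (f := fun j : ℕ => ((j : ℝ) ^ 2)⁻¹) hinj]
    refine sum_inv_sq_le r hr _ fun j hj => ?_
    obtain ⟨i, hi, rfl⟩ := Finset.mem_image.1 hj
    simp only [hS', Finset.mem_filter, Finset.mem_range] at hi
    omega
  refine h1.trans ((Finset.sum_le_sum h2).trans ?_)
  rw [← Finset.mul_sum]
  calc r * C * ∑ i ∈ S', (((i - m : ℕ) : ℝ) ^ 2)⁻¹ ≤ r * C * (r : ℝ)⁻¹ := by gcongr
    _ = C := by field_simp

-- Same count with rows in place of columns: now the entries with `m ≥ a + 2 r` vanish, and those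
-- with `m + r < a` are summed through `a - m > r`.
omit [CompleteSpace X] in
theorem toeplitz_hormander_transpose {n : ℕ} {κ : ℕ → X →L[ℝ] X} {C : ℝ} (hC : 0 ≤ C)
    (hκ : ∀ j, 1 ≤ j → j + 1 < n → ‖κ (j + 1) - κ j‖ ≤ C * ((j : ℝ) ^ 2)⁻¹) :
    KernelHormander n (fun m i => toeplitz κ i m) C := by
  intro a r i har hm
  rw [Finset.mem_Ico] at hm
  have hr : 0 < r := by omega
  have hr' : (0 : ℝ) < r := by exact_mod_cast hr
  set S := (Finset.range n).filter (fun m => m + r < a ∨ a + 2 * r ≤ m) with hS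
  set S' := (Finset.range n).filter (fun m => m + r < a) with hS'
  have h1 : ∑ m ∈ S, ‖toeplitz κ i m - toeplitz κ a m‖ ≤
      ∑ m ∈ S', ‖toeplitz κ i m - toeplitz κ a m‖ := by
    refine le_of_eq (Finset.sum_subset_zero_on_sdiff ?_ ?_ fun _ _ => rfl).symm
    · intro m hi
      simp only [hS, hS', Finset.mem_filter] at hi ⊢
      exact ⟨hi.1, Or.inl hi.2⟩
    · intro m hi
      simp only [hS, hS', Finset.mem_sdiff, Finset.mem_filter, Finset.mem_range] at hi
      have h1 : ¬ m ≤ i := by omega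
      have h2 : ¬ m ≤ a := by omega
      simp [toeplitz, h1, h2]
  have h2 : ∀ m ∈ S', ‖toeplitz κ i m - toeplitz κ a m‖ ≤ r * C * (((a - m : ℕ) : ℝ) ^ 2)⁻¹ := by
    intro m hi
    simp only [hS', Finset.mem_filter, Finset.mem_range] at hi
    have e1 : m ≤ i := by omega
    have e2 : m ≤ a := by omega
    simp only [toeplitz, e1, e2, if_true]
    rw [show i - m = (a - m) + (i - a) by omega]
    refine (norm_sub_le_of_step hC hκ (by omega) (by omega)).trans ?_
    have : ((i - a : ℕ) : ℝ) ≤ r := by exact_mod_cast (by omega : i - a ≤ r)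
    rw [mul_assoc]
    gcongr
  have h3 : ∑ m ∈ S', (((a - m : ℕ) : ℝ) ^ 2)⁻¹ ≤ (r : ℝ)⁻¹ := by
    have hinj : Set.InjOn (fun m => a - m) (S' : Set ℕ) := by
      intro i hi j hj hij
      simp only [hS', Finset.coe_filter, Set.mem_ofPred_eq, Finset.mem_range] at hi hj
      simp only at hij
      omega
    rw [← Finset.sum_image (f := fun j : ℕ => ((j : ℝ) ^ 2)⁻¹) hinj]
    refine sum_inv_sq_le r hr _ fun j hj => ?_
    obtain ⟨m, hi, rfl⟩ := Finset.mem_image.1 hj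
    simp only [hS', Finset.mem_filter, Finset.mem_range] at hi
    omega
  refine h1.trans ((Finset.sum_le_sum h2).trans ?_)
  rw [← Finset.mul_sum]
  calc r * C * ∑ m ∈ S', (((a - m : ℕ) : ℝ) ^ 2)⁻¹ ≤ r * C * (r : ℝ)⁻¹ := by gcongr
    _ = C := by field_simp

end Kernel

/-! ### The Toeplitz kernel of the discretized problem -/

section Discretize

variable {X : Type*} [NormedAddCommGroup X] [NormedSpace ℝ X]
variable {D : Type*} [NormedAddCommGroup D] [NormedSpace ℝ D]
variable {J A₀ : D →L[ℝ] X} {p : ℝ≥0∞} {K b h : ℝ} {y : ℝ → X} {v : ℝ → D} {x : X}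

/-- Step function with values `x i` on the cells `(i h, (i+1) h)`. -/
noncomputable def stepFun {E : Type*} [AddCommMonoid E] (h : ℝ) (n : ℕ) (x : ℕ → E)
    (t : ℝ) : E :=
  ∑ i ∈ Finset.range n, (Ioo (i * h) ((i + 1 : ℕ) * h)).indicator (fun _ => x i) t

theorem stepFun_apply {E : Type*} [NormedAddCommGroup E] (hh : 0 < h) {n : ℕ} (x : ℕ → E) {k : ℕ}
    (hk : k < n) {t : ℝ} (ht : t ∈ Ioo (k * h) ((k + 1 : ℕ) * h)) : stepFun h n x t = x k := by
  rw [stepFun, Finset.sum_eq_single k]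
  · exact indicator_of_mem ht _
  · intro i _ hik
    refine indicator_of_notMem (fun hi => hik ?_) _
    have h1 : (i : ℝ) < (k + 1 : ℕ) := lt_of_mul_lt_mul_right (hi.1.trans ht.2) hh.le
    have h2 : (k : ℝ) < (i + 1 : ℕ) := lt_of_mul_lt_mul_right (ht.1.trans hi.2) hh.le
    have h3 : i < k + 1 := by exact_mod_cast h1
    have h4 : k < i + 1 := by exact_mod_cast h2
    omega
  · intro hk'
    exact absurd (Finset.mem_range.2 hk) hk'

theorem memLp_stepFun {E : Type*} [NormedAddCommGroup E] (n : ℕ) (x : ℕ → E) (a b : ℝ) :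
    MemLp (stepFun h n x) p (vol a b) :=
  memLp_finsetSum _ fun _ _ => (memLp_const _).indicator measurableSet_Ioo

theorem lpn_const {E : Type*} [NormedAddCommGroup E] (hp : p ≠ 0) {a b : ℝ}
    (hab : a < b) (x : E) : lpn p a b (fun _ => x) = ‖x‖ * (b - a) ^ (1 / p.toReal) := by
  have : vol a b ≠ 0 := by
    rw [Ne, Measure.restrict_eq_zero]
    simp [hab]
  rw [lpn, eLpNorm_const _ hp this, ENNReal.toReal_mul, ← ENNReal.toReal_rpow]
  simp [hab.le]

theorem lpn_stepFun_rpow {E : Type*} [NormedAddCommGroup E] (hp : p ≠ 0) (hp' : p ≠ ⊤)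
    (hh : 0 < h) (n : ℕ) (x : ℕ → E) :
    lpn p 0 (n * h) (stepFun h n x) ^ p.toReal =
      h * ∑ k ∈ Finset.range n, ‖x k‖ ^ p.toReal := by
  have hr := ENNReal.toReal_pos hp hp'
  rw [lpn_rpow_sum hp hp' hh.le n (memLp_stepFun n x _ _), Finset.mul_sum]
  refine Finset.sum_congr rfl fun k hk => ?_
  have h1 : stepFun h n x =ᵐ[vol (k * h) ((k + 1 : ℕ) * h)] fun _ => x k := by
    filter_upwards [ae_vol_mem (k * h) ((k + 1 : ℕ) * h)] with t ht
    exact stepFun_apply hh x (Finset.mem_range.1 hk) ht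
  have e : ((k + 1 : ℕ) : ℝ) * h - k * h = h := by push_cast; ring
  rw [lpn_congr h1, lpn_const hp (by rw [← sub_pos, e]; exact hh), e,
    Real.mul_rpow (norm_nonneg _) (by positivity), ← Real.rpow_mul hh.le,
    one_div_mul_cancel hr.ne', Real.rpow_one, mul_comm]

/-- `δ` is the cell average of the time derivative. -/
theorem exists_kernel (hp : 1 ≤ p) (hus : ∀ a b, a < b → US J (fun _ => A₀) p a b)
    (hK0 : 0 ≤ K) {n : ℕ} (hn : 0 < n) (hh : 0 < h) (hK : APriori J A₀ p (n * h) K) :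
    ∃ κ : ℕ → X →L[ℝ] X, (∀ j < n, ‖κ j‖ ≤ K) ∧
      ∀ x v, Sol J (fun _ => A₀) p 0 (n * h) ((Ioo 0 h).indicator fun _ => x) 0 v → ∀ j < n,
        κ j x = h⁻¹ • ∫ s in (j * h)..((j + 1 : ℕ) * h),
          ((Ioo 0 h).indicator (fun _ => x) s - A₀ (v s)) := by
  have hn' : (0 : ℝ) < n := by exact_mod_cast hn
  have hb : 0 < n * h := by positivity
  have hhb : h ≤ n * h := by
    have : (1 : ℝ) ≤ n := by exact_mod_cast hn
    nlinarith
  have hm : ∀ x : X, MemLp ((Ioo 0 h).indicator fun _ => x) p (vol 0 (n * h)) := fun x =>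
    (memLp_const x).indicator measurableSet_Ioo
  have hA := FamBdd.const A₀ 0 (n * h)
  have hcell : ∀ j < n, ((j : ℝ) * h ∈ Icc 0 (n * h)) ∧ ((j + 1 : ℕ) * h ∈ Icc 0 (n * h)) := by
    intro j hj
    have h1 : (j : ℝ) ≤ n := by exact_mod_cast hj.le
    have h2 : ((j + 1 : ℕ) : ℝ) ≤ n := by exact_mod_cast hj
    exact ⟨⟨by positivity, by gcongr⟩, ⟨by positivity, by gcongr⟩⟩
  choose v hv using fun x : X => (hus 0 (n * h) hb).1 _ (hm x)
  have hind : ∀ (x : X) w, Sol J (fun _ => A₀) p 0 (n * h) ((Ioo 0 h).indicator fun _ => x) 0 w →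
      w =ᵐ[vol 0 (n * h)] v x := fun x w hw => (hus 0 (n * h) hb).unique hp hA (hm x) hw (hv x)
  have hint : ∀ x, ∀ j < n, IntervalIntegrable
      (fun s => (Ioo 0 h).indicator (fun _ => x) s - A₀ (v x s)) volume (j * h)
      ((j + 1 : ℕ) * h) := fun x j hj =>
    intervalIntegrable_of_memLp hp ((hv x).memLp_rhs hA (hm x)) (hcell j hj).1 (hcell j hj).2
  have hadd : ∀ x x', (fun s => (Ioo 0 h).indicator (fun _ => x + x') s - A₀ (v (x + x') s))
      =ᵐ[vol 0 (n * h)] fun s => ((Ioo 0 h).indicator (fun _ => x) s - A₀ (v x s)) +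
        ((Ioo 0 h).indicator (fun _ => x') s - A₀ (v x' s)) := fun x x' => by
    have h1 := (hv x).add hp hA (hm x) (hm x') (hv x')
    rw [add_zero] at h1
    have h2 := hind (x + x') _ (h1.congr (Eventually.of_forall fun t => by
      by_cases ht : t ∈ Ioo 0 h <;> simp [ht]) (ae_eq_refl _))
    filter_upwards [h2] with s hs
    rw [← hs, map_add]
    by_cases ht : s ∈ Ioo 0 h <;> simp [ht] <;> abel
  have hsmul : ∀ (c : ℝ) x, (fun s => (Ioo 0 h).indicator (fun _ => c • x) s - A₀ (v (c • x) s))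
      =ᵐ[vol 0 (n * h)] fun s => c • ((Ioo 0 h).indicator (fun _ => x) s - A₀ (v x s)) :=
    fun c x => by
    have h1 := (hv x).smul c
    rw [smul_zero] at h1
    have h2 := hind (c • x) _ (h1.congr (Eventually.of_forall fun t => by
      by_cases ht : t ∈ Ioo 0 h <;> simp [ht]) (ae_eq_refl _))
    filter_upwards [h2] with s hs
    rw [← hs, map_smul, smul_sub]
    by_cases ht : s ∈ Ioo 0 h <;> simp [ht]
  let κ₀ : ℕ → X →ₗ[ℝ] X := fun j =>
    { toFun := fun x => if j < n then h⁻¹ • ∫ s in (j * h)..((j + 1 : ℕ) * h),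
          ((Ioo 0 h).indicator (fun _ => x) s - A₀ (v x s)) else 0
      map_add' := fun x x' => by
        by_cases hj : j < n
        · simp only [if_pos hj]
          rw [volt_congr (hadd x x') (hcell j hj).1 (hcell j hj).2,
            intervalIntegral.integral_add (hint x j hj) (hint x' j hj), smul_add]
        · simp [hj]
      map_smul' := fun c x => by
        by_cases hj : j < n
        · simp only [if_pos hj, RingHom.id_apply]
          rw [volt_congr (hsmul c x) (hcell j hj).1 (hcell j hj).2,
            intervalIntegral.integral_smul, smul_comm]
        · simp [hj] }
  -- Hölder on the cell gives `h^(1-1/p)` and the norm of the pulse gives `h^(1/p)`; their product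
  -- cancels `h⁻¹`, so the bound does not depend on the mesh.
  have hκ₀ : ∀ j x, ‖κ₀ j x‖ ≤ K * ‖x‖ := by
    intro j x
    by_cases hj : j < n
    · have e1 : κ₀ j x = h⁻¹ • ∫ s in (j * h)..((j + 1 : ℕ) * h),
          ((Ioo 0 h).indicator (fun _ => x) s - A₀ (v x s)) := if_pos hj
      rw [e1, norm_smul, norm_inv, Real.norm_of_nonneg hh.le, inv_mul_le_iff₀ hh]
      have hr := (hv x).memLp_rhs hA (hm x)
      have hjle : (j : ℝ) * h ≤ (j + 1 : ℕ) * h := by push_cast; nlinarith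
      have e2 := norm_volt_le hp (memLp_subinterval hr (hcell j hj).1.1 (hcell j hj).2.2)
        (t := (j + 1 : ℕ) * h) ⟨hjle, le_rfl⟩
      have e3 : ((j + 1 : ℕ) : ℝ) * h - j * h = h := by push_cast; ring
      rw [e3] at e2
      have e4 := lpn_subinterval hr (hcell j hj).1.1 (hcell j hj).2.2
      have e5 := hK 0 (n * h) hb (by rw [sub_zero]) _ _ (hm x) (hv x)
      have e6 : lpn p 0 (n * h) ((Ioo 0 h).indicator fun _ => x) ≤ ‖x‖ * h ^ (1 / p.toReal) := by
        rw [lpn_indicator le_rfl hhb]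
        simpa using lpn_le_of_bound (p := p) (b := h) hh.le (norm_nonneg x)
          (f := fun _ => x) fun t _ => le_rfl
      calc _ ≤ h ^ (1 - 1 / p.toReal) * (K * (‖x‖ * h ^ (1 / p.toReal))) := by
            refine e2.trans (mul_le_mul_of_nonneg_left ?_ (by positivity))
            exact e4.trans (e5.trans (mul_le_mul_of_nonneg_left e6 hK0))
        _ = (h ^ (1 - 1 / p.toReal) * h ^ (1 / p.toReal)) * (K * ‖x‖) := by ring
        _ = _ := by rw [← Real.rpow_add hh, sub_add_cancel, Real.rpow_one]
    · have e1 : κ₀ j x = 0 := if_neg hj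
      rw [e1, norm_zero]
      positivity
  refine ⟨fun j => (κ₀ j).mkContinuous K (hκ₀ j), fun j _ =>
    LinearMap.mkContinuous_norm_le _ hK0 _, fun x w hw j hj => ?_⟩
  have e1 : (κ₀ j).mkContinuous K (hκ₀ j) x = h⁻¹ • ∫ s in (j * h)..((j + 1 : ℕ) * h),
      ((Ioo 0 h).indicator (fun _ => x) s - A₀ (v x s)) := if_pos hj
  rw [e1]
  congr 1
  refine volt_congr ?_ (hcell j hj).1 (hcell j hj).2
  filter_upwards [hind x w hw] with s hs
  rw [hs]

/-- A pulse on `(0, h)` is a constant right-hand side minus its shift by `h`, so its response is `v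
t - v (t - h)`. Integrating the derivative over a cell turns this into a difference of two
consecutive increments of `y`. -/
theorem kernel_eq_second_diff (hp : 1 ≤ p)
    {n : ℕ} (hh : 0 < h) {κ : ℕ → X →L[ℝ] X}
    (hκ : ∀ x v, Sol J (fun _ => A₀) p 0 (n * h) ((Ioo 0 h).indicator fun _ => x) 0 v → ∀ j < n,
        κ j x = h⁻¹ • ∫ s in (j * h)..((j + 1 : ℕ) * h),
          ((Ioo 0 h).indicator (fun _ => x) s - A₀ (v s)))
    (hy : Traj J A₀ p 0 (n * h) (fun _ => x) y v) (hy0 : y 0 = 0) {j : ℕ} (hj : j + 1 < n) :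
    κ (j + 1) x = h⁻¹ • ((y (j * h + h + h) - y (j * h + h)) - (y (j * h + h) - y (j * h))) := by
  have hA := FamBdd.const A₀ 0 (n * h)
  have hx : ∀ a b : ℝ, MemLp (fun _ : ℝ => x) p (vol a b) := fun a b => memLp_const x
  have hs : Sol J (fun _ => A₀) p 0 (n * h) (fun _ => x) 0 v := hy0 ▸ hy.sol
  have hjn : ((j : ℝ) + 2) ≤ n := by exact_mod_cast hj
  have hhb : h ≤ n * h := by
    have : (1 : ℝ) ≤ n := by linarith [(Nat.cast_nonneg j : (0 : ℝ) ≤ j)]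
    nlinarith
  have hb2 : (j : ℝ) * h + h + h ≤ n * h := by nlinarith
  have hj0 : 0 ≤ (j : ℝ) * h := by positivity
  have h1 := (hs.translate h).restrict_right (d := n * h) (by linarith)
  rw [zero_add] at h1
  have h2 := h1.extend_left hp hA hh.le hhb (hx _ _) rfl
  have e0 : (fun t => if t ≤ h then 0 else x) = (Ioi h).indicator fun _ => x := by
    funext t
    by_cases ht : t ≤ h
    · rw [if_pos ht, indicator_of_notMem (s := Ioi h) (not_lt.2 ht)]
    · rw [if_neg ht, indicator_of_mem (s := Ioi h) (not_le.1 ht)]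
  have h3 := hs.sub hp hA (hx _ _) (by rw [e0]; exact (hx _ _).indicator measurableSet_Ioi) h2
  rw [sub_zero] at h3
  have h4 := h3.congr (g := (Ioo 0 h).indicator fun _ => x) (by
    have hne : ∀ᵐ t ∂vol 0 (n * h), t ≠ h := ae_restrict_of_ae (by simp [ae_iff, measure_singleton])
    filter_upwards [ae_vol_mem 0 (n * h), hne] with t ht htne
    by_cases hth : t ≤ h
    · have : t ∈ Ioo 0 h := ⟨ht.1, lt_of_le_of_ne hth htne⟩
      simp [hth, this]
    · have : t ∉ Ioo 0 h := fun h' => hth h'.2.le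
      simp [hth, this]) (ae_eq_refl _)
  rw [hκ x _ h4 (j + 1) hj]
  congr 1
  have e1 : ((j + 1 : ℕ) : ℝ) * h = j * h + h := by push_cast; ring
  have e2 : ((j + 1 + 1 : ℕ) : ℝ) * h = j * h + h + h := by push_cast; ring
  rw [e1, e2]
  have e3 : ∀ s ∈ Ioo ((j : ℝ) * h + h) (j * h + h + h),
      (Ioo 0 h).indicator (fun _ => x) s - A₀ (v s - if s ≤ h then 0 else v (s - h)) =
      (x - A₀ (v s)) - (x - A₀ (v (s - h))) := by
    intro s hs
    have n1 : ¬ s ≤ h := by linarith [hs.1]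
    have n2 : s ∉ Ioo 0 h := fun h' => n1 h'.2.le
    rw [indicator_of_notMem n2, if_neg n1, map_sub]
    abel
  rw [volt_congr (a := j * h + h) (b := j * h + h + h)
    (g := fun s => (x - A₀ (v s)) - (x - A₀ (v (s - h)))) (by
      filter_upwards [ae_vol_mem (j * h + h) (j * h + h + h)] with s hs using e3 s hs)
    ⟨le_rfl, by linarith⟩ ⟨by linarith, le_rfl⟩, intervalIntegral.integral_sub,
    intervalIntegral.integral_comp_sub_right (fun s => x - A₀ (v s)),
    add_sub_cancel_right, add_sub_cancel_right,
    ← hy.eq_sub hp (hx _ _) ⟨by linarith, by linarith⟩ ⟨by linarith, hb2⟩,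
    ← hy.eq_sub hp (hx _ _) ⟨hj0, by linarith⟩ ⟨by linarith, by linarith⟩]
  · exact intervalIntegrable_of_memLp hp (hy.memLp_deriv (hx _ _)) ⟨by linarith, by linarith⟩
      ⟨by linarith, hb2⟩
  · have := (intervalIntegrable_of_memLp hp (hy.memLp_deriv (hx _ _)) (s := j * h)
      (t := j * h + h) ⟨hj0, by linarith⟩ ⟨by linarith, by linarith⟩).comp_sub_right h
    exact this

/-- The discretized problem is given by a Toeplitz kernel. -/
theorem cell_average_eq (hp : 1 ≤ p) (hus : ∀ a b, a < b → US J (fun _ => A₀) p a b)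
    {n : ℕ} (hh : 0 < h) {κ : ℕ → X →L[ℝ] X}
    (hκ : ∀ x v, Sol J (fun _ => A₀) p 0 (n * h) ((Ioo 0 h).indicator fun _ => x) 0 v → ∀ j < n,
        κ j x = h⁻¹ • ∫ s in (j * h)..((j + 1 : ℕ) * h),
          ((Ioo 0 h).indicator (fun _ => x) s - A₀ (v s)))
    {x : ℕ → X} {v : ℝ → D} (hv : Sol J (fun _ => A₀) p 0 (n * h) (stepFun h n x) 0 v)
    {k : ℕ} (hk : k < n) :
    h⁻¹ • ∫ s in (k * h)..((k + 1 : ℕ) * h), (stepFun h n x s - A₀ (v s)) =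
      ∑ m ∈ Finset.range n, toeplitz κ k m (x m) := by
  have hn' : (0 : ℝ) < n := by exact_mod_cast (by omega : 0 < n)
  have hb : 0 < n * h := by positivity
  have hA := FamBdd.const A₀ 0 (n * h)
  have hm : ∀ (x : X) a b, MemLp ((Ioo 0 h).indicator fun _ => x) p (vol a b) := fun x a b =>
    (memLp_const x).indicator measurableSet_Ioo
  have hm2 : ∀ i : ℕ, MemLp ((Ioo (i * h) ((i + 1 : ℕ) * h)).indicator fun _ => x i) p
    (vol 0 (n * h)) := fun i => (memLp_const _).indicator measurableSet_Ioo
  choose w hw using fun x : X => (hus 0 (n * h) hb).1 _ (hm x 0 (n * h))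
  -- Response to the `i`-th pulse: the response to the pulse on `(0, h)` moved by `i h` and zero
  -- before. By uniqueness `v` is the sum of these; their vanishing before `i h` gives the zeros
  -- above the diagonal.
  set W : ℕ → ℝ → D := fun i t => if t ≤ i * h then 0 else w (x i) (t - i * h) with hW
  have hWs : ∀ i ∈ Finset.range n, Sol J (fun _ => A₀) p 0 (n * h)
      ((Ioo (i * h) ((i + 1 : ℕ) * h)).indicator fun _ => x i) 0 (W i) := by
    intro i hi
    have hin : (i : ℝ) ≤ n := by exact_mod_cast (Finset.mem_range.1 hi).le
    have hi0 : 0 ≤ (i : ℝ) * h := by positivity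
    have hinh : (i : ℝ) * h ≤ n * h := by gcongr
    have h1 := ((hw (x i)).translate (i * h)).restrict_right (d := n * h) (by linarith)
    rw [zero_add] at h1
    have hmt := memLp_subinterval (memLp_translate (hm (x i) 0 (n * h)) (i * h)) (c := i * h)
      (d := n * h) (by linarith) (by linarith)
    have h2 := h1.extend_left hp hA hi0 hinh hmt rfl
    refine h2.congr (Eventually.of_forall fun t => ?_) (ae_eq_refl _)
    by_cases ht : t ∈ Ioo (i * h) ((i + 1 : ℕ) * h)
    · have n1 : ¬ t ≤ i * h := not_le.2 ht.1
      have n2 : t - i * h ∈ Ioo 0 h := by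
        have := ht.2
        push_cast at this
        exact ⟨by linarith [ht.1], by linarith⟩
      simp only [n1, if_false]
      rw [indicator_of_mem ht, indicator_of_mem n2]
    · rw [indicator_of_notMem ht]
      by_cases n1 : t ≤ i * h
      · simp [n1]
      · have n2 : t - i * h ∉ Ioo 0 h := fun h' => ht ⟨not_le.1 n1, by
          push_cast; linarith [h'.2]⟩
        simp only [n1, if_false]
        rw [indicator_of_notMem n2]
  have hsum := Sol.sum (Finset.range n) hp hA (fun i _ => hm2 i) hWs
  rw [Finset.sum_const_zero] at hsum
  have huniq : v =ᵐ[vol 0 (n * h)] fun t => ∑ i ∈ Finset.range n, W i t :=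
    (hus 0 (n * h) hb).unique hp hA (memLp_stepFun n x _ _) hv hsum
  have hk0 : (k : ℝ) * h ∈ Icc 0 (n * h) := by
    have : (k : ℝ) ≤ n := by exact_mod_cast hk.le
    exact ⟨by positivity, by gcongr⟩
  have hk1 : ((k + 1 : ℕ) : ℝ) * h ∈ Icc 0 (n * h) := by
    have : ((k + 1 : ℕ) : ℝ) ≤ n := by exact_mod_cast hk
    exact ⟨by positivity, by gcongr⟩
  have hkk : (k : ℝ) * h ≤ (k + 1 : ℕ) * h := by push_cast; nlinarith
  rw [volt_congr (g := fun s => ∑ i ∈ Finset.range n,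
    ((Ioo (i * h) ((i + 1 : ℕ) * h)).indicator (fun _ => x i) s - A₀ (W i s))) (by
      filter_upwards [huniq] with s hs
      rw [hs, map_sum, Finset.sum_sub_distrib, stepFun]) hk0 hk1,
    intervalIntegral.integral_finsetSum fun i hi =>
      intervalIntegrable_of_memLp hp ((hWs i hi).memLp_rhs hA (hm2 i)) hk0 hk1, Finset.smul_sum]
  refine Finset.sum_congr rfl fun i hi => ?_
  by_cases hik : i ≤ k
  · rw [toeplitz, if_pos hik, hκ (x i) _ (hw (x i)) (k - i) (by omega)]
    congr 1
    have hik' : (i : ℝ) ≤ k := by exact_mod_cast hik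
    have e1 : ((k - i : ℕ) : ℝ) * h = k * h - i * h := by rw [Nat.cast_sub hik]; ring
    have e2 : ((k - i + 1 : ℕ) : ℝ) * h = (k + 1 : ℕ) * h - i * h := by
      push_cast [Nat.cast_sub hik]; ring
    rw [e1, e2, ← intervalIntegral.integral_comp_sub_right
      (fun s => (Ioo 0 h).indicator (fun _ => x i) s - A₀ (w (x i) s))]
    refine volt_congr (a := k * h) (b := (k + 1 : ℕ) * h) ?_ ⟨le_rfl, hkk⟩ ⟨hkk, le_rfl⟩
    filter_upwards [ae_vol_mem (k * h) ((k + 1 : ℕ) * h)] with s hs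
    have n1 : ¬ s ≤ i * h := by
      have : (i : ℝ) * h ≤ k * h := by gcongr
      linarith [hs.1]
    have n2 : s ∈ Ioo (i * h) ((i + 1 : ℕ) * h) ↔ s - i * h ∈ Ioo 0 h := by
      simp only [mem_Ioo]; push_cast
      constructor <;> rintro ⟨a1, a2⟩ <;> constructor <;> linarith
    have n3 : (Ioo (i * h) ((i + 1 : ℕ) * h)).indicator (fun _ => x i) s =
        (Ioo 0 h).indicator (fun _ => x i) (s - i * h) := by
      by_cases hmem : s ∈ Ioo (i * h) ((i + 1 : ℕ) * h)
      · rw [indicator_of_mem hmem, indicator_of_mem (n2.1 hmem)]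
      · rw [indicator_of_notMem hmem, indicator_of_notMem fun h' => hmem (n2.2 h')]
    rw [n3, hW]
    simp only [n1, if_false]
  · rw [toeplitz, if_neg hik, zero_apply, volt_congr (a := k * h) (b := (k + 1 : ℕ) * h)
      (g := fun _ => 0) ?_ ⟨le_rfl, hkk⟩ ⟨hkk, le_rfl⟩]
    · simp
    · filter_upwards [ae_vol_mem (k * h) ((k + 1 : ℕ) * h)] with s hs
      have hik' : ((k + 1 : ℕ) : ℝ) ≤ i := by exact_mod_cast (not_le.1 hik)
      have : ((k + 1 : ℕ) : ℝ) * h ≤ i * h := by gcongr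
      have n1 : s ≤ i * h := by linarith [hs.2]
      have n2 : s ∉ Ioo (i * h) ((i + 1 : ℕ) * h) := fun h' => absurd h'.1 (not_lt.2 n1)
      rw [indicator_of_notMem n2, hW]
      simp [n1]

end Discretize

/-! ### Mesh-independent `ℓ^q` bounds -/

section DiscreteBound

variable {X : Type*} [NormedAddCommGroup X] [NormedSpace ℝ X]
variable {D : Type*} [NormedAddCommGroup D] [NormedSpace ℝ D]
variable {J A₀ : D →L[ℝ] X} {p q : ℝ≥0∞} {K b h : ℝ} {y : ℝ → X} {v : ℝ → D} {x : X}

/-- The mean of `g` over the cell `(k h, (k+1) h)`. -/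
noncomputable def cellAvg (h : ℝ) (g : ℝ → X) (k : ℕ) : X :=
  h⁻¹ • ∫ s in (k * h)..((k + 1 : ℕ) * h), g s

theorem cell_mem {n k : ℕ} (hh : 0 < h) (hk : k < n) :
    (k : ℝ) * h ∈ Icc 0 (n * h) ∧ ((k + 1 : ℕ) : ℝ) * h ∈ Icc 0 (n * h) ∧
      (k : ℝ) * h ≤ (k + 1 : ℕ) * h ∧ ((k + 1 : ℕ) : ℝ) * h - k * h = h := by
  have h1 : (k : ℝ) ≤ n := by exact_mod_cast hk.le
  have h2 : ((k + 1 : ℕ) : ℝ) ≤ n := by exact_mod_cast hk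
  refine ⟨⟨by positivity, by gcongr⟩, ⟨by positivity, by gcongr⟩, ?_, ?_⟩
  · push_cast; nlinarith
  · push_cast; ring

theorem sum_cellAvg_rpow_le (hp : 1 ≤ p) (hp' : p ≠ ⊤) (hh : 0 < h) {n : ℕ} {g : ℝ → X}
    (hg : MemLp g p (vol 0 (n * h))) :
    h * ∑ k ∈ Finset.range n, ‖cellAvg h g k‖ ^ p.toReal ≤ lpn p 0 (n * h) g ^ p.toReal := by
  have hp0 : p ≠ 0 := (zero_lt_one.trans_le hp).ne'
  have hr := ENNReal.toReal_pos hp0 hp'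
  rw [lpn_rpow_sum hp0 hp' hh.le n hg, Finset.mul_sum]
  refine Finset.sum_le_sum fun k hk => ?_
  obtain ⟨h1, h2, h3, h4⟩ := cell_mem hh (Finset.mem_range.1 hk)
  have e2 := norm_volt_le hp (memLp_subinterval hg h1.1 h2.2) (t := (k + 1 : ℕ) * h) ⟨h3, le_rfl⟩
  rw [h4] at e2
  have e3 : ‖cellAvg h g k‖ ≤ h ^ (-(1 / p.toReal)) * lpn p (k * h) ((k + 1 : ℕ) * h) g := by
    rw [cellAvg, norm_smul, norm_inv, Real.norm_of_nonneg hh.le, inv_mul_le_iff₀ hh, ← mul_assoc]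
    rw [Real.rpow_sub hh, Real.rpow_one, div_eq_mul_inv, ← Real.rpow_neg hh.le] at e2
    exact e2
  calc h * ‖cellAvg h g k‖ ^ p.toReal
      ≤ h * (h ^ (-(1 / p.toReal)) * lpn p (k * h) ((k + 1 : ℕ) * h) g) ^ p.toReal := by gcongr
    _ = _ := by
      rw [Real.mul_rpow (by positivity) (lpn_nonneg _ _ _ _), ← Real.rpow_mul hh.le, ← mul_assoc,
        neg_mul, one_div_mul_cancel hr.ne', Real.rpow_neg_one, mul_inv_cancel₀ hh.ne', one_mul]

theorem lpn_stepFun_cellAvg_le (hp : 1 ≤ p) (hp' : p ≠ ⊤) (hh : 0 < h) {n : ℕ} {g : ℝ → X}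
    (hg : MemLp g p (vol 0 (n * h))) :
    lpn p 0 (n * h) (stepFun h n (cellAvg h g)) ≤ lpn p 0 (n * h) g := by
  have hp0 : p ≠ 0 := (zero_lt_one.trans_le hp).ne'
  have hr := ENNReal.toReal_pos hp0 hp'
  refine (Real.rpow_le_rpow_iff (lpn_nonneg _ _ _ _) (lpn_nonneg _ _ _ _) hr).1 ?_
  rw [lpn_stepFun_rpow hp0 hp' hh]
  exact sum_cellAvg_rpow_le hp hp' hh hg

variable [CompleteSpace X]

/-- For `j ≥ 2` the difference is `h⁻¹` times a third difference of step `h` based at `(j - 1) h`.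
For `j = 1` that base point would be zero, and the trivial bound `2 K` is used. -/
theorem kernel_step_le (hK : APriori J A₀ p b K) (hK0 : 0 ≤ K) (hp : 1 ≤ p) (hp' : p ≠ ⊤)
    (hus : ∀ a b, a < b → US J (fun _ => A₀) p a b) {n : ℕ} (hh : 0 < h) (hnb : n * h = b)
    {κ : ℕ → X →L[ℝ] X} (hκK : ∀ j < n, ‖κ j‖ ≤ K)
    (hκ : ∀ x v, Sol J (fun _ => A₀) p 0 (n * h) ((Ioo 0 h).indicator fun _ => x) 0 v → ∀ j < n,
        κ j x = h⁻¹ • ∫ s in (j * h)..((j + 1 : ℕ) * h),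
          ((Ioo 0 h).indicator (fun _ => x) s - A₀ (v s))) {j : ℕ} (hj : 1 ≤ j) (hjn : j + 1 < n) :
    ‖κ (j + 1) - κ j‖ ≤ (432 * K ^ 2 * (K + 1) ^ 2 + 2 * K) * ((j : ℝ) ^ 2)⁻¹ := by
  rcases Nat.eq_or_lt_of_le hj with rfl | hj2
  · have h1 := norm_sub_le (κ (1 + 1)) (κ 1)
    have h2 := hκK (1 + 1) hjn
    have h3 := hκK 1 (by omega)
    have h4 : 0 ≤ 432 * K ^ 2 * (K + 1) ^ 2 := by positivity
    simp only [Nat.cast_one, one_pow, inv_one, mul_one]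
    linarith
  · obtain ⟨i, rfl⟩ : ∃ i, j = i + 1 := ⟨j - 1, by omega⟩
    have hi : 1 ≤ i := by omega
    have hi' : (1 : ℝ) ≤ i := by exact_mod_cast hi
    have hin : (i : ℝ) + 3 ≤ n := by exact_mod_cast (by omega : i + 3 ≤ n)
    have hn0 : (0 : ℝ) < n := by linarith
    refine ContinuousLinearMap.opNorm_le_bound _ (by positivity) fun x => ?_
    obtain ⟨v, hv⟩ := (hus 0 (n * h) (by positivity)).1 (fun _ => x) (memLp_const x)
    have ht := hv.traj
    set y : ℝ → X := fun t => 0 + ∫ s in (0 : ℝ)..t, (x - A₀ (v s)) with hy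
    have hy0 : y 0 = 0 := by simp [hy]
    have e1 := kernel_eq_second_diff hp hh hκ ht hy0 (j := i + 1) hjn
    have e2 := kernel_eq_second_diff hp hh hκ ht hy0 (j := i) (by omega)
    have e3 : ((i + 1 : ℕ) : ℝ) * h = i * h + h := by push_cast; ring
    rw [e3] at e1
    have e4 := third_diff_le (r := h) (T := i * h) hK hK0 hp hp' ht hy0 hnb.le hh (by nlinarith)
      (by nlinarith)
    rw [sub_apply, e1, e2, ← smul_sub, norm_smul, norm_inv, Real.norm_of_nonneg hh.le,
      inv_mul_le_iff₀ hh]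
    refine e4.trans ?_
    have e5 : h / (i * h) = (i : ℝ)⁻¹ := by field_simp
    -- The shift from `i` to `j = i + 1` costs at most `((i + 1) / i)^2 ≤ 4`, whence `432 = 4 ·
    -- 108`.
    have e6 : ((i : ℝ)⁻¹) ^ 2 ≤ 4 * (((i + 1 : ℕ) : ℝ) ^ 2)⁻¹ := by
      rw [← div_eq_mul_inv, inv_pow, inv_eq_one_div, div_le_div_iff₀ (by positivity) (by positivity)]
      push_cast
      nlinarith
    rw [e5]
    have e7 : 0 ≤ 108 * K ^ 2 * (K + 1) ^ 2 := by positivity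
    calc 108 * K ^ 2 * (K + 1) ^ 2 * (h * (i : ℝ)⁻¹ ^ 2) * ‖x‖
        ≤ 108 * K ^ 2 * (K + 1) ^ 2 * (h * (4 * (((i + 1 : ℕ) : ℝ) ^ 2)⁻¹)) * ‖x‖ := by gcongr
      _ = h * (432 * K ^ 2 * (K + 1) ^ 2 * (((i + 1 : ℕ) : ℝ) ^ 2)⁻¹ * ‖x‖) := by ring
      _ ≤ h * ((432 * K ^ 2 * (K + 1) ^ 2 + 2 * K) * (((i + 1 : ℕ) : ℝ) ^ 2)⁻¹ * ‖x‖) := by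
        gcongr
        linarith

/-- The a priori estimate in `L^p`, applied to step functions, bounds the Toeplitz kernel on `ℓ^p`,
and extrapolation moves the bound to `ℓ^q`. The point is that `C` depends only on `p`, `q` and the a
priori constant, not on the mesh. -/
theorem exists_discrete_bound [CompleteSpace D] (hp : 1 < p) (hp' : p ≠ ⊤) (hq : 1 < q) (hq' : q ≠ ⊤) (hb : 0 < b)
    (hus : ∀ a b, a < b → US J (fun _ => A₀) p a b) :
    ∃ C, 0 ≤ C ∧ ∀ (n : ℕ) (N : ℕ) (h : ℝ), n = 2 ^ N → n * h = b → ∀ (x : ℕ → X) v,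
      Sol J (fun _ => A₀) p 0 b (stepFun h n x) 0 v →
      lpn q 0 b (stepFun h n (cellAvg h fun s => stepFun h n x s - A₀ (v s))) ≤
        C * lpn q 0 b (stepFun h n x) := by
  obtain ⟨K, hK0, hK⟩ := exists_aPriori hp.le hb hus
  set B := 432 * K ^ 2 * (K + 1) ^ 2 + 2 * K with hB
  have hB0 : 0 ≤ B := by positivity
  have hp0 : p ≠ 0 := (zero_lt_one.trans hp).ne'
  have hq0 : q ≠ 0 := (zero_lt_one.trans hq).ne'
  have hr : 1 < p.toReal := by simpa using (ENNReal.toReal_lt_toReal (by simp) hp').2 hp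
  have hs : 1 < q.toReal := by simpa using (ENNReal.toReal_lt_toReal (by simp) hq').2 hq
  have hKB : K ≤ B := by
    have : 0 ≤ 432 * K ^ 2 * (K + 1) ^ 2 := by positivity
    linarith
  obtain ⟨C, hC0, hC⟩ := kernel_extrapolate (Y := X) (Z := X) hr hs hB0
  refine ⟨C, hC0, fun n N h hn hnb x v hv => ?_⟩
  have hn0 : 0 < n := by rw [hn]; positivity
  have hn0' : (0 : ℝ) < n := by exact_mod_cast hn0
  have hh : 0 < h := by
    rw [← hnb] at hb
    exact (mul_pos_iff_of_pos_left hn0').1 hb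
  obtain ⟨κ, hκK, hκ⟩ := exists_kernel hp.le hus hK0 hn0 hh (hnb.symm ▸ hK)
  have hstep := fun j hj hjn => kernel_step_le hK hK0 hp.le hp' hus hh hnb hκK hκ (j := j) hj hjn
  have hbd : KernelBdd n (toeplitz κ) p.toReal B := by
    intro x
    obtain ⟨v, hv⟩ := (hus 0 (n * h) (hnb.symm ▸ hb)).1 _ (memLp_stepFun (h := h) n x _ _)
    have hm := hv.memLp_rhs (FamBdd.const A₀ _ _) (memLp_stepFun (h := h) n x _ _)
    have h1 := sum_cellAvg_rpow_le hp.le hp' hh hm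
    have h2 := hK 0 (n * h) (hnb.symm ▸ hb) (by linarith) _ _ (memLp_stepFun (h := h) n x _ _) hv
    have h3 : lpn p 0 (n * h) (fun s => stepFun h n x s - A₀ (v s)) ^ p.toReal ≤
        (B * lpn p 0 (n * h) (stepFun h n x)) ^ p.toReal := by
      have := lpn_nonneg p 0 (n * h) (stepFun h n x)
      refine Real.rpow_le_rpow (lpn_nonneg _ _ _ _) (h2.trans ?_) (by positivity)
      gcongr
    rw [Real.mul_rpow hB0 (lpn_nonneg _ _ _ _), lpn_stepFun_rpow hp0 hp' hh] at h3
    have h4 : ∀ k ∈ Finset.range n, cellAvg h (fun s => stepFun h n x s - A₀ (v s)) k =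
        ∑ m ∈ Finset.range n, toeplitz κ k m (x m) := fun k hk =>
      cell_average_eq hp.le hus hh hκ hv (Finset.mem_range.1 hk)
    rw [Finset.sum_congr rfl fun k hk => by rw [h4 k hk]] at h1
    have h5 := h1.trans h3
    rw [mul_left_comm] at h5
    exact le_of_mul_le_mul_left h5 hh
  have hq1 := hC N (toeplitz κ) (hn ▸ hbd) (hn ▸ toeplitz_hormander hB0 hstep)
    (hn ▸ toeplitz_hormander_transpose hB0 hstep) x
  rw [← hn] at hq1
  subst hnb
  rw [← Real.rpow_le_rpow_iff (lpn_nonneg _ _ _ _) (mul_nonneg hC0 (lpn_nonneg _ _ _ _))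
    (zero_lt_one.trans hs), Real.mul_rpow hC0 (lpn_nonneg _ _ _ _), lpn_stepFun_rpow hq0 hq' hh,
    lpn_stepFun_rpow hq0 hq' hh, mul_left_comm]
  refine mul_le_mul_of_nonneg_left ?_ hh.le
  refine le_trans (le_of_eq (Finset.sum_congr rfl fun k hk => ?_)) hq1
  rw [← cell_average_eq hp.le hus hh hκ hv (Finset.mem_range.1 hk)]
  rfl

end DiscreteBound

/-! ### Dyadic refinement and passage to the limit -/

section Refine

variable {X : Type*} [NormedAddCommGroup X] [NormedSpace ℝ X]
variable {D : Type*} [NormedAddCommGroup D] [NormedSpace ℝ D]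
variable {J A₀ : D →L[ℝ] X} {p q : ℝ≥0∞} {K b h : ℝ} {f g : ℝ → X} {v : ℝ → D}

theorem ae_exists_cell (hh : 0 < h) (n : ℕ) :
    ∀ᵐ t ∂vol 0 (n * h), ∃ k < n, t ∈ Ioo (k * h) ((k + 1 : ℕ) * h) := by
  have h1 : ∀ᵐ t ∂vol 0 (n * h), t ∉ range fun k : ℕ => (k : ℝ) * h :=
    ae_restrict_of_ae ((countable_range _).ae_notMem volume)
  filter_upwards [h1, ae_vol_mem 0 (n * h)] with t ht hmem
  have h2 : (⌊t / h⌋₊ : ℝ) ≤ t / h := Nat.floor_le (div_nonneg hmem.1.le hh.le)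
  have h3 := Nat.lt_floor_add_one (t / h)
  rw [le_div_iff₀ hh] at h2
  rw [div_lt_iff₀ hh] at h3
  refine ⟨⌊t / h⌋₊, ?_, lt_of_le_of_ne h2 fun h => ht ⟨_, h⟩, by push_cast; exact h3⟩
  rw [Nat.floor_lt (div_nonneg hmem.1.le hh.le), div_lt_iff₀ hh]
  exact hmem.2

/-- Mesh of the dyadic partition of `(0, b)` of level `N`. -/
noncomputable def mesh (b : ℝ) (N : ℕ) : ℝ := b / ((2 ^ N : ℕ) : ℝ)

theorem mul_mesh (b : ℝ) (N : ℕ) : ((2 ^ N : ℕ) : ℝ) * mesh b N = b := by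
  rw [mesh, mul_div_cancel₀]
  positivity

theorem mesh_pos (hb : 0 < b) (N : ℕ) : 0 < mesh b N := by
  rw [mesh]; positivity

theorem tendsto_mesh (hb : 0 < b) : Tendsto (mesh b) atTop (𝓝[>] 0) := by
  refine tendsto_nhdsWithin_iff.2 ⟨?_, Eventually.of_forall fun N => mesh_pos hb N⟩
  have : Tendsto (fun N : ℕ => b * (1 / 2 : ℝ) ^ N) atTop (𝓝 (b * 0)) :=
    (tendsto_pow_atTop_nhds_zero_of_lt_one (by norm_num) (by norm_num)).const_mul b
  rw [mul_zero] at this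
  refine this.congr fun N => ?_
  rw [mesh]
  push_cast
  rw [one_div, inv_pow, div_eq_mul_inv]

theorem ae_exists_dyadic_cell (hb : 0 < b) : ∀ᵐ t ∂vol 0 b, ∀ N, ∃ k : ℕ, k < 2 ^ N ∧
    t ∈ Ioo (k * mesh b N) ((k + 1 : ℕ) * mesh b N) := by
  rw [ae_all_iff]
  intro N
  have := ae_exists_cell (mesh_pos hb N) (2 ^ N)
  rwa [mul_mesh] at this

omit [NormedSpace ℝ X] in
theorem stepFun_sample_sub_le (hb : 0 < b) (hf : Continuous f) {ε : ℝ} (hε : 0 < ε) :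
    ∀ᶠ N in atTop, ∀ᵐ t ∂vol 0 b,
      ‖stepFun (mesh b N) (2 ^ N) (fun k => f (k * mesh b N)) t - f t‖ ≤ ε := by
  obtain ⟨δ, hδ, H⟩ := Metric.uniformContinuousOn_iff.1
    (isCompact_Icc.uniformContinuousOn_of_continuous (hf.continuousOn (s := Icc 0 b))) ε hε
  have hev : ∀ᶠ N in atTop, mesh b N < δ :=
    ((tendsto_mesh hb).mono_right nhdsWithin_le_nhds).eventually_lt_const hδ
  filter_upwards [hev] with N hN
  filter_upwards [ae_exists_dyadic_cell hb] with t ht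
  obtain ⟨k, hk, hkt⟩ := ht N
  obtain ⟨h1, h2, h3, h4⟩ := cell_mem (mesh_pos hb N) hk
  rw [mul_mesh] at h1 h2
  rw [stepFun_apply (mesh_pos hb N) _ hk hkt, ← dist_eq_norm]
  refine (H _ h1 t ⟨h1.1.trans hkt.1.le, hkt.2.le.trans h2.2⟩ ?_).le
  rw [Real.dist_eq, abs_lt]
  constructor <;> linarith [hkt.1, hkt.2]

/-- Lebesgue's differentiation theorem for balls that contain `t` without being centred there: the
cell around `t` is a ball about its midpoint with radius half the mesh. -/
theorem tendsto_stepFun_cellAvg [CompleteSpace X] (hb : 0 < b) (hg : IntegrableOn g (Ioo 0 b)) :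
    ∀ᵐ t ∂vol 0 b, Tendsto (fun N => stepFun (mesh b N) (2 ^ N) (cellAvg (mesh b N) g) t) atTop
      (𝓝 (g t)) := by
  have hG : LocallyIntegrable ((Ioo 0 b).indicator g) volume :=
    ((integrable_indicator_iff measurableSet_Ioo).2 hg).locallyIntegrable
  have h1 := ae_restrict_of_ae (s := Ioo 0 b)
    (IsUnifLocDoublingMeasure.ae_tendsto_average volume hG 1)
  filter_upwards [h1, ae_exists_dyadic_cell hb, ae_vol_mem 0 b] with t ht hcell hmem
  choose k hk hkt using hcell
  have h2 := ht (l := atTop) (fun N => k N * mesh b N + mesh b N / 2) (fun N => mesh b N / 2) (by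
    refine tendsto_nhdsWithin_iff.2 ⟨?_, Eventually.of_forall fun N => half_pos (mesh_pos hb N)⟩
    simpa using ((tendsto_mesh hb).mono_right nhdsWithin_le_nhds).div_const 2)
    (Eventually.of_forall fun N => by
      have := hkt N
      rw [Real.closedBall_eq_Icc]
      push_cast at this
      constructor <;> linarith [this.1, this.2])
  rw [indicator_of_mem hmem] at h2
  refine h2.congr fun N => ?_
  obtain ⟨h1, h2, h3, h4⟩ := cell_mem (mesh_pos hb N) (hk N)
  rw [mul_mesh] at h1 h2
  have e1 : k N * mesh b N + mesh b N / 2 - mesh b N / 2 = k N * mesh b N := by ring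
  have e2 : k N * mesh b N + mesh b N / 2 + mesh b N / 2 = (k N + 1 : ℕ) * mesh b N := by
    push_cast; ring
  rw [stepFun_apply (mesh_pos hb N) _ (hk N) (hkt N), cellAvg, Real.closedBall_eq_Icc, e1, e2,
    setAverage_eq, Measure.real, Real.volume_Icc, h4, ENNReal.toReal_ofReal (mesh_pos hb N).le,
    intervalIntegral.integral_of_le h3, integral_Icc_eq_integral_Ioo, integral_Ioc_eq_integral_Ioo]
  congr 1
  refine setIntegral_congr_fun measurableSet_Ioo fun s hs => ?_
  exact indicator_of_mem (s := Ioo 0 b) ⟨h1.1.trans_lt hs.1, hs.2.trans_le h2.2⟩ g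

theorem cellAvg_sub {n k : ℕ} (hh : 0 < h) (hp : 1 ≤ p) (hf : MemLp f p (vol 0 (n * h)))
    (hg : MemLp g p (vol 0 (n * h))) (hk : k < n) :
    cellAvg h (fun t => f t - g t) k = cellAvg h f k - cellAvg h g k := by
  obtain ⟨h1, h2, -⟩ := cell_mem hh hk
  rw [cellAvg, intervalIntegral.integral_sub (intervalIntegrable_of_memLp hp hf h1 h2)
    (intervalIntegrable_of_memLp hp hg h1 h2), smul_sub]
  rfl

/-- Step functions sampled from `f` converge uniformly, hence in both `L^p` and `L^q`. By the `L^p`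
estimate the cell averages of their derivatives approach those of `g`, which converge to `g` a.e.;
along a subsequence the discrete `L^q` bounds pass to `g` by Fatou's lemma. -/
theorem lpn_deriv_le_of_continuous [CompleteSpace X] [CompleteSpace D] (hp : 1 < p) (hp' : p ≠ ⊤)
    (hq : 1 < q) (hq' : q ≠ ⊤) (hb : 0 < b) (hus : ∀ a b, a < b → US J (fun _ => A₀) p a b) :
    ∃ C, 0 ≤ C ∧ ∀ f v, Continuous f → Sol J (fun _ => A₀) p 0 b f 0 v →
      MemLp (fun s => f s - A₀ (v s)) q (vol 0 b) ∧
      lpn q 0 b (fun s => f s - A₀ (v s)) ≤ C * lpn q 0 b f := by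
  obtain ⟨C, hC0, hC⟩ := exists_discrete_bound hp hp' hq hq' hb hus
  obtain ⟨K, hK0, hK⟩ := exists_aPriori hp.le hb hus
  refine ⟨C, hC0, fun f v hf hv => ?_⟩
  have hA := FamBdd.const A₀ 0 b
  have hfm : ∀ r : ℝ≥0∞, MemLp f r (vol 0 b) := fun r => memLp_of_continuousOn hf.continuousOn
  set F : ℕ → ℝ → X := fun N => stepFun (mesh b N) (2 ^ N) (fun k => f (k * mesh b N)) with hF
  have hFm : ∀ (r : ℝ≥0∞) N, MemLp (F N) r (vol 0 b) := fun r N => memLp_stepFun _ _ _ _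
  have hFf : ∀ r : ℝ≥0∞, Tendsto (fun N => lpn r 0 b (fun t => F N t - f t)) atTop (𝓝 0) := by
    intro r
    rw [Metric.tendsto_atTop']
    intro ε hε
    set c := lpn r 0 b (fun _ => (1 : ℝ)) with hc
    have hc0 : 0 ≤ c := lpn_nonneg _ _ _ _
    have := stepFun_sample_sub_le hb hf (ε := ε / (c + 1)) (by positivity)
    obtain ⟨N₀, hN₀⟩ := eventually_atTop.1 this
    refine ⟨N₀, fun N hN => ?_⟩
    rw [dist_zero_right, Real.norm_of_nonneg (lpn_nonneg _ _ _ _)]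
    refine (lpn_le_mul (g := fun _ => (1 : ℝ)) (M := ε / (c + 1)) (by positivity)
      (memLp_const 1) ?_).trans_lt ?_
    · filter_upwards [hN₀ N hN.le] with t ht
      simpa using ht
    · rw [div_mul_eq_mul_div, div_lt_iff₀ (by positivity)]
      nlinarith
  choose w hw using fun N => (hus 0 b hb).1 (F N) (hFm p N)
  set G : ℕ → ℝ → X := fun N s => F N s - A₀ (w N s) with hG
  set g : ℝ → X := fun s => f s - A₀ (v s) with hg
  have hGm : ∀ N, MemLp (G N) p (vol 0 b) := fun N => (hw N).memLp_rhs hA (hFm p N)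
  have hgm : MemLp g p (vol 0 b) := hv.memLp_rhs hA (hfm p)
  have hGg : ∀ N, lpn p 0 b (fun s => G N s - g s) ≤ K * lpn p 0 b (fun t => F N t - f t) := by
    intro N
    have h1 := (hw N).sub hp.le hA (hFm p N) (hfm p) hv
    rw [sub_zero] at h1
    have h2 := hK 0 b hb (by simp) _ _ ((hFm p N).sub (hfm p)) h1
    refine le_trans (le_of_eq (congrArg _ ?_)) h2
    funext s
    simp only [hG, hg, map_sub, Pi.sub_apply]
    abel
  set e : ℕ → ℝ → X := fun N => stepFun (mesh b N) (2 ^ N) (cellAvg (mesh b N) (G N)) with he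
  set e' : ℕ → ℝ → X := fun N => stepFun (mesh b N) (2 ^ N) (cellAvg (mesh b N) g) with he'
  have hem : ∀ (r : ℝ≥0∞) N, MemLp (e N) r (vol 0 b) := fun r N => memLp_stepFun _ _ _ _
  have hem' : ∀ (r : ℝ≥0∞) N, MemLp (e' N) r (vol 0 b) := fun r N => memLp_stepFun _ _ _ _
  have hee : ∀ N, lpn p 0 b (fun t => e N t - e' N t) ≤ lpn p 0 b (fun s => G N s - g s) := by
    intro N
    have hGm' := hGm N
    have hgm' := hgm
    rw [← mul_mesh b N] at hGm' hgm'
    have h1 := lpn_stepFun_cellAvg_le hp.le hp' (mesh_pos hb N) (hGm'.sub hgm')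
    rw [mul_mesh] at h1
    refine le_trans (le_of_eq (lpn_congr ?_)) h1
    filter_upwards [ae_exists_dyadic_cell hb] with t ht
    obtain ⟨k, hk, hkt⟩ := ht N
    simp only [he, he']
    rw [stepFun_apply (mesh_pos hb N) _ hk hkt, stepFun_apply (mesh_pos hb N) _ hk hkt,
      stepFun_apply (mesh_pos hb N) _ hk hkt]
    exact (cellAvg_sub (mesh_pos hb N) hp.le hGm' hgm' hk).symm
  have hlim : Tendsto (fun N => lpn p 0 b (fun t => e N t - e' N t)) atTop (𝓝 0) := by
    refine squeeze_zero (fun _ => lpn_nonneg _ _ _ _) (fun N => (hee N).trans (hGg N)) ?_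
    simpa using (hFf p).const_mul K
  have hmeas : TendstoInMeasure (vol 0 b) (fun N t => e N t - e' N t) atTop (fun _ => 0) := by
    refine tendstoInMeasure_of_tendsto_eLpNorm (p := p) (zero_lt_one.trans hp).ne'
      (fun N => ((hem p N).sub (hem' p N)).1) aestronglyMeasurable_const ?_
    have h1 := (ENNReal.tendsto_ofReal hlim)
    rw [ENNReal.ofReal_zero] at h1
    refine h1.congr fun N => ?_
    have h2 : MemLp (fun t => e N t - e' N t) p (vol 0 b) := (hem p N).sub (hem' p N)
    rw [lpn, ENNReal.ofReal_toReal h2.2.ne]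
    congr 1
    funext t
    simp
  obtain ⟨ns, hns, hae⟩ := hmeas.exists_seq_tendsto_ae
  have hae' : ∀ᵐ t ∂vol 0 b, Tendsto (fun i => e (ns i) t) atTop (𝓝 (g t)) := by
    filter_upwards [hae, tendsto_stepFun_cellAvg hb (hgm.integrable hp.le)] with t h1 h2
    have h3 := h1.add (h2.comp hns.tendsto_atTop)
    rw [zero_add] at h3
    exact h3.congr fun i => sub_add_cancel _ _
  have hbound : ∀ ε > 0, eLpNorm g q (vol 0 b) ≤ ENNReal.ofReal (C * (lpn q 0 b f + ε)) := by
    intro ε hε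
    have hev : ∀ᶠ N in atTop, lpn q 0 b (fun t => F N t - f t) < ε :=
      (hFf q).eventually_lt_const hε
    refine Lp.eLpNorm_le_of_ae_tendsto (f := fun i => e (ns i)) ?_ (fun i => (hem q (ns i)).1) hae'
    filter_upwards [hns.tendsto_atTop.eventually hev] with i hi
    rw [← ENNReal.ofReal_toReal (hem q (ns i)).2.ne]
    refine ENNReal.ofReal_le_ofReal ?_
    refine (hC _ (ns i) (mesh b (ns i)) rfl (mul_mesh b _) _ _ (hw (ns i))).trans ?_
    refine mul_le_mul_of_nonneg_left ?_ hC0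
    have h1 := lpn_add_le hq.le (hfm q) ((hFm q (ns i)).sub (hfm q))
    have h2 : lpn q 0 b (fun t => f t + (F (ns i) - f) t) = lpn q 0 b (F (ns i)) := by
      congr 1
      funext t
      simp
    rw [h2] at h1
    exact h1.trans (add_le_add_right hi.le _)
  have hmq : MemLp g q (vol 0 b) :=
    ⟨hgm.1, (hbound 1 one_pos).trans_lt ENNReal.ofReal_lt_top⟩
  refine ⟨hmq, ?_⟩
  have hlim2 : Tendsto (fun ε : ℝ => C * (lpn q 0 b f + ε)) (𝓝[>] 0) (𝓝 (C * (lpn q 0 b f + 0))) :=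
    ((by fun_prop : Continuous fun ε : ℝ => C * (lpn q 0 b f + ε)).tendsto 0).mono_left
      nhdsWithin_le_nhds
  rw [add_zero] at hlim2
  refine ge_of_tendsto hlim2 ?_
  filter_upwards [self_mem_nhdsWithin] with ε hε
  refine ENNReal.toReal_le_of_le_ofReal ?_ (hbound ε hε)
  have h1 := lpn_nonneg q 0 b f
  have h2 : 0 < ε := hε
  positivity

end Refine

/-! ### Independence of the exponent for a single operator -/

section Exponents

variable {X : Type*} [NormedAddCommGroup X] [NormedSpace ℝ X] [CompleteSpace X]
variable {D : Type*} [NormedAddCommGroup D] [NormedSpace ℝ D] [CompleteSpace D]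
variable {J A₀ : D →L[ℝ] X} {p q : ℝ≥0∞} {b : ℝ}

omit [CompleteSpace X] in
theorem lpn_volt_le (hq : 1 ≤ q) {a b : ℝ} (hab : a ≤ b) {g : ℝ → X} (hg : MemLp g q (vol a b)) :
    lpn q a b (fun t => ∫ s in a..t, g s) ≤ (b - a) * lpn q a b g := by
  rcases hab.eq_or_lt with rfl | hab'
  · simp [lpn, vol]
  have hba : 0 < b - a := sub_pos.2 hab'
  have hs : 1 / q.toReal ≤ 1 := by
    rcases eq_or_ne q ⊤ with rfl | hq'
    · simp
    · rw [div_le_one (ENNReal.toReal_pos (zero_lt_one.trans_le hq).ne' hq')]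
      simpa using ENNReal.toReal_mono hq' hq
  refine (lpn_le_of_bound hab (M := (b - a) ^ (1 - 1 / q.toReal) * lpn q a b g)
    (mul_nonneg (by positivity) (lpn_nonneg _ _ _ _)) fun t ht => ?_).trans (le_of_eq ?_)
  · refine (norm_volt_le hq hg ⟨ht.1.le, ht.2.le⟩).trans ?_
    have h2 : (t - a) ^ (1 - 1 / q.toReal) ≤ (b - a) ^ (1 - 1 / q.toReal) :=
      Real.rpow_le_rpow (by linarith [ht.1]) (by linarith [ht.2]) (by linarith)
    exact mul_le_mul h2 (lpn_subinterval hg le_rfl ht.2.le) (lpn_nonneg _ _ _ _) (by positivity)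
  · rw [mul_right_comm, ← Real.rpow_add hba, sub_add_cancel, Real.rpow_one]

/-- Maximal regularity forces the norm of `D` to be equivalent to the graph norm. -/
theorem exists_graph_norm_bound (hp : 1 < p) (hp' : p ≠ ⊤)
    (hus : US J (fun _ => A₀) p 0 1) : ∃ C, 0 ≤ C ∧ ∀ x, ‖x‖ ≤ C * (‖J x‖ + ‖A₀ x‖) := by
  obtain ⟨C, hC0, hC⟩ := hus.exists_bound hp.le one_pos (FamBdd.const A₀ 0 1) (norm_nonneg _)
  have hp0 : p ≠ 0 := (zero_lt_one.trans hp).ne'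
  have hr : 1 < p.toReal := by simpa using (ENNReal.toReal_lt_toReal (by simp) hp').2 hp
  refine ⟨4 * C, by positivity, fun x => ?_⟩
  have hf : Continuous fun t : ℝ => J x + t • A₀ x := by fun_prop
  have hv : Continuous fun t : ℝ => t • x := by fun_prop
  -- The explicit solution `t • x`, whose right-hand side involves only `J x` and `A₀ x`.
  have hs : Sol J (fun _ => A₀) p 0 1 (fun t : ℝ => J x + t • A₀ x) 0 (fun t : ℝ => t • x) := by
    refine ⟨memLp_of_continuousOn hv.continuousOn, Eventually.of_forall fun t => ?_⟩
    simp
  have h1 := hC _ _ (memLp_of_continuousOn hf.continuousOn) hs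
  have h2 : lpn p 0 1 (fun t : ℝ => J x + t • A₀ x) ≤ ‖J x‖ + ‖A₀ x‖ := by
    refine (lpn_le_of_bound zero_le_one (M := ‖J x‖ + ‖A₀ x‖) (by positivity)
      fun t ht => ?_).trans (by simp)
    refine (norm_add_le _ _).trans ?_
    rw [norm_smul, Real.norm_of_nonneg ht.1.le]
    have := mul_le_mul_of_nonneg_right ht.2.le (norm_nonneg (A₀ x))
    linarith
  have h3 : lpn p (1 / 2) 1 (fun _ => x) ≤ 2 * lpn p 0 1 (fun t : ℝ => t • x) := by
    have hm : MemLp (fun t : ℝ => t • x) p (vol 0 1) := memLp_of_continuousOn hv.continuousOn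
    refine (lpn_le_mul zero_le_two (memLp_subinterval hm (by norm_num) le_rfl) ?_).trans
      (mul_le_mul_of_nonneg_left (lpn_subinterval hm (by norm_num) le_rfl) zero_le_two)
    filter_upwards [ae_vol_mem (1 / 2) 1] with t ht
    rw [norm_smul, Real.norm_of_nonneg (by linarith [ht.1]), ← mul_assoc]
    have h4 : 1 ≤ 2 * t := by linarith [ht.1]
    nlinarith [norm_nonneg x]
  rw [lpn_const hp0 (by norm_num)] at h3
  have h4 : (1 / 2 : ℝ) ≤ (1 - 1 / 2 : ℝ) ^ (1 / p.toReal) := by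
    calc (1 / 2 : ℝ) = (1 / 2) ^ (1 : ℝ) := (Real.rpow_one _).symm
      _ ≤ (1 / 2) ^ (1 / p.toReal) := Real.rpow_le_rpow_of_exponent_ge (by norm_num) (by norm_num)
          (by rw [div_le_one (by linarith)]; exact hr.le)
      _ = _ := by norm_num
  have h5 := mul_le_mul_of_nonneg_left h4 (norm_nonneg x)
  have h6 := mul_le_mul_of_nonneg_left h2 hC0
  linarith

/-- Once `u'` is controlled in `L^q`, so are `J v`, its primitive, and `A₀ v = f - u'`; the graph
norm bound then controls `v` in `D`. -/
theorem lpn_sol_le_of_continuous (hp : 1 < p) (hp' : p ≠ ⊤)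
    (hq : 1 < q) (hq' : q ≠ ⊤) (hb : 0 < b) (hus : ∀ a b, a < b → US J (fun _ => A₀) p a b) :
    ∃ C, 0 ≤ C ∧ ∀ f v, Continuous f → Sol J (fun _ => A₀) p 0 b f 0 v →
      Sol J (fun _ => A₀) q 0 b f 0 v ∧ lpn q 0 b v ≤ C * lpn q 0 b f := by
  obtain ⟨C, hC0, hC⟩ := lpn_deriv_le_of_continuous hp hp' hq hq' hb hus
  obtain ⟨G, hG0, hG⟩ := exists_graph_norm_bound hp hp' (hus 0 1 one_pos)
  refine ⟨G * (b * C + (1 + C)), by positivity, fun f v hf hv => ?_⟩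
  obtain ⟨hgm, hgle⟩ := hC f v hf hv
  have hfm : MemLp f q (vol 0 b) := memLp_of_continuousOn hf.continuousOn
  set g := fun s => f s - A₀ (v s) with hg
  have hJv : (fun t => J (v t)) =ᵐ[vol 0 b] fun t => ∫ s in (0 : ℝ)..t, g s := by
    filter_upwards [hv.eq] with t ht
    rw [ht, zero_add]
  have hJm : MemLp (fun t => J (v t)) q (vol 0 b) :=
    (memLp_congr_ae hJv).2 (memLp_of_continuousOn (continuousOn_volt hq.le hgm))
  have hAv : (fun t => A₀ (v t)) = fun t => f t - g t := by
    funext t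
    simp [hg]
  have hAm : MemLp (fun t => A₀ (v t)) q (vol 0 b) := hAv ▸ hfm.sub hgm
  have hsum : MemLp (fun t => ‖J (v t)‖ + ‖A₀ (v t)‖) q (vol 0 b) := hJm.norm.add hAm.norm
  have hle : ∀ᵐ t ∂vol 0 b, ‖v t‖ ≤ G * ‖‖J (v t)‖ + ‖A₀ (v t)‖‖ := Eventually.of_forall fun t => by
    rw [Real.norm_of_nonneg (by positivity)]
    exact hG (v t)
  have hvm : MemLp v q (vol 0 b) := hsum.of_le_mul hv.memLp.1 hle
  refine ⟨⟨hvm, hv.eq⟩, ?_⟩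
  have h1 : lpn q 0 b (fun t => J (v t)) ≤ b * lpn q 0 b g := by
    rw [lpn_congr hJv]
    simpa using lpn_volt_le hq.le hb.le hgm
  have h2 : lpn q 0 b (fun t => A₀ (v t)) ≤ lpn q 0 b f + lpn q 0 b g := by
    rw [hAv]
    exact lpn_sub_le hq.le hfm hgm
  have h3 := lpn_le_mul hG0 hsum hle
  have h4 := lpn_add_le hq.le hJm.norm hAm.norm
  have h5 : ∀ φ : ℝ → X, lpn q 0 b (fun t => ‖φ t‖) = lpn q 0 b φ := fun φ => by
    rw [lpn, eLpNorm_norm, lpn]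
  rw [h5, h5] at h4
  calc lpn q 0 b v ≤ G * (b * lpn q 0 b g + (lpn q 0 b f + lpn q 0 b g)) :=
        h3.trans (mul_le_mul_of_nonneg_left (h4.trans (add_le_add h1 h2)) hG0)
    _ ≤ G * (b * (C * lpn q 0 b f) + (lpn q 0 b f + C * lpn q 0 b f)) := by gcongr
    _ = _ := by ring

/-- Continuous functions are dense in `L^q`, and on an interval they are also in `L^p`, so they have
solutions. The `L^q` estimate makes the solutions for approximating data a Cauchy sequence. -/
theorem exists_sol_exponent (hp : 1 < p) (hp' : p ≠ ⊤)
    (hq : 1 < q) (hq' : q ≠ ⊤) (hb : 0 < b) (hus : ∀ a b, a < b → US J (fun _ => A₀) p a b)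
    {f : ℝ → X} (hf : MemLp f q (vol 0 b)) : ∃ v, Sol J (fun _ => A₀) q 0 b f 0 v := by
  have : Fact (1 ≤ q) := ⟨hq.le⟩
  obtain ⟨C, hC0, hC⟩ := lpn_sol_le_of_continuous hp hp' hq hq' hb hus
  obtain ⟨T, hT⟩ := exists_mulOp (p := q) (FamBdd.const A₀ 0 b) (norm_nonneg _)
  obtain ⟨I, hI⟩ := exists_voltOp (X := X) (p := q) hb
  have hiff := sol_iff_of_ops (J := J) hb hT hI
  have happ : ∀ n : ℕ, ∃ φ : ℝ → X, Continuous φ ∧ MemLp φ q (vol 0 b) ∧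
      eLpNorm (f - φ) q (vol 0 b) ≤ (n : ℝ≥0∞)⁻¹ := fun n => by
    obtain ⟨φ, h1, h2⟩ := hf.exists_boundedContinuous_eLpNorm_sub_le hq' (ε := (n : ℝ≥0∞)⁻¹)
      (by simp)
    exact ⟨φ, φ.continuous, h2, h1⟩
  choose φ hφc hφm hφ using happ
  choose v hv using fun n => (hus 0 b hb).1 (φ n) (memLp_of_continuousOn (hφc n).continuousOn)
  have hvq : ∀ n, Sol J (fun _ => A₀) q 0 b (φ n) 0 (v n) := fun n => (hC _ _ (hφc n) (hv n)).1
  set F : ℕ → Lp X q (vol 0 b) := fun n => (hφm n).toLp _ with hF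
  set V : ℕ → Lp D q (vol 0 b) := fun n => (hvq n).memLp.toLp _ with hV
  have hFlim : Tendsto F atTop (𝓝 (hf.toLp f)) := by
    rw [Lp.tendsto_Lp_iff_tendsto_eLpNorm'']
    have h0 : Tendsto (fun n : ℕ => (n : ℝ≥0∞)⁻¹) atTop (𝓝 0) :=
      ENNReal.tendsto_inv_nat_nhds_zero
    refine tendsto_of_tendsto_of_tendsto_of_le_of_le tendsto_const_nhds h0 (fun _ => zero_le)
      fun n => ?_
    rw [eLpNorm_sub_comm]
    exact hφ n
  have hVF : ∀ n m, dist (V n) (V m) ≤ C * dist (F n) (F m) := by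
    intro n m
    have h1 := (hv n).sub hp.le (FamBdd.const A₀ 0 b) (memLp_of_continuousOn (hφc n).continuousOn)
      (memLp_of_continuousOn (hφc m).continuousOn) (hv m)
    rw [sub_zero] at h1
    have h2 := (hC _ _ ((hφc n).sub (hφc m)) h1).2
    rw [dist_eq_norm, dist_eq_norm, hV, hF]
    simp only
    rw [← MemLp.toLp_sub, ← MemLp.toLp_sub, lpn_toLp, lpn_toLp]
    exact h2
  have hVc : CauchySeq V := by
    have hFc := hFlim.cauchySeq
    rw [Metric.cauchySeq_iff] at hFc ⊢
    intro ε hε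
    obtain ⟨N, hN⟩ := hFc (ε / (C + 1)) (by positivity)
    refine ⟨N, fun m hm n hn => (hVF m n).trans_lt ?_⟩
    have h1 := hN m hm n hn
    rw [lt_div_iff₀ (by positivity)] at h1
    nlinarith [dist_nonneg (x := F m) (y := F n)]
  obtain ⟨W, hW⟩ := cauchySeq_tendsto_of_complete hVc
  have heq : ∀ n, J.compLpL q (vol 0 b) (V n) = I (F n - T (V n)) := fun n =>
    (hiff (F n) (V n)).1 ((hvq n).congr (hφm n).coeFn_toLp.symm (hvq n).memLp.coeFn_toLp.symm)
  have hlim : J.compLpL q (vol 0 b) W = I (hf.toLp f - T W) := by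
    refine tendsto_nhds_unique (f := fun n => J.compLpL q (vol 0 b) (V n)) (l := atTop)
      (((J.compLpL q (vol 0 b)).continuous.tendsto W).comp hW) ?_
    simp only [heq]
    exact (I.continuous.tendsto _).comp (hFlim.sub ((T.continuous.tendsto W).comp hW))
  exact ⟨W, ((hiff _ _).2 hlim).congr hf.coeFn_toLp (ae_eq_refl _)⟩

/-- The primitive of a homogeneous solution again solves the homogeneous problem and is continuous
into `D`. It thus lies in `L^p`, where uniqueness is known. -/
theorem unique_sol_exponent (hq : 1 < q) (hus : US J (fun _ => A₀) p 0 b)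
    {v : ℝ → D} (hv : Sol J (fun _ => A₀) q 0 b (fun _ => 0) 0 v) : v =ᵐ[vol 0 b] 0 := by
  set V : ℝ → D := fun t => ∫ s in (0 : ℝ)..t, v s with hV
  have hVc : ContinuousOn V (Icc 0 b) := continuousOn_volt hq.le hv.memLp
  have hs : Sol J (fun _ => A₀) p 0 b (fun _ => 0) 0 V := by
    refine ⟨memLp_of_continuousOn hVc, ?_⟩
    filter_upwards [ae_vol_mem 0 b] with t ht
    have h0 : (0 : ℝ) ∈ Icc 0 b := ⟨le_rfl, (ht.1.trans ht.2).le⟩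
    rw [hV, map_volt_comm J hq.le hv.memLp h0 (Ioo_subset_Icc_self ht), zero_add]
    refine volt_congr ?_ h0 (Ioo_subset_Icc_self ht)
    filter_upwards [hv.eq, ae_vol_mem 0 b] with s hs hmem
    rw [hs, map_volt_comm A₀ hq.le hv.memLp h0 (Ioo_subset_Icc_self hmem)]
    simp
  exact ae_eq_zero_of_volt_eq_zero hq.le hv.memLp (hus.2 V hs)

/-- Maximal regularity of a single operator does not depend on the exponent. -/
theorem US.change_exponent (hp : 1 < p) (hp' : p ≠ ⊤) (hq : 1 < q) (hq' : q ≠ ⊤)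
    (hus : ∀ a b, a < b → US J (fun _ => A₀) p a b) {a b : ℝ} (hab : a < b) :
    US J (fun _ => A₀) q a b := by
  have h0 : 0 < b - a := sub_pos.2 hab
  have h1 : US J (fun _ => A₀) q 0 (b - a) :=
    ⟨fun f hf => exists_sol_exponent hp hp' hq hq' h0 hus hf,
      fun v hv => unique_sol_exponent hq (hus _ _ h0) hv⟩
  have h2 := h1.translate a
  rwa [zero_add, sub_add_cancel] at h2

end Exponents

/-! ### Gluing, freezing the time, and maximal regularity of the unperturbed family -/

section Family

variable {X : Type*} [NormedAddCommGroup X] [NormedSpace ℝ X]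
variable {D : Type*} [NormedAddCommGroup D] [NormedSpace ℝ D]
variable {J : D →L[ℝ] X} {A : ℝ → D →L[ℝ] X} {q : ℝ≥0∞} {a b c₀ m M τ : ℝ} {f : ℝ → X}

/-- Subtracting the constant function `x` reduces to zero initial value, with right-hand side `f -
A(·) x`. -/
theorem US.exists_sol_init (h : US J A q a b) (hA : FamBdd A a b M)
    (hf : MemLp f q (vol a b)) (x : D) : ∃ v, Sol J A q a b f (J x) v := by
  have hx : MemLp (fun _ : ℝ => x) q (vol a b) := memLp_const x
  have hAx := hA.memLp hx
  obtain ⟨w, hw⟩ := h.1 _ (hf.sub hAx)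
  refine ⟨fun t => x + w t, hx.add hw.memLp, ?_⟩
  filter_upwards [hw.eq] with t ht
  rw [map_add, ht, zero_add]
  congr 1
  refine intervalIntegral.integral_congr fun s _ => ?_
  simp only [Pi.sub_apply, map_add]
  abel

/-- Solutions on overlapping intervals can be glued. -/
theorem US.glue (hq : 1 ≤ q) (hA : FamBdd A a b M) (ham : a < m) (hmb : m ≤ b)
    (h1 : US J A q a m) (hc : ∀ c, a < c → c < m → c₀ < c → US J A q c b) (hc₀ : c₀ < m) :
    US J A q a b := by
  have hmax : max a c₀ < m := max_lt ham hc₀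
  refine ⟨fun f hf => ?_, fun v hv => ?_⟩
  · obtain ⟨v, hv⟩ := h1.1 f (memLp_subinterval hf le_rfl hmb)
    -- The problem can only be restarted from values in the range of `J`. Almost every `c` in the
    -- overlap qualifies, since there the integral formula has value `J (v c)`.
    obtain ⟨c, hcm, hcv⟩ : ∃ c ∈ Ioo (max a c₀) m,
        J (v c) = 0 + ∫ s in a..c, (f s - A s (v s)) := by
      by_contra! hcon
      have hae := ae_vol_mono (le_max_left a c₀) le_rfl hv.eq
      have hfalse : ∀ᵐ t ∂vol (max a c₀) m, False := by
        filter_upwards [hae, ae_vol_mem (max a c₀) m] with t h1 h2 using hcon t h2 h1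
      rw [ae_vol_iff, ae_iff] at hfalse
      simp only [imp_false, not_not, Set.ofPred_mem_eq, Real.volume_Ioo, ENNReal.ofReal_eq_zero]
        at hfalse
      linarith
    have hac : a < c := (le_max_left _ _).trans_lt hcm.1
    have hcb : c < b := hcm.2.trans_le hmb
    obtain ⟨w, hw⟩ := (hc c hac hcm.2 ((le_max_right _ _).trans_lt hcm.1)).exists_sol_init
      (hA.mono hac.le le_rfl) (memLp_subinterval hf hac.le le_rfl) (v c)
    rw [hcv] at hw
    exact ⟨_, (hv.restrict_right hcm.2.le).concat hq hA hf hac.le hcb.le hw⟩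
  · have hz : ∀ a b : ℝ, MemLp (fun _ : ℝ => (0 : X)) q (vol a b) := fun a b => MemLp.zero
    have h2 := h1.2 v (hv.restrict_right hmb)
    obtain ⟨c, hcm⟩ := exists_between hmax
    have hac : a < c := (le_max_left _ _).trans_lt hcm.1
    have h3 := hv.restrict hq hA (hz _ _) (c := c) (d := b) hac.le (hcm.2.le.trans hmb) le_rfl
    have h4 : ∫ s in a..c, ((0 : X) - A s (v s)) = 0 := by
      rw [volt_congr (a := a) (b := m) (g := fun _ => 0) ?_ ⟨le_rfl, ham.le⟩ ⟨hac.le, hcm.2.le⟩]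
      · simp
      · filter_upwards [h2] with s hs
        simp [hs]
    rw [h4, add_zero] at h3
    have h5 := (hc c hac hcm.2 ((le_max_right _ _).trans_lt hcm.1)).2 v h3
    refine ae_vol_union (c := c) (ae_vol_mono le_rfl hcm.2.le h2) h5

/-- The interval grows by `δ / 2` at a time, so that the next piece of length at most `δ` overlaps
the part already solved, as gluing requires. -/
theorem US.of_local (hq : 1 ≤ q) (hA : FamBdd A 0 τ M) {δ : ℝ} (hδ : 0 < δ)
    (h : ∀ a b, 0 ≤ a → a < b → b ≤ τ → b - a ≤ δ → US J A q a b) (ha : 0 ≤ a) (hab : a < b)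
    (hb : b ≤ τ) : US J A q a b := by
  have key : ∀ n : ℕ, ∀ b, a < b → b ≤ τ → b - a ≤ (n + 1) * (δ / 2) → US J A q a b := by
    intro n
    induction n with
    | zero => exact fun b hab hb hle => h a b ha hab hb (by norm_num at hle; linarith)
    | succ n ih =>
      intro b hab hb hle
      push_cast at hle
      by_cases hn : b - a ≤ (n + 1) * (δ / 2)
      · exact ih b hab hb hn
      · have hnn : (0 : ℝ) ≤ n := n.cast_nonneg
        have h1 : a < b - δ / 2 := by nlinarith
        refine US.glue (c₀ := b - δ) hq (hA.mono ha hb) h1 (by linarith)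
          (ih _ h1 (by linarith) (by linarith)) (fun c hac hcm hc => ?_) (by linarith)
        exact h c b (by linarith) (by linarith) hb (by linarith)
  obtain ⟨n, hn⟩ := exists_nat_ge ((b - a) / (δ / 2))
  refine key n b hab hb ?_
  rw [div_le_iff₀ (by positivity)] at hn
  linarith

variable [CompleteSpace X] [CompleteSpace D]

/-- Solvability near a time at which the family is frozen. -/
theorem US.near (hq : 1 < q) (hτ : 0 < τ) (hA : FamBdd A 0 τ M) {w : ℝ → ℝ} {η : ℝ}
    (hη : 0 ≤ η) (hw : ContinuousOn w (Icc 0 τ)) (hw0 : w 0 = 0) {t₀ : ℝ} (ht₀ : t₀ ∈ Icc 0 τ)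
    (hdini : ∀ x : D, ∀ t ∈ Icc 0 τ, ‖A t x - A t₀ x‖ ≤ w |t - t₀| * ‖x‖ + η * ‖J x‖)
    (h : ∀ a b, a < b → US J (fun _ => A t₀) q a b) :
    ∃ δ > 0, ∀ a b, 0 ≤ a → a < b → b ≤ τ → Icc a b ⊆ Metric.ball t₀ δ → US J A q a b := by
  obtain ⟨C, hC0, hC⟩ := exists_bound_uniform hq.le hτ h
  obtain ⟨K, hK0, hK⟩ := exists_aPriori hq.le hτ h
  -- `ε` and `δ₂` make the contributions of `ε ‖v‖` and `η ‖J v‖` at most a quarter of the norm of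
  -- `f` each. The second is small because `J v` is a primitive, which gains the length `b - a ≤ 2
  -- δ₂`.
  set ε := 1 / (4 * (C + 1)) with hε
  have hε0 : 0 < ε := by positivity
  obtain ⟨δ₁, hδ₁, hwδ⟩ := Metric.continuousOn_iff.1 hw 0 ⟨le_rfl, hτ.le⟩ ε hε0
  set δ₂ := 1 / (8 * ((η + 1) * (K + 1))) with hδ₂
  have hδ₂0 : 0 < δ₂ := by positivity
  refine ⟨min δ₁ δ₂, lt_min hδ₁ hδ₂0, fun a b ha hab hb hsub => ?_⟩
  have hB : FamBdd (fun t => A t - A t₀) a b (|M| + ‖A t₀‖) :=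
    ⟨fun x => ((hA.mono ha hb).meas x).sub aestronglyMeasurable_const, fun t ht =>
      (norm_sub_le _ _).trans (by
        gcongr
        exact ((hA.mono ha hb).bound t ht).trans (le_abs_self M))⟩
  have hlen : b - a ≤ 2 * δ₂ := by
    have h1 := hsub ⟨le_rfl, hab.le⟩
    have h2 := hsub ⟨hab.le, le_rfl⟩
    rw [Metric.mem_ball, Real.dist_eq, abs_lt] at h1 h2
    have := min_le_right δ₁ δ₂
    linarith
  have hper := US.perturb hq.le (h a b hab) hab (FamBdd.const (A t₀) a b) (norm_nonneg _) hB
    (by positivity) (κ := 1 / 2) (by norm_num) fun f v hf hv => ?_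
  · exact hper.congr_family fun t _ => add_sub_cancel _ _
  have hv1 := hC a b hab (by linarith) f v hf hv
  have hg := hv.memLp_rhs (FamBdd.const (A t₀) a b) hf
  have hJv : (fun t => J (v t)) =ᵐ[vol a b] fun t => ∫ s in a..t, (f s - A t₀ (v s)) := by
    filter_upwards [hv.eq] with t ht
    rw [ht, zero_add]
  have hJm : MemLp (fun t => J (v t)) q (vol a b) := (FamBdd.const J a b).memLp hv.memLp
  have hJ1 : lpn q a b (fun t => J (v t)) ≤ (b - a) * (K * lpn q a b f) := by
    rw [lpn_congr hJv]
    refine (lpn_volt_le hq.le hab.le hg).trans ?_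
    exact mul_le_mul_of_nonneg_left (hK a b hab (by linarith) f v hf hv) (by linarith)
  have hsum : MemLp (fun t => ε * ‖v t‖ + η * ‖J (v t)‖) q (vol a b) :=
    (hv.memLp.norm.const_mul ε).add (hJm.norm.const_mul η)
  have h1 : lpn q a b (fun t => (A t - A t₀) (v t)) ≤
      1 * lpn q a b (fun t => ε * ‖v t‖ + η * ‖J (v t)‖) := by
    refine lpn_le_mul zero_le_one hsum ?_
    filter_upwards [ae_vol_mem a b] with t ht
    have ht' : t ∈ Icc 0 τ := ⟨ha.trans ht.1.le, ht.2.le.trans hb⟩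
    rw [one_mul, Real.norm_of_nonneg (by positivity), sub_apply]
    refine (hdini (v t) t ht').trans ?_
    have h1 := hsub (Ioo_subset_Icc_self ht)
    rw [Metric.mem_ball, Real.dist_eq] at h1
    have h2 : |t - t₀| ∈ Icc 0 τ := ⟨abs_nonneg _, abs_le.2
      ⟨by linarith [ht'.1, ht₀.2], by linarith [ht'.2, ht₀.1]⟩⟩
    have h3 := hwδ _ h2 (by
      rw [Real.dist_eq, sub_zero, abs_abs]
      exact h1.trans_le (min_le_left _ _))
    rw [hw0, Real.dist_eq, sub_zero] at h3
    have h4 := (le_abs_self _).trans h3.le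
    gcongr
  have h2 := lpn_add_le hq.le (hv.memLp.norm.const_mul ε) (hJm.norm.const_mul η)
  have h3 : lpn q a b (fun t => ε * ‖v t‖) ≤ ε * lpn q a b v :=
    lpn_le_mul hε0.le hv.memLp (Eventually.of_forall fun t => by
      rw [Real.norm_of_nonneg (by positivity)])
  have h4 : lpn q a b (fun t => η * ‖J (v t)‖) ≤ η * lpn q a b (fun t => J (v t)) :=
    lpn_le_mul hη hJm (Eventually.of_forall fun t => by
      rw [Real.norm_of_nonneg (by positivity)])
  have hf0 := lpn_nonneg q a b f
  have h5 : ε * C ≤ 1 / 4 := by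
    rw [hε, div_mul_eq_mul_div, one_mul, div_le_div_iff₀ (by positivity) (by norm_num)]
    linarith
  have h6 : η * ((b - a) * K) ≤ 1 / 4 := by
    have h7 : (η + 1) * ((2 * δ₂) * (K + 1)) = 1 / 4 := by
      rw [hδ₂]; field_simp; norm_num
    have h8 : 0 ≤ b - a := by linarith
    calc η * ((b - a) * K) ≤ (η + 1) * ((2 * δ₂) * (K + 1)) := by
          gcongr <;> linarith
      _ = 1 / 4 := h7
  calc lpn q a b (fun t => (A t - A t₀) (v t))
      ≤ ε * (C * lpn q a b f) + η * ((b - a) * (K * lpn q a b f)) := by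
        rw [one_mul] at h1
        refine h1.trans (h2.trans (add_le_add (h3.trans ?_) (h4.trans ?_)))
        · exact mul_le_mul_of_nonneg_left hv1 hε0.le
        · exact mul_le_mul_of_nonneg_left hJ1 hη
    _ = (ε * C + η * ((b - a) * K)) * lpn q a b f := by ring
    _ ≤ 1 / 2 * lpn q a b f := by
        gcongr
        linarith

/-- Maximal regularity of relatively continuous families. -/
theorem US.of_relatively_continuous (hq : 1 < q) (hτ : 0 < τ) (hA : FamBdd A 0 τ M) {w : ℝ → ℝ}
    {η : ℝ} (hη : 0 ≤ η) (hw : ContinuousOn w (Icc 0 τ)) (hw0 : w 0 = 0)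
    (hdini : ∀ x : D, ∀ s ∈ Icc 0 τ, ∀ t ∈ Icc 0 τ,
      ‖A t x - A s x‖ ≤ w |t - s| * ‖x‖ + η * ‖J x‖)
    (h : ∀ t ∈ Icc 0 τ, ∀ a b, a < b → US J (fun _ => A t) q a b) (ha : 0 ≤ a) (hab : a < b)
    (hb : b ≤ τ) : US J A q a b := by
  choose! δ hδ0 hδ using fun t₀ (ht₀ : t₀ ∈ Icc 0 τ) =>
    US.near hq hτ hA hη hw hw0 ht₀ (fun x t ht => hdini x t₀ ht₀ t ht) (h t₀ ht₀)
  obtain ⟨ρ, hρ, hcov⟩ := lebesgue_number_lemma_of_metric (s := Icc 0 τ)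
    (c := fun t : Icc (0 : ℝ) τ => Metric.ball (t : ℝ) (δ t)) isCompact_Icc
    (fun _ => Metric.isOpen_ball)
    (fun t ht => mem_iUnion.2 ⟨⟨t, ht⟩, Metric.mem_ball_self (hδ0 t ht)⟩)
  refine US.of_local hq.le hA (half_pos hρ) (fun a b ha hab hb hle => ?_) ha hab hb
  obtain ⟨⟨t₀, ht₀⟩, hsub⟩ := hcov a ⟨ha, hab.le.trans hb⟩
  refine hδ t₀ ht₀ a b ha hab hb fun t ht => hsub ?_
  rw [Metric.mem_ball, Real.dist_eq, abs_lt]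
  constructor <;> linarith [ht.1, ht.2]

end Family

/-! ### Riemann sums -/

section Riemann

theorem norm_riemann_sub_le {E : Type*} [NormedAddCommGroup E] [NormedSpace ℝ E] [CompleteSpace E]
    {ψ : ℝ → E} (hψ : Continuous ψ) {a h ε : ℝ} (hh : 0 ≤ h) {n : ℕ}
    (hε : ∀ i < n, ∀ t ∈ Icc (a + i * h) (a + (i + 1 : ℕ) * h), ‖ψ (a + i * h) - ψ t‖ ≤ ε) :
    ‖∑ i ∈ Finset.range n, h • ψ (a + i * h) - ∫ t in a..(a + n * h), ψ t‖ ≤ n * (h * ε) := by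
  have h0 : a = a + (0 : ℕ) * h := by simp
  have hi : ∀ s t : ℝ, IntervalIntegrable ψ volume s t := fun s t => hψ.intervalIntegrable s t
  have h1 : ∫ t in a..(a + n * h), ψ t =
      ∑ i ∈ Finset.range n, ∫ t in (a + i * h)..(a + (i + 1 : ℕ) * h), ψ t := by
    rw [intervalIntegral.sum_integral_adjacent_intervals (a := fun i : ℕ => a + i * h)
      fun i _ => hi _ _, ← h0]
  rw [h1, ← Finset.sum_sub_distrib]
  refine (norm_sum_le_of_le _ (n := fun _ => h * ε) fun i hin => ?_).trans (by simp)
  have h2 : a + (i + 1 : ℕ) * h - (a + i * h) = h := by push_cast; ring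
  have h3 : h • ψ (a + i * h) = ∫ t in (a + i * h)..(a + (i + 1 : ℕ) * h), ψ (a + i * h) := by
    rw [intervalIntegral.integral_const, h2]
  rw [h3, ← intervalIntegral.integral_sub (intervalIntegrable_const) (hi _ _)]
  refine (intervalIntegral.norm_integral_le_of_norm_le_const (C := ε) fun t ht => ?_).trans ?_
  · rw [uIoc_of_le (by linarith)] at ht
    exact hε i (Finset.mem_range.1 hin) t (Ioc_subset_Icc_self ht)
  · rw [h2, abs_of_nonneg hh, mul_comm]

theorem exists_uniform_mesh {E : Type*} [NormedAddCommGroup E] {ψ : ℝ → E} (hψ : Continuous ψ)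
    {a b ε : ℝ} (hab : a < b) (hε : 0 < ε) : ∃ (n : ℕ) (h : ℝ), 0 < h ∧ h ≤ ε ∧ a + n * h = b ∧
      ∀ i < n, ∀ t ∈ Icc (a + i * h) (a + (i + 1 : ℕ) * h), ‖ψ (a + i * h) - ψ t‖ ≤ ε := by
  obtain ⟨δ, hδ, H⟩ := Metric.uniformContinuousOn_iff.1
    (isCompact_Icc.uniformContinuousOn_of_continuous (hψ.continuousOn (s := Icc a b))) ε hε
  have hba : 0 < b - a := sub_pos.2 hab
  obtain ⟨n, hn⟩ := exists_nat_gt ((b - a) / min δ ε)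
  have hm : 0 < min δ ε := lt_min hδ hε
  have hn0 : (0 : ℝ) < n := (by positivity : 0 < (b - a) / min δ ε).trans hn
  rw [div_lt_iff₀ hm] at hn
  have hlt : (b - a) / n < min δ ε := by
    rw [div_lt_iff₀ hn0]
    linarith
  have hh : 0 < (b - a) / n := by positivity
  have hnb : n * ((b - a) / n) = b - a := by field_simp
  refine ⟨n, (b - a) / n, hh, hlt.le.trans (min_le_right _ _), by rw [hnb]; ring,
    fun i hi t ht => ?_⟩
  obtain ⟨h1, h2, h3, h4⟩ := cell_mem hh hi
  rw [hnb] at h1 h2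
  rw [← dist_eq_norm]
  refine (H _ ⟨by linarith [h1.1], by linarith [h1.2]⟩ t
    ⟨by linarith [h1.1, ht.1], by linarith [h2.2, ht.2]⟩ ?_).le
  rw [Real.dist_eq, abs_lt]
  have := min_le_left δ ε
  constructor <;> linarith [ht.1, ht.2]

theorem lpn_sum_le {E ι : Type*} [NormedAddCommGroup E] {p : ℝ≥0∞} (hp : 1 ≤ p) {a b : ℝ}
    (s : Finset ι) {f : ι → ℝ → E} (hf : ∀ i ∈ s, MemLp (f i) p (vol a b)) :
    lpn p a b (fun t => ∑ i ∈ s, f i t) ≤ ∑ i ∈ s, lpn p a b (f i) := by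
  classical
  induction s using Finset.induction_on with
  | empty => simp [lpn]
  | insert i s hi ih =>
    simp only [Finset.sum_insert hi]
    have h1 : ∀ j ∈ s, MemLp (f j) p (vol a b) := fun j hj => hf j (Finset.mem_insert_of_mem hj)
    exact (lpn_add_le hp (hf i (Finset.mem_insert_self i s)) (memLp_finsetSum s h1)).trans
      (by linarith [ih h1])

/-- The left-endpoint sums up to time `t` are uniformly close to the primitive. -/
theorem norm_jump_sum_sub_le {E : Type*} [NormedAddCommGroup E] [NormedSpace ℝ E] [CompleteSpace E]
    {ψ : ℝ → E} (hψ : Continuous ψ) {a b h ε C : ℝ} (hh : 0 < h) (hε : 0 ≤ ε) {n : ℕ}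
    (hnb : a + n * h = b)
    (hψε : ∀ i < n, ∀ t ∈ Icc (a + i * h) (a + (i + 1 : ℕ) * h), ‖ψ (a + i * h) - ψ t‖ ≤ ε)
    (hC : ∀ t ∈ Icc a b, ‖ψ t‖ ≤ C) {t : ℝ} (ht : t ∈ Ioo a b) :
    ‖(∑ i ∈ Finset.range n, if t ≤ a + i * h then 0 else h • ψ (a + i * h)) - ∫ s in a..t, ψ s‖ ≤
      (b - a) * ε + C * h := by
  have hta : 0 < (t - a) / h := div_pos (by linarith [ht.1]) hh
  -- `k + 1 = ⌈(t - a) / h⌉` counts the nodes strictly before `t`. The sum over them approximates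
  -- the integral up to the node of index `k + 1`, which exceeds `t` by at most `h`.
  obtain ⟨k, hk⟩ := Nat.exists_eq_succ_of_ne_zero (Nat.ceil_pos.2 hta).ne'
  have h1 := Nat.le_ceil ((t - a) / h)
  have h2 := Nat.ceil_lt_add_one hta.le
  rw [hk] at h1 h2
  rw [div_le_iff₀ hh] at h1
  push_cast at h1 h2
  have h2' : (k : ℝ) * h < t - a := by
    rw [← lt_div_iff₀ hh]
    linarith
  have hkn : k < n := by
    have : (k : ℝ) * h < n * h := by linarith [ht.2]
    exact_mod_cast lt_of_mul_lt_mul_right this hh.le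
  have hkn' : ((k + 1 : ℕ) : ℝ) ≤ n := by exact_mod_cast hkn
  have hknh : ((k + 1 : ℕ) : ℝ) * h ≤ n * h := by gcongr
  have hsum : (∑ i ∈ Finset.range n, if t ≤ a + i * h then 0 else h • ψ (a + i * h)) =
      ∑ i ∈ Finset.range (k + 1), h • ψ (a + i * h) := by
    rw [← Finset.sum_subset (Finset.range_mono (show k + 1 ≤ n by omega))]
    · refine Finset.sum_congr rfl fun i hi => if_neg ?_
      have : (i : ℝ) ≤ k := by exact_mod_cast Nat.lt_succ_iff.1 (Finset.mem_range.1 hi)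
      have : (i : ℝ) * h ≤ k * h := by gcongr
      linarith
    · intro i _ hi
      refine if_pos ?_
      have : ((k + 1 : ℕ) : ℝ) ≤ i := by
        exact_mod_cast not_lt.1 fun h' => hi (Finset.mem_range.2 h')
      have : ((k + 1 : ℕ) : ℝ) * h ≤ i * h := by gcongr
      push_cast at this
      linarith
  have hi : ∀ s t : ℝ, IntervalIntegrable ψ volume s t := fun s t => hψ.intervalIntegrable s t
  have h3 := norm_riemann_sub_le hψ hh.le (n := k + 1) fun i hi => hψε i (by omega)
  have h4 : ‖∫ s in t..(a + (k + 1 : ℕ) * h), ψ s‖ ≤ C * h := by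
    refine (intervalIntegral.norm_integral_le_of_norm_le_const (C := C) fun s hs => ?_).trans ?_
    · rw [uIoc_of_le (by push_cast; linarith)] at hs
      exact hC s ⟨by linarith [ht.1, hs.1], by linarith [hs.2]⟩
    · have hC0 : 0 ≤ C := (norm_nonneg _).trans (hC t (Ioo_subset_Icc_self ht))
      gcongr
      rw [abs_of_nonneg (by push_cast; linarith)]
      push_cast
      linarith
  have h5 := intervalIntegral.integral_add_adjacent_intervals (hi a t) (hi t (a + (k + 1 : ℕ) * h))
  rw [hsum, show ∑ i ∈ Finset.range (k + 1), h • ψ (a + i * h) - ∫ s in a..t, ψ s =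
    (∑ i ∈ Finset.range (k + 1), h • ψ (a + i * h) - ∫ s in a..(a + (k + 1 : ℕ) * h), ψ s) +
      ∫ s in t..(a + (k + 1 : ℕ) * h), ψ s by rw [← h5]; abel]
  refine (norm_add_le _ _).trans (add_le_add (h3.trans ?_) h4)
  rw [← mul_assoc]
  gcongr
  linarith

end Riemann

/-! ### Duhamel's formula by Riemann sums -/

section Evolution

variable {X : Type*} [NormedAddCommGroup X] [NormedSpace ℝ X] [CompleteSpace X]
variable {D : Type*} [NormedAddCommGroup D] [NormedSpace ℝ D] [CompleteSpace D]
variable {J : D →L[ℝ] X} {A P : ℝ → D →L[ℝ] X} {q : ℝ≥0∞} {a b L M N : ℝ}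

/-- A bound for the evolution family gives a bound for the inhomogeneous problem. -/
theorem lpn_perturbation_le_of_continuous (hq : 1 ≤ q) (hab : a < b)
    (hA : FamBdd A a b M) (hM : 0 ≤ M) (hP : FamBdd P a b N) (hN : 0 ≤ N) (hus : US J A q a b)
    (hL : 0 ≤ L) {U : ℝ → D → ℝ → D}
    (hU : ∀ s, a ≤ s → s < b → ∀ x, Sol J A q s b (fun _ => 0) (J x) (U s x))
    (hPU : ∀ s, a ≤ s → s < b → ∀ x, lpn q s b (fun t => P t (U s x t)) ≤ L * ‖J x‖)
    {φ : ℝ → D} (hφ : Continuous φ) {v : ℝ → D} (hv : Sol J A q a b (fun t => J (φ t)) 0 v) :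
    lpn q a b (fun t => P t (v t)) ≤ L * ∫ t in a..b, ‖J (φ t)‖ := by
  obtain ⟨C, hC0, hC⟩ := hus.exists_bound hq hab hA hM
  obtain ⟨R, hR⟩ := (isCompact_Icc (a := a) (b := b)).exists_bound_of_continuousOn hφ.continuousOn
  have hba : 0 < b - a := sub_pos.2 hab
  have hR0 : 0 ≤ R := (norm_nonneg _).trans (hR a ⟨le_rfl, hab.le⟩)
  set c := L * ((b - a) * ‖J‖) +
    (N * (C * M + 1)) * (((b - a) + R) * (b - a) ^ (1 / q.toReal)) with hc
  -- `v` is compared with the Riemann sum `V` of Duhamel's integral. The estimate for `P V` is the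
  -- hypothesis on the evolution family; `P (V - v)` is small by maximal regularity.
  have key : ∀ ε > 0, lpn q a b (fun t => P t (v t)) ≤ L * (∫ t in a..b, ‖J (φ t)‖) + c * ε := by
    intro ε hε
    obtain ⟨n, h, hh, hhε, hnb, hosc⟩ := exists_uniform_mesh hφ hab hε
    have hri : ∀ i < n, a ≤ a + i * h ∧ a + i * h < b := fun i hi => by
      have : (i : ℝ) < n := by exact_mod_cast hi
      have : (i : ℝ) * h < n * h := by gcongr
      exact ⟨by have : 0 ≤ (i : ℝ) * h := by positivity
                linarith, by linarith⟩
    have hJφ : Continuous fun t => J (φ t) := J.continuous.comp hφ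
    set W : ℝ → D := fun t => ∫ s in a..t, φ s with hW
    have hφm : MemLp φ q (vol a b) := memLp_of_continuousOn hφ.continuousOn
    have hWm : MemLp W q (vol a b) := memLp_of_continuousOn (continuousOn_volt hq hφm)
    set σ : ℝ → D := fun t => ∑ i ∈ Finset.range n,
      if t ≤ a + i * h then 0 else h • φ (a + i * h) with hσ
    -- Each summand of `V` jumps at its node by `h φ(t_i)`. Removing the jump, collected in `σ`,
    -- leaves a solution with zero initial value and right-hand side `-A(·)` applied to the jump
    -- function.
    set d : ℕ → ℝ → D := fun i t => if t ≤ a + i * h then 0 else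
      h • U (a + i * h) (φ (a + i * h)) t - h • φ (a + i * h) with hd
    have hcst : ∀ (y : D) a b, MemLp (fun _ : ℝ => y) q (vol a b) := fun y a b => memLp_const y
    have hite : ∀ (i : ℕ) (y : D), MemLp (fun t => if t ≤ a + i * h then 0 else y) q (vol a b) := by
      intro i y
      have e0 : (fun t => if t ≤ a + i * h then 0 else y) =
          (Ioi (a + i * h)).indicator fun _ => y := by
        funext t
        by_cases ht : t ≤ a + i * h
        · rw [if_pos ht, indicator_of_notMem (s := Ioi (a + i * h)) (not_lt.2 ht)]
        · rw [if_neg ht, indicator_of_mem (s := Ioi (a + i * h)) (not_le.1 ht)]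
      rw [e0]
      exact (hcst _ _ _).indicator measurableSet_Ioi
    have hσm : MemLp σ q (vol a b) := memLp_finsetSum _ fun i _ => hite i _
    have hrhs : ∀ y : ℝ → D, MemLp y q (vol a b) → MemLp (fun t => -A t (y t)) q (vol a b) :=
      fun y hy => (hA.memLp hy).neg
    have hdsol : ∀ i ∈ Finset.range n, Sol J A q a b
        (fun t => -A t (if t ≤ a + i * h then 0 else h • φ (a + i * h))) 0 (d i) := by
      intro i hi
      obtain ⟨h1, h2⟩ := hri i (Finset.mem_range.1 hi)
      have hAi := hA.mono h1 le_rfl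
      have s1 := (hU _ h1 h2 (φ (a + i * h))).smul h
      have s2 : Sol J A q (a + i * h) b (fun t => -A t (h • φ (a + i * h))) 0
          (fun t => h • U (a + i * h) (φ (a + i * h)) t - h • φ (a + i * h)) := by
        refine ⟨s1.memLp.sub (hcst _ _ _), ?_⟩
        filter_upwards [s1.eq] with t ht
        rw [map_sub, ht, map_smul, add_sub_cancel_left, zero_add]
        refine intervalIntegral.integral_congr fun s _ => ?_
        simp only [map_sub, smul_zero]
        abel
      refine (s2.extend_left hq hA h1 h2.le (hAi.memLp (hcst _ _ _)).neg rfl).congr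
        (Eventually.of_forall fun t => ?_) (ae_eq_refl _)
      by_cases ht : t ≤ a + i * h <;> simp [ht]
    have hdsum := Sol.sum (Finset.range n) hq hA (fun i _ => hrhs _ (hite i _)) hdsol
    rw [Finset.sum_const_zero] at hdsum
    have hvW : Sol J A q a b (fun t => -A t (W t)) 0 (fun t => v t - W t) := by
      refine ⟨hv.memLp.sub hWm, ?_⟩
      filter_upwards [hv.eq, ae_vol_mem a b] with t ht hmem
      have h0 : a ∈ Icc a b := ⟨le_rfl, hab.le⟩
      have ht' := Ioo_subset_Icc_self hmem
      rw [map_sub, ht, hW, map_volt_comm J hq hφm h0 ht', zero_add, zero_add,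
        ← intervalIntegral.integral_sub]
      · refine intervalIntegral.integral_congr fun s _ => ?_
        simp only [map_sub]
        abel
      · exact intervalIntegrable_of_memLp hq (hv.memLp_rhs hA
          (memLp_of_continuousOn hJφ.continuousOn)) h0 ht'
      · exact hJφ.intervalIntegrable _ _
    have hz := hdsum.sub hq hA (memLp_finsetSum _ fun i _ => hrhs _ (hite i _)) (hrhs W hWm) hvW
    rw [sub_zero] at hz
    -- Likewise `v - W` solves the problem with right-hand side `-A W`, where `W` is the primitive
    -- of `φ`. So `z` solves it with right-hand side `-A (σ - W)`, and `σ - W` is uniformly small in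
    -- `D`.
    set z : ℝ → D := fun t => ∑ i ∈ Finset.range n, d i t - (v t - W t) with hzdef
    have hσW : MemLp (fun t => σ t - W t) q (vol a b) := hσm.sub hWm
    have hz' : Sol J A q a b (fun t => -A t (σ t - W t)) 0 z := by
      refine hz.congr (Eventually.of_forall fun t => ?_) (ae_eq_refl _)
      simp only [hσ, map_sub, map_sum, Finset.sum_neg_distrib]
      abel
    have hzle : lpn q a b z ≤ C * (M * lpn q a b (fun t => σ t - W t)) := by
      refine (hC _ _ (hrhs _ hσW) hz').trans (mul_le_mul_of_nonneg_left ?_ hC0)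
      refine lpn_le_mul hM hσW ?_
      filter_upwards [hA.ae_le fun t => σ t - W t] with t ht
      rwa [norm_neg]
    have hσle : lpn q a b (fun t => σ t - W t) ≤
        ((b - a) + R) * (b - a) ^ (1 / q.toReal) * ε := by
      refine (lpn_le_of_bound hab.le (M := ((b - a) + R) * ε) (by positivity) fun t ht => ?_).trans
        (le_of_eq (by ring))
      refine (norm_jump_sum_sub_le hφ hh hε.le hnb hosc hR ht).trans ?_
      rw [add_mul]
      gcongr
    have hPz : lpn q a b (fun t => P t (z t)) ≤ N * lpn q a b z :=
      lpn_le_mul hN hz.memLp (hP.ae_le z)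
    have hPσ : lpn q a b (fun t => P t (σ t - W t)) ≤ N * lpn q a b (fun t => σ t - W t) :=
      lpn_le_mul hN hσW (hP.ae_le _)
    set V : ℝ → D := fun t => ∑ i ∈ Finset.range n,
      if t ≤ a + i * h then 0 else h • U (a + i * h) (φ (a + i * h)) t with hV
    have hVi : ∀ i ∈ Finset.range n, (fun t => P t (if t ≤ a + i * h then 0 else
        h • U (a + i * h) (φ (a + i * h)) t)) =ᵐ[vol a b] (Ioo (a + i * h) b).indicator
        fun t => h • P t (U (a + i * h) (φ (a + i * h)) t) := by
      intro i hi
      filter_upwards [ae_vol_mem a b] with t ht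
      by_cases hti : t ≤ a + i * h
      · rw [if_pos hti, map_zero, indicator_of_notMem fun h' => not_lt.2 hti h'.1]
      · rw [if_neg hti, indicator_of_mem (s := Ioo (a + i * h) b) ⟨not_le.1 hti, ht.2⟩, map_smul]
    have hPi : ∀ i ∈ Finset.range n, MemLp (fun t => P t (if t ≤ a + i * h then 0 else
        h • U (a + i * h) (φ (a + i * h)) t)) q (vol a b) := by
      intro i hi
      obtain ⟨h1, h2⟩ := hri i (Finset.mem_range.1 hi)
      exact (memLp_congr_ae (hVi i hi)).2 (memLp_indicator_Ioo h1 le_rfl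
        (((hP.mono h1 le_rfl).memLp (hU _ h1 h2 _).memLp).const_smul h))
    -- The triangle inequality over the nodes, with (H2)-type bounds for each, gives `L` times a
    -- Riemann sum of `‖J φ‖`: Minkowski's inequality in discrete form.
    have hPV : lpn q a b (fun t => P t (V t)) ≤
        L * ((∫ t in a..b, ‖J (φ t)‖) + (b - a) * (‖J‖ * ε)) := by
      have e1 : (fun t => P t (V t)) = fun t => ∑ i ∈ Finset.range n,
          P t (if t ≤ a + i * h then 0 else h • U (a + i * h) (φ (a + i * h)) t) := by
        funext t
        rw [hV, map_sum]
      have e2 : ∀ i ∈ Finset.range n, lpn q a b (fun t => P t (if t ≤ a + i * h then 0 else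
          h • U (a + i * h) (φ (a + i * h)) t)) ≤ L * (h • ‖J (φ (a + i * h))‖) := by
        intro i hi
        obtain ⟨h1, h2⟩ := hri i (Finset.mem_range.1 hi)
        rw [lpn_congr (hVi i hi), lpn_indicator h1 le_rfl, lpn_smul, abs_of_nonneg hh.le]
        refine (mul_le_mul_of_nonneg_left (hPU _ h1 h2 _) hh.le).trans (le_of_eq ?_)
        rw [smul_eq_mul]
        ring
      rw [e1]
      refine (lpn_sum_le hq _ hPi).trans ((Finset.sum_le_sum e2).trans ?_)
      rw [← Finset.mul_sum]
      refine mul_le_mul_of_nonneg_left ?_ hL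
      have h3 := norm_riemann_sub_le (ψ := fun t => ‖J (φ t)‖) hJφ.norm hh.le (n := n)
        (ε := ‖J‖ * ε) fun i hi t ht => by
          refine (abs_norm_sub_norm_le _ _).trans ?_
          rw [← map_sub]
          exact (J.le_opNorm _).trans (mul_le_mul_of_nonneg_left (hosc i hi t ht) (norm_nonneg _))
      rw [hnb, Real.norm_eq_abs, ← mul_assoc, show n * h = b - a by linarith] at h3
      linarith [(abs_le.1 h3).2]
    have hdec : (fun t => P t (v t)) = fun t => P t (V t) - (P t (z t) + P t (σ t - W t)) := by
      funext t
      rw [← map_add, ← map_sub]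
      congr 1
      have : V t = ∑ i ∈ Finset.range n, d i t + σ t := by
        rw [hV, hσ, ← Finset.sum_add_distrib]
        refine Finset.sum_congr rfl fun i _ => ?_
        by_cases ht : t ≤ a + i * h <;> simp [hd, ht]
      rw [this]
      simp only [hzdef]
      abel
    have hPVm : MemLp (fun t => P t (V t)) q (vol a b) := by
      have e1 : (fun t => P t (V t)) = fun t => ∑ i ∈ Finset.range n,
          P t (if t ≤ a + i * h then 0 else h • U (a + i * h) (φ (a + i * h)) t) := by
        funext t
        rw [hV, map_sum]
      rw [e1]
      exact memLp_finsetSum _ hPi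
    have hPzm := hP.memLp hz.memLp
    have hPσm := hP.memLp hσW
    have hN1 := mul_le_mul_of_nonneg_left hzle hN
    have hfin := lpn_sub_le hq hPVm (hPzm.add hPσm)
    have hfin2 := lpn_add_le hq hPzm hPσm
    rw [hdec]
    calc _ ≤ _ := hfin
      _ ≤ L * ((∫ t in a..b, ‖J (φ t)‖) + (b - a) * (‖J‖ * ε)) +
          (N * (C * (M * lpn q a b (fun t => σ t - W t))) + N * lpn q a b (fun t => σ t - W t)) :=
        add_le_add hPV (hfin2.trans (add_le_add (hPz.trans hN1) hPσ))
      _ = L * (∫ t in a..b, ‖J (φ t)‖) + L * ((b - a) * ‖J‖) * ε +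
          (N * (C * M + 1)) * lpn q a b (fun t => σ t - W t) := by ring
      _ ≤ L * (∫ t in a..b, ‖J (φ t)‖) + L * ((b - a) * ‖J‖) * ε +
          (N * (C * M + 1)) * (((b - a) + R) * (b - a) ^ (1 / q.toReal) * ε) := by gcongr
      _ = _ := by rw [hc]; ring
  have hlim : Tendsto (fun ε : ℝ => L * (∫ t in a..b, ‖J (φ t)‖) + c * ε) (𝓝[>] 0)
      (𝓝 (L * (∫ t in a..b, ‖J (φ t)‖) + c * 0)) :=
    ((by fun_prop : Continuous fun ε : ℝ => L * (∫ t in a..b, ‖J (φ t)‖) + c * ε).tendsto 0).mono_left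
      nhdsWithin_le_nhds
  rw [mul_zero, add_zero] at hlim
  refine ge_of_tendsto hlim ?_
  filter_upwards [self_mem_nhdsWithin] with ε hε using key ε hε

end Evolution

/-! ### Density and the perturbation theorem -/

section Perturbation

variable {X : Type*} [NormedAddCommGroup X] [NormedSpace ℝ X]
variable {D : Type*} [NormedAddCommGroup D] [NormedSpace ℝ D]
variable {J : D →L[ℝ] X} {A P : ℝ → D →L[ℝ] X} {p q : ℝ≥0∞} {a b c L M N τ : ℝ} {f : ℝ → X}

/-- A partition of unity patches locally constant choices, because the preimage under `J` of a ball
is convex; density of the range makes it nonempty. -/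
theorem exists_continuous_lift (hJ : DenseRange J) {g : ℝ → X} (hg : Continuous g) {ε : ℝ}
    (hε : 0 < ε) : ∃ φ : ℝ → D, Continuous φ ∧ ∀ t, ‖g t - J (φ t)‖ ≤ ε := by
  obtain ⟨φ, hφ⟩ := exists_continuous_forall_mem_convex_of_local_const
    (t := fun t => J ⁻¹' Metric.ball (g t) ε)
    (fun t => (convex_ball (g t) ε).linear_preimage (J : D →ₗ[ℝ] X)) (fun t => by
      obtain ⟨y, hy⟩ := hJ.exists_dist_lt (g t) hε
      refine ⟨y, ?_⟩
      have : ∀ᶠ s in 𝓝 t, dist (g s) (J y) < ε :=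
        (hg.dist continuous_const).continuousAt.eventually_lt continuousAt_const hy
      filter_upwards [this] with s hs
      rwa [mem_preimage, Metric.mem_ball, dist_comm])
  refine ⟨φ, φ.continuous, fun t => ?_⟩
  have := hφ t
  rw [mem_preimage, Metric.mem_ball, dist_comm, dist_eq_norm] at this
  exact this.le

theorem exists_continuous_dom_approx (hJ : DenseRange J) (hq : 1 ≤ q) (hq' : q ≠ ⊤)
    (hf : MemLp f q (vol a b)) {ε : ℝ} (hε : 0 < ε) :
    ∃ φ : ℝ → D, Continuous φ ∧ lpn q a b (fun t => f t - J (φ t)) ≤ ε := by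
  obtain ⟨g, hg, hgm⟩ := hf.exists_boundedContinuous_eLpNorm_sub_le hq'
    (ε := ENNReal.ofReal (ε / 2)) (by simpa using hε)
  set k := lpn q a b fun _ => (1 : ℝ) with hk
  have hk0 : 0 ≤ k := lpn_nonneg _ _ _ _
  obtain ⟨φ, hφ, hgφ⟩ := exists_continuous_lift hJ g.continuous
    (ε := ε / (2 * (k + 1))) (by positivity)
  refine ⟨φ, hφ, ?_⟩
  have hJm : MemLp (fun t => J (φ t)) q (vol a b) :=
    memLp_of_continuousOn (J.continuous.comp hφ).continuousOn
  have h1 : lpn q a b (fun t => f t - g t) ≤ ε / 2 :=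
    ENNReal.toReal_le_of_le_ofReal (by positivity) hg
  have h2 : lpn q a b (fun t => g t - J (φ t)) ≤ ε / (2 * (k + 1)) * k :=
    lpn_le_mul (by positivity) (memLp_const 1) (Eventually.of_forall fun t => by
      simpa using hgφ t)
  have h3 := lpn_add_le hq (hf.sub hgm) (hgm.sub hJm)
  have h4 : ε / (2 * (k + 1)) * k ≤ ε / 2 := by
    rw [div_mul_eq_mul_div, div_le_div_iff₀ (by positivity) (by positivity)]
    nlinarith
  have h5 : (fun t => (f - ⇑g) t + (⇑g - fun t => J (φ t)) t) = fun t => f t - J (φ t) := by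
    funext t
    simp
  rw [h5] at h3
  exact h3.trans ((add_le_add h1 (h2.trans h4)).trans (by linarith))

/-- Exhaustion of `(a, b)` from the left and Fatou's lemma. It brings (H2), stated for `τ' < τ`, up
to the endpoint `τ`. -/
theorem eLpNorm_le_of_forall_lt {E : Type*} [NormedAddCommGroup E] {F : ℝ → E} {K : ℝ≥0∞}
    (hF : AEStronglyMeasurable F (vol a b)) (h : ∀ c, a < c → c < b → eLpNorm F p (vol a c) ≤ K) :
    eLpNorm F p (vol a b) ≤ K := by
  rcases le_or_gt b a with hab | hab
  · simp [vol, Ioo_eq_empty (not_lt.2 hab)]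
  have hba : 0 < b - a := sub_pos.2 hab
  set s : ℕ → ℝ := fun n => b - (b - a) / (n + 2) with hs
  have hsn : ∀ n, a < s n ∧ s n < b := fun n => by
    have hn : (0 : ℝ) ≤ n := n.cast_nonneg
    have h1 : 0 < (b - a) / ((n : ℝ) + 2) := by positivity
    have h2 : (b - a) / ((n : ℝ) + 2) < b - a := by
      rw [div_lt_iff₀ (by positivity)]
      nlinarith
    constructor <;> simp only [hs] <;> linarith
  have hlim : Tendsto s atTop (𝓝 b) := by
    have h1 : Tendsto (fun n : ℕ => (b - a) / ((n : ℝ) + 2)) atTop (𝓝 0) :=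
      tendsto_const_nhds.div_atTop
        (tendsto_atTop_add_const_right _ _ tendsto_natCast_atTop_atTop)
    simpa using h1.const_sub b
  refine Lp.eLpNorm_le_of_ae_tendsto (u := atTop) (f := fun n => (Ioo a (s n)).indicator F)
    (Eventually.of_forall fun n => ?_) (fun n => hF.indicator measurableSet_Ioo) ?_
  · rw [eLpNorm_indicator_eq_eLpNorm_restrict measurableSet_Ioo,
      restrict_vol_of_subset le_rfl (hsn n).2.le]
    exact h _ (hsn n).1 (hsn n).2
  · filter_upwards [ae_vol_mem a b] with t ht
    refine tendsto_const_nhds.congr' ?_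
    filter_upwards [hlim.eventually_const_lt ht.2] with n hn
    exact (indicator_of_mem (s := Ioo a (s n)) ⟨ht.1, hn⟩ F).symm

theorem lpn_le_rpow_mul {E : Type*} [NormedAddCommGroup E] {F : ℝ → E} (hqp : q ≤ p)
    (hab : a ≤ b) (hF : MemLp F p (vol a b)) (he : 0 ≤ 1 / q.toReal - 1 / p.toReal) :
    lpn q a b F ≤ (b - a) ^ (1 / q.toReal - 1 / p.toReal) * lpn p a b F := by
  have h1 := eLpNorm_le_eLpNorm_mul_rpow_measure_univ hqp hF.1
  rw [Measure.restrict_apply_univ, Real.volume_Ioo,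
    ENNReal.ofReal_rpow_of_nonneg (sub_nonneg.2 hab) he] at h1
  have h2 := ENNReal.toReal_mono (ENNReal.mul_ne_top hF.2.ne ENNReal.ofReal_ne_top) h1
  rw [ENNReal.toReal_mul, ENNReal.toReal_ofReal (Real.rpow_nonneg (sub_nonneg.2 hab) _),
    mul_comm] at h2
  exact h2

variable [CompleteSpace X] [CompleteSpace D]

/-- For continuous `D`-valued data the bound involves the `L^1` norm, and Hölder produces the power
of `b - a`. General `f` follows by density, the error being controlled through maximal regularity of
`A` and boundedness of `P`. -/
theorem lpn_perturbation_le (hJ : DenseRange J) (hq : 1 ≤ q) (hq' : q ≠ ⊤) (hab : a < b)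
    (hA : FamBdd A a b M) (hM : 0 ≤ M) (hP : FamBdd P a b N) (hN : 0 ≤ N) (hus : US J A q a b)
    (hL : 0 ≤ L) {U : ℝ → D → ℝ → D}
    (hU : ∀ s, a ≤ s → s < b → ∀ x, Sol J A q s b (fun _ => 0) (J x) (U s x))
    (hPU : ∀ s, a ≤ s → s < b → ∀ x, lpn q s b (fun t => P t (U s x t)) ≤ L * ‖J x‖)
    (hf : MemLp f q (vol a b)) {v : ℝ → D} (hv : Sol J A q a b f 0 v) :
    lpn q a b (fun t => P t (v t)) ≤ L * (b - a) ^ (1 - 1 / q.toReal) * lpn q a b f := by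
  obtain ⟨C, hC0, hC⟩ := hus.exists_bound hq hab hA hM
  set l := L * (b - a) ^ (1 - 1 / q.toReal) with hl
  have hl0 : 0 ≤ l := mul_nonneg hL (Real.rpow_nonneg (sub_nonneg.2 hab.le) _)
  have key : ∀ ε > 0, lpn q a b (fun t => P t (v t)) ≤ l * lpn q a b f + (l + N * C) * ε := by
    intro ε hε
    obtain ⟨φ, hφ, hfφ⟩ := exists_continuous_dom_approx hJ hq hq' hf hε
    have hJm : MemLp (fun t => J (φ t)) q (vol a b) :=
      memLp_of_continuousOn (J.continuous.comp hφ).continuousOn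
    obtain ⟨w, hw⟩ := hus.1 _ hJm
    have h1 := lpn_perturbation_le_of_continuous hq hab hA hM hP hN hus hL hU hPU hφ hw
    have h2 := lpn_one_le hq hab.le hJm
    have h3 := hv.sub hq hA hf hJm hw
    rw [sub_zero] at h3
    have h4 := hC _ _ (hf.sub hJm) h3
    have h5 : lpn q a b (fun t => P t (v t - w t)) ≤ N * lpn q a b (fun t => v t - w t) :=
      lpn_le_mul hN h3.memLp (hP.ae_le _)
    have h6 := lpn_add_le hq (hP.memLp hw.memLp) (hP.memLp h3.memLp)
    have h7 := lpn_sub_le hq hf (hf.sub hJm)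
    have e1 : (fun t => P t (w t) + P t (v t - w t)) = fun t => P t (v t) := by
      funext t
      rw [← map_add, add_sub_cancel]
    have e2 : (fun t => f t - (f - fun t => J (φ t)) t) = fun t => J (φ t) := by
      funext t
      simp
    rw [e1] at h6
    rw [e2] at h7
    have h8 : lpn q a b (f - fun t => J (φ t)) ≤ ε := hfφ
    calc lpn q a b (fun t => P t (v t))
        ≤ L * ((b - a) ^ (1 - 1 / q.toReal) * (lpn q a b f + ε)) + N * (C * ε) := by
          refine h6.trans (add_le_add (h1.trans ?_) (h5.trans ?_))
          · refine mul_le_mul_of_nonneg_left (h2.trans ?_) hL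
            exact mul_le_mul_of_nonneg_left (h7.trans (by linarith))
              (Real.rpow_nonneg (sub_nonneg.2 hab.le) _)
          · exact mul_le_mul_of_nonneg_left (h4.trans (mul_le_mul_of_nonneg_left h8 hC0)) hN
      _ = _ := by rw [hl]; ring
  have hlim : Tendsto (fun ε : ℝ => l * lpn q a b f + (l + N * C) * ε) (𝓝[>] 0)
      (𝓝 (l * lpn q a b f + (l + N * C) * 0)) :=
    ((by fun_prop : Continuous fun ε : ℝ => l * lpn q a b f + (l + N * C) * ε).tendsto 0).mono_left
      nhdsWithin_le_nhds
  rw [mul_zero, add_zero] at hlim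
  refine ge_of_tendsto hlim ?_
  filter_upwards [self_mem_nhdsWithin] with ε hε using key ε hε

/-- Maximal regularity is stable under perturbations which are bounded along the evolution
family. -/
theorem US.of_evolution_bound (hJ : DenseRange J) (hq : 1 ≤ q) (hqp : q ≤ p) (hp : 1 < p)
    (hp' : p ≠ ⊤) (hA : FamBdd A 0 τ M) (hM : 0 ≤ M) (hP : FamBdd P 0 τ N) (hN : 0 ≤ N)
    (hus : ∀ a b, 0 ≤ a → a < b → b ≤ τ → US J A q a b) (hc : 0 ≤ c) {U : ℝ → D → ℝ → D}
    (hU : ∀ s, 0 ≤ s → s < τ → ∀ x, Sol J A p s τ (fun _ => 0) (J x) (U s x))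
    (hPU : ∀ s, 0 ≤ s → s < τ → ∀ x, lpn p s τ (fun t => P t (U s x t)) ≤ c * ‖J x‖)
    (ha : 0 ≤ a) (hab : a < b) (hb : b ≤ τ) : US J (fun t => A t + P t) q a b := by
  have hq' : q ≠ ⊤ := ne_top_of_le_ne_top hp' hqp
  have hr : 1 < p.toReal := by simpa using (ENNReal.toReal_lt_toReal (by simp) hp').2 hp
  have hs : 1 ≤ q.toReal := by simpa using ENNReal.toReal_mono hq' hq
  have hsr : q.toReal ≤ p.toReal := ENNReal.toReal_mono hp' hqp
  have he : 0 ≤ 1 / q.toReal - 1 / p.toReal :=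
    sub_nonneg.2 (one_div_le_one_div_of_le (by linarith) hsr)
  set θ := 1 - 1 / p.toReal with hθ
  have hθ0 : 0 < θ := by
    rw [hθ, sub_pos, div_lt_one (by linarith)]
    exact hr
  -- Chosen so that `c δ^θ ≤ 1 / 2`. The exponent `θ = 1 - 1/p` is the sum of `1/q - 1/p`, from
  -- lowering the exponent in (H2), and `1 - 1/q`, from passing to `L^1`; it is positive since `p >
  -- 1`.
  set δ := (1 / (2 * (c + 1))) ^ (1 / θ) with hδ
  have hδ0 : 0 < δ := by positivity
  have hAP : FamBdd (fun t => A t + P t) 0 τ (M + N) :=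
    ⟨fun x => (hA.meas x).add (hP.meas x), fun t ht =>
      (norm_add_le _ _).trans (add_le_add (hA.bound t ht) (hP.bound t ht))⟩
  refine US.of_local hq hAP hδ0 (fun a b ha hab hb hle => ?_) ha hab hb
  have hba : 0 < b - a := sub_pos.2 hab
  have hAab := hA.mono ha hb
  have hPab := hP.mono ha hb
  refine (hus a b ha hab hb).perturb hq hab hAab hM hPab hN (κ := 1 / 2) (by norm_num)
    fun f v hf hv => ?_
  set L := c * (b - a) ^ (1 / q.toReal - 1 / p.toReal) with hL
  have hU' : ∀ s, a ≤ s → s < b → ∀ x, Sol J A q s b (fun _ => 0) (J x) (U s x) :=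
    fun s has hsb x => ((hU s (ha.trans has) (hsb.trans_le hb) x).restrict_right hb).mono_exponent hqp
  have hPU' : ∀ s, a ≤ s → s < b → ∀ x, lpn q s b (fun t => P t (U s x t)) ≤ L * ‖J x‖ := by
    intro s has hsb x
    have hs0 := ha.trans has
    have hm : MemLp (fun t => P t (U s x t)) p (vol s τ) :=
      (hP.mono hs0 le_rfl).memLp (hU s hs0 (hsb.trans_le hb) x).memLp
    have h1 := lpn_le_rpow_mul hqp hsb.le (memLp_subinterval hm le_rfl hb) he
    have h2 := (lpn_subinterval hm le_rfl hb).trans (hPU s hs0 (hsb.trans_le hb) x)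
    have h3 : (b - s) ^ (1 / q.toReal - 1 / p.toReal) ≤ (b - a) ^ (1 / q.toReal - 1 / p.toReal) :=
      Real.rpow_le_rpow (by linarith) (by linarith) he
    calc _ ≤ _ := h1
      _ ≤ (b - a) ^ (1 / q.toReal - 1 / p.toReal) * (c * ‖J x‖) :=
        mul_le_mul h3 h2 (lpn_nonneg _ _ _ _) (by positivity)
      _ = _ := by rw [hL]; ring
  have hfin := lpn_perturbation_le hJ hq hq' hab hAab hM hPab hN (hus a b ha hab hb)
    (by positivity : 0 ≤ L) hU' hPU' hf hv
  refine hfin.trans (mul_le_mul_of_nonneg_right ?_ (lpn_nonneg _ _ _ _))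
  rw [hL, mul_assoc, ← Real.rpow_add hba, show 1 / q.toReal - 1 / p.toReal + (1 - 1 / q.toReal) = θ
    by rw [hθ]; ring]
  have h1 : (b - a) ^ θ ≤ 1 / (2 * (c + 1)) := by
    refine (Real.rpow_le_rpow hba.le hle hθ0.le).trans (le_of_eq ?_)
    rw [hδ, ← Real.rpow_mul (by positivity), one_div_mul_cancel hθ0.ne', Real.rpow_one]
  calc c * (b - a) ^ θ ≤ c * (1 / (2 * (c + 1))) := mul_le_mul_of_nonneg_left h1 hc
    _ ≤ 1 / 2 := by
      rw [mul_one_div, div_le_div_iff₀ (by positivity) (by norm_num)]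
      linarith

end Perturbation

/-! ### The evolution family in integrated form -/

section Transfer

variable {𝕜 : Type*} [RCLike 𝕜]
variable {X : Type*} [NormedAddCommGroup X] [NormedSpace 𝕜 X] [NormedSpace ℝ X]
variable {D : Type*} [NormedAddCommGroup D] [NormedSpace 𝕜 D] [NormedSpace ℝ D]
  [IsScalarTower ℝ 𝕜 D]
variable {J : D →L[𝕜] X} {A : ℝ → D →L[𝕜] X} {M τ : ℝ}

theorem StronglyMeasurableBounded.famBdd (h : StronglyMeasurableBounded τ A) :
    ∃ M, 0 ≤ M ∧ FamBdd (fun t => (A t).restrictScalars ℝ) 0 τ M := by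
  obtain ⟨hm, M, hM⟩ := h
  refine ⟨|M|, abs_nonneg _, fun x => (hm x).mono_measure
    (Measure.restrict_mono Ioo_subset_Icc_self le_rfl), fun t ht => ?_⟩
  rw [ContinuousLinearMap.norm_restrictScalars]
  exact (hM t (Ioo_subset_Icc_self ht)).trans (le_abs_self M)

variable [CompleteSpace X]

theorem SingleMR.us [CompleteSpace D] {B : D →L[𝕜] X} (h : SingleMR J B) (hJ : Function.Injective J) {q : ℝ≥0∞}
    (hq : 1 < q) (hq' : q ≠ ⊤) {a b : ℝ} (hab : a < b) :
    US (J.restrictScalars ℝ) (fun _ => B.restrictScalars ℝ) q a b := by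
  obtain ⟨p, hp, hB⟩ := h
  refine US.change_exponent (p := ENNReal.ofReal p) (by simpa using hp) ENNReal.ofReal_ne_top hq hq'
    (fun a b hab => ?_) hab
  exact (uniquelySolvable_iff hJ hp.le hab (FamBdd.const (B.restrictScalars ℝ) a b)).1 (hB a b hab)

/-- The function chosen in the definition solves the problem for some unknown exponent `r`.
Uniqueness for the exponent `min p r` identifies it a.e. with the solution for `p`. -/
theorem evolutionFamily_sol (hA : FamBdd (fun t => (A t).restrictScalars ℝ) 0 τ M)
    (hus : ∀ q : ℝ≥0∞, 1 < q → q ≠ ⊤ → ∀ a b, 0 ≤ a → a < b → b ≤ τ →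
      US (J.restrictScalars ℝ) (fun t => (A t).restrictScalars ℝ) q a b)
    {p : ℝ} (hp : 1 < p) {s : ℝ} (hs : 0 ≤ s) (hsτ : s < τ) (x : D) :
    Sol (J.restrictScalars ℝ) (fun t => (A t).restrictScalars ℝ) (ENNReal.ofReal p) s τ
      (fun _ => 0) (J x) (fun t => evolutionFamily J A τ t s x) := by
  have hAs := hA.mono hs le_rfl
  have hz : ∀ q : ℝ≥0∞, MemLp (fun _ : ℝ => (0 : X)) q (vol s τ) := fun q => MemLp.zero
  obtain ⟨w, hw⟩ := (hus (ENNReal.ofReal p) (by simpa using hp) ENNReal.ofReal_ne_top s τ hs hsτ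
    le_rfl).exists_sol_init hAs (hz _) x
  have hex : ∃ v : ℝ → D, ∃ (p : ℝ) (u : ℝ → X), 1 < p ∧
      IsSolution J A p s τ (fun _ => 0) (J x) u v :=
    ⟨w, p, _, hp, (isSolution_iff hp.le hsτ hAs (hz _)).2 ⟨hw, fun t _ => rfl⟩⟩
  obtain ⟨r, u, hr, hsol⟩ := hex.choose_spec
  have h1 := ((isSolution_iff hr.le hsτ hAs (hz _)).1 hsol).1
  have hm : 1 < ENNReal.ofReal (min p r) := by simpa using ⟨hp, hr⟩
  have hmp : ENNReal.ofReal (min p r) ≤ ENNReal.ofReal p := ENNReal.ofReal_le_ofReal (min_le_left _ _)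
  have hmr : ENNReal.ofReal (min p r) ≤ ENNReal.ofReal r :=
    ENNReal.ofReal_le_ofReal (min_le_right _ _)
  have huniq := (hus _ hm ENNReal.ofReal_ne_top s τ hs hsτ le_rfl).unique hm.le hAs (hz _)
    (hw.mono_exponent hmp) (h1.mono_exponent hmr)
  refine hw.congr (ae_eq_refl _) (huniq.trans (Eventually.of_forall fun t => ?_))
  simp only [evolutionFamily, dif_pos hex]

end Transfer

end MaxReg

/-! ### Proof of the main theorem -/

theorem mainTheorem2 {𝕜 : Type*} [RCLike 𝕜]
    {X : Type*} [NormedAddCommGroup X] [NormedSpace 𝕜 X] [NormedSpace ℝ X] [CompleteSpace X]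
    {D : Type*} [NormedAddCommGroup D] [NormedSpace 𝕜 D] [CompleteSpace D]
    (J : D →L[𝕜] X) (hJinj : Function.Injective J) (hJdense : DenseRange J)
    (τ : ℝ) (hτ : 0 < τ) (A P : ℝ → D →L[𝕜] X)
    (hA : MaxReg.StronglyMeasurableBounded τ A)
    (hP : MaxReg.StronglyMeasurableBounded τ P)
    (hH1 : MaxReg.H1 J τ A) (μ : ℝ) (hH2 : MaxReg.H2 J τ A P μ)
    (q : ℝ) (hq : 1 < q) (hqμ : q ≤ μ) :
    MaxReg.FamilyMR J q τ (fun t => A t + P t) := by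
  open MaxReg in
  -- The integrated theory is real, so `D` receives its real structure by restriction of scalars.
  let _ : NormedSpace ℝ D := NormedSpace.restrictScalars ℝ 𝕜 D
  have _ : IsScalarTower ℝ 𝕜 D := IsScalarTower.of_algebraMap_smul fun r x => rfl
  obtain ⟨M, hM, hAM⟩ := hA.famBdd
  obtain ⟨N, hN, hPN⟩ := hP.famBdd
  obtain ⟨hsingle, ν, -, η, hη, w, hwc, -, hw0, -, hdini⟩ := hH1
  obtain ⟨hμ, c, hc, hPU⟩ := hH2
  have hus : ∀ q : ℝ≥0∞, 1 < q → q ≠ ⊤ → ∀ a b, 0 ≤ a → a < b → b ≤ τ →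
      US (J.restrictScalars ℝ) (fun t => (A t).restrictScalars ℝ) q a b :=
    fun q hq hq' a b ha hab hb => US.of_relatively_continuous hq hτ hAM hη hwc hw0 hdini
      (fun t ht a b hab => (hsingle t ht).us hJinj hq hq' hab) ha hab hb
  have hU : ∀ s, 0 ≤ s → s < τ → ∀ x, Sol (J.restrictScalars ℝ)
      (fun t => (A t).restrictScalars ℝ) (ENNReal.ofReal μ) s τ (fun _ => 0) (J x)
      (fun t => evolutionFamily J A τ t s x) :=
    fun s hs hsτ x => evolutionFamily_sol hAM hus hμ hs hsτ x
  intro a b ha hab hb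
  rw [uniquelySolvable_iff (M := M + N) hJinj hq.le hab]
  · refine US.of_evolution_bound (A := fun t => (A t).restrictScalars ℝ)
      (P := fun t => (P t).restrictScalars ℝ)
      (U := fun s x t => evolutionFamily J A τ t s x) hJdense
      (by simpa using hq.le) (ENNReal.ofReal_le_ofReal hqμ) (by simpa using hμ)
      ENNReal.ofReal_ne_top hAM hM hPN hN (hus _ (by simpa using hq) ENNReal.ofReal_ne_top) hc.le hU
      (fun s hs hsτ x => ?_) ha hab hb
    refine ENNReal.toReal_le_of_le_ofReal (mul_nonneg hc.le (norm_nonneg _)) ?_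
    refine eLpNorm_le_of_forall_lt
      ((hPN.mono hs le_rfl).memLp (hU s hs hsτ x).memLp).1 fun τ' h1 h2 => ?_
    exact hPU s τ' hs h1 h2 x
  · exact ⟨fun x => ((hAM.mono ha hb).meas x).add ((hPN.mono ha hb).meas x), fun t ht =>
      (norm_add_le _ _).trans (add_le_add ((hAM.mono ha hb).bound t ht)
        ((hPN.mono ha hb).bound t ht))⟩
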